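/- Let $p\in\mathbb P^1=\mathbb C\cup\{\infty\}$, and for every $r\ge 0$ let $b^{(r)}_1,\dots,b^{(r)}_r$ be distinct points of $\mathbb P^1\setminus\{p\}$. For $d,g\ge 0$ and a finitely supported $m=(m_1,m_2,\dots)$ of nonnegative integers (encoding the unordered partition $\alpha$ with $m_a$ parts equal to $a$), put $r=2d+2g-2-\sum_a(a-1)m_a$ and, if $r\ge 0$, let $N_{d,g}(\alpha)$ be the number of isomorphism classes, each counted with weight $1/|\mathrm{Aut}|$, of branched covers $f:C\to\mathbb P^1$ of degree $d$ by connected closed surfaces $C$ of genus $g$ that have exactly $m_a$ preimages of $p$ with ramification index $a$ for each $a\ge1$, are simply branched over each of $b^{(r)}_1,\dots,b^{(r)}_r$, and are unramified elsewhere. Here the preimages of $p$ with equal ramification index are numbered, and isomorphisms respect the numbering; thus $N_{d,g}(\alpha)$ is $\prod_a m_a!$ times the weighted number of covers with unnumbered preimages. (A branched cover is a continuous map from a compact Hausdorff space that is $w\mapsto w^e$, $e\ge 1$, in suitable local coordinates near every point.) These covers form finitely many isomorphism classes, and their automorphism groups are finite. The generating function $$G=\sum_{d,g,m}N_{d,g}(\alpha)\prod_{a\ge1}\frac{z_a^{m_a}}{m_a!}\;\frac{u^r}{r!}\;t^d\,\lambda^{2g-2},\qquad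 r=2d+2g-2-\sum_a(a-1)m_a\ge 0,$$ a formal power series in the $z_a$ $(a\ge 1)$, $u$, $t$ with coefficients in $\mathbb Q[\lambda,\lambda^{-1}]$, satisfies the cut-join equation $$\partial_uG=\frac12\sum_{i,j\ge1}\Big(ij\,\lambda^2z_{i+j}\big[\partial_{z_i}\partial_{z_j}G+\partial_{z_i}G\cdot\partial_{z_j}G\big]+(i+j)\,z_iz_j\,\partial_{z_{i+j}}G\Big),$$ where the sum over $(i,j)$ is a finite sum in every coefficient. -/

import Mathlib

open scoped LaurentPolynomial

noncomputable section

namespace Hurwitz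

/-- The sphere `ℙ¹ = ℂ ∪ {∞}`. -/
abbrev Sphere : Type := OnePoint ℂ

/-- `f` has ramification index `e ≥ 1` at `x`: in suitable local coordinates centred at `x` and at
`f x`, the map `f` is `w ↦ w ^ e`. -/
def HasRamificationIndex {C : Type} [TopologicalSpace C] (f : C → Sphere) (x : C) (e : ℕ) : Prop :=
  0 < e ∧ ∃ (φ : OpenPartialHomeomorph C ℂ) (ψ : OpenPartialHomeomorph Sphere ℂ),
    x ∈ φ.source ∧ φ x = 0 ∧ f x ∈ ψ.source ∧ ψ (f x) = 0 ∧
    ∀ y ∈ φ.source, f y ∈ ψ.source ∧ ψ (f y) = φ y ^ e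

/-- The closed (orientable) surface `C` has genus `g`: it has a finite cell decomposition with `n k`
open cells `c k i ≅ ℝᵏ` of dimension `k = 0, 1, 2`, the boundary of each cell lying in the union of
the cells of lower dimension, such that `n 0 - n 1 + n 2 = 2 - 2 g`. -/
def HasGenus (C : Type) [TopologicalSpace C] (g : ℕ) : Prop :=
  ∃ (n : Fin 3 → ℕ) (c : (k : Fin 3) → Fin (n k) → Set C),
    (∀ k i, Nonempty (c k i ≃ₜ (Fin (k : ℕ) → ℝ))) ∧
    (∀ x : C, ∃! s : Σ k : Fin 3, Fin (n k), x ∈ c s.1 s.2) ∧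
    (∀ k i, closure (c k i) \ c k i ⊆ ⋃ (j : Fin 3) (_ : j < k) (i' : Fin (n j)), c j i') ∧
    (n 0 : ℤ) - n 1 + n 2 = 2 - 2 * g

/-- A branched cover of the sphere: a continuous map to `ℙ¹` from a nonempty connected compact
Hausdorff space, which near every point is `w ↦ w ^ e` for some `e ≥ 1` in local coordinates. -/
structure BranchedCover where
  C : Type
  [top : TopologicalSpace C]
  [compact : CompactSpace C]
  [hausdorff : T2Space C]
  [connected : ConnectedSpace C]
  f : C → Sphere
  continuous_f : Continuous f
  locally_power : ∀ x, ∃ e, HasRamificationIndex f x e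

attribute [instance] BranchedCover.top BranchedCover.compact BranchedCover.hausdorff
  BranchedCover.connected

/-- A connected branched cover of `ℙ¹` of degree `d` and genus `g`, simply branched over each of the
points `b i`, with exactly `m a` preimages of `p` of ramification index `a` for every `a ≥ 1`
(these are numbered, separately for each `a`), and unramified elsewhere. -/
structure HurwitzCover (p : Sphere) {r : ℕ} (b : Fin r → Sphere) (d g : ℕ) (m : ℕ+ →₀ ℕ)
    extends BranchedCover where
  /-- the fibres over points which are not branch points have `d` elements -/
  degree : ∀ q, q ≠ p → (∀ i, q ≠ b i) → Nat.card (f ⁻¹' {q}) = d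
  genus : HasGenus C g
  /-- the numbering of the preimages of `p` -/
  label : (Σ a : ℕ+, Fin (m a)) ≃ f ⁻¹' {p}
  label_index : ∀ s, HasRamificationIndex f (label s : C) (s.1 : ℕ)
  simple : ∀ i, ∃ x, f x = b i ∧ HasRamificationIndex f x 2 ∧
    ∀ y, f y = b i → y ≠ x → HasRamificationIndex f y 1
  unramified : ∀ x, f x ≠ p → (∀ i, f x ≠ b i) → HasRamificationIndex f x 1

namespace HurwitzCover

variable {p : Sphere} {r : ℕ} {b : Fin r → Sphere} {d g : ℕ} {m : ℕ+ →₀ ℕ}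

/-- Isomorphisms of covers: homeomorphisms over `ℙ¹` that respect the numbering of the points
over `p`. -/
def Iso (X Y : HurwitzCover p b d g m) : Type :=
  {φ : X.C ≃ₜ Y.C // (∀ x, Y.f (φ x) = X.f x) ∧ ∀ s, φ (X.label s) = (Y.label s : Y.C)}

instance isoSetoid (p : Sphere) {r : ℕ} (b : Fin r → Sphere) (d g : ℕ) (m : ℕ+ →₀ ℕ) :
    Setoid (HurwitzCover p b d g m) where
  r X Y := Nonempty (Iso X Y)
  iseqv :=
    { refl := fun X => ⟨⟨Homeomorph.refl _, fun _ => rfl, fun _ => rfl⟩⟩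
      symm := by
        rintro X Y ⟨⟨φ, h1, h2⟩⟩
        refine ⟨⟨φ.symm, fun y => ?_, fun s => ?_⟩⟩
        · rw [← h1, φ.apply_symm_apply]
        · rw [← h2, φ.symm_apply_apply]
      trans := by
        rintro X Y Z ⟨⟨φ, h1, h2⟩⟩ ⟨⟨χ, k1, k2⟩⟩
        refine ⟨⟨φ.trans χ, fun x => ?_, fun s => ?_⟩⟩
        · rw [Homeomorph.trans_apply, k1, h1]
        · rw [Homeomorph.trans_apply, h2, k2] }

end HurwitzCover

/-- Isomorphism classes of covers. -/
abbrev CoverClass (p : Sphere) {r : ℕ} (b : Fin r → Sphere) (d g : ℕ) (m : ℕ+ →₀ ℕ) : Type 1 :=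
  Quotient (HurwitzCover.isoSetoid p b d g m)

/-- The Hurwitz number: the number of isomorphism classes of covers, each counted with weight
`1 / |Aut|`. -/
def hurwitzNumber (p : Sphere) {r : ℕ} (b : Fin r → Sphere) (d g : ℕ) (m : ℕ+ →₀ ℕ) : ℚ :=
  ∑ᶠ c : CoverClass p b d g m, 1 / (Nat.card (HurwitzCover.Iso c.out c.out) : ℚ)

/-- The formal variables `z_a` (`a ≥ 1`), `u` and `t`. -/
inductive Var where
  | z (a : ℕ+)
  | u
  | t

lemma Var.z_injective : Function.Injective Var.z := fun _ _ h => Var.z.inj h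

/-- Formal power series in the `z_a`, `u`, `t` whose coefficients are Laurent polynomials in `λ`
(written `T` in Mathlib: `λ ^ k` is `LaurentPolynomial.T k`). -/
abbrev Series : Type := MvPowerSeries Var ℚ[T;T⁻¹]

/-- The exponents of the `z_a` in the monomial `z ^ m u ^ r t ^ d` with exponent vector `n`. -/
def zExponents (n : Var →₀ ℕ) : ℕ+ →₀ ℕ := n.comapDomain Var.z Var.z_injective.injOn

/-- The generating function
`G = ∑ N_{d,g}(m) ∏_a (z_a ^ (m a) / (m a)!) (u ^ r / r!) t ^ d λ ^ (2 g - 2)`, the sum running over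
`d, g ≥ 0` and `m`, with `r = 2 d + 2 g - 2 - ∑_a (a - 1) m_a` simple branch points `b r i`. Given
`m`, `r` and `d`, at most one `g` contributes. -/
def generatingFunction (p : Sphere) (b : (r : ℕ) → Fin r → Sphere) : Series := fun n =>
  let m := zExponents n
  let r := n Var.u
  let d := n Var.t
  ∑ᶠ (g : ℕ) (_ : (r : ℤ) = 2 * d + 2 * g - 2 - m.sum fun a k => ((a : ℤ) - 1) * k),
    LaurentPolynomial.C
        (hurwitzNumber p (b r) d g m / ((m.prod fun _ k => (k.factorial : ℚ)) * r.factorial)) *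
      LaurentPolynomial.T (2 * (g : ℤ) - 2)

/-- `S` is the sum of the family `F` of formal series: every coefficient is a finite sum. -/
def HasFormalSum {ι : Type} (F : ι → Series) (S : Series) : Prop :=
  ∀ n : Var →₀ ℕ, {i | MvPowerSeries.coeff n (F i) ≠ 0}.Finite ∧
    MvPowerSeries.coeff n S = ∑ᶠ i, MvPowerSeries.coeff n (F i)

/-- The variable `z_a`. -/
def z (a : ℕ+) : Series := MvPowerSeries.X (Var.z a)

/-- The partial derivative `∂/∂v`. -/
def partialDeriv (v : Var) (F : Series) : Series := MvPowerSeries.pderiv ℚ[T;T⁻¹] v F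

/-- The constant series `λ²`. -/
def lambdaSq : Series := MvPowerSeries.C (LaurentPolynomial.T 2)

/-- `i j λ² z_{i+j} [∂_{z_i} ∂_{z_j} G + ∂_{z_i} G ∂_{z_j} G] + (i + j) z_i z_j ∂_{z_{i+j}} G`. -/
def cutJoinTerm (G : Series) (i j : ℕ+) : Series :=
  ((i : ℕ) : Series) * ((j : ℕ) : Series) * lambdaSq * z (i + j) *
      (partialDeriv (Var.z i) (partialDeriv (Var.z j) G) +
        partialDeriv (Var.z i) G * partialDeriv (Var.z j) G) +
    (((i : ℕ) : Series) + ((j : ℕ) : Series)) * z i * z j * partialDeriv (Var.z (i + j)) G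

end Hurwitz

end

noncomputable section

namespace Hurwitz

open Set Filter Topology

/-! ### Topological preliminaries -/

/-! The weighted count of covers is a count of permutations, and the cut-join equation records what
happens to these permutations when one transposition is removed.

Geometry. A homeomorphism of the sphere moves `p` to `∞` and the branch points to real numbers `b 0
< b 1 < ...` without changing the Hurwitz number (`exists_homeomorph_strictMono`,
`HurwitzCover.hurwitzNumber_transport`). Cut the sphere along the real circle. Both open half planes
are simply connected and contain no branch point, so the cover consists of `d` sheets over each, and
the sheets extend continuously to the closed half planes. Upper and lower sheets are glued along the
`r + 1` arcs by permutations `g j`, normalised by `g 0 = 1`. The points over a point `q` of the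
circle are the cycles of `(g left)⁻¹ * g right`, and the ramification index is the cycle length
(`Sheets.s_eq_iff_sameCycle`, `Sheets.ramificationIndex_eq`). Hence simple branching means that
consecutive quotients are transpositions, the cycles of the last `g` are the points over `∞`, and
connectedness means transitivity. The permutations determine the cover (`Sheets.exists_homeomorph`),
and every transitive system occurs (`exists_branchedCover`), with charts built from branches of the
`e`-th root. The genus comes from the cells cut out by the circle (`Sheets.hasGenus`). Isomorphisms
act freely on the `d!` numberings of the sheets, with the monodromy data as orbits, so the weighted
count is the number of data divided by `d!` (`hurwitzNumber_real`).

Combinatorics. The data are words of `r` transpositions together with labels for the cycles of the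
product. Writing each transposition as an ordered pair of points costs a factor `2 ^ r`, and the
labels give `∏ m_a!` (`card_isMonodromy`). Remove the first letter `(x, y)` of a transitive word. If
the rest is still transitive, multiplication by the transposition cuts a cycle of length `i + j`
into `i` and `j` or joins two such cycles (`cycleTypeOn_cut`, `cycleTypeOn_join`): these are the two
terms linear in `G`. Otherwise the rest splits into words on two complementary blocks, one
containing `x` and the other `y`, which are shuffled freely, and the letter joins a cycle of one
block to a cycle of the other: this is the term `∂G · ∂G` (`ite_isTransOn_cons`,
`sum_words_shuffle`). Division by `2 ^ r r! d!` absorbs the binomial coefficients and leaves the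
factor `1/2` (`weight_succ`).

The power of `λ` is additive in the exponent vector, which makes all terms match, and the same
recursion shows that every nonzero count belongs to a genus `g ≥ 0` (`exists_genus`), so that the
sum over `g` loses nothing. -/

lemma isPreconnected_punctured_ball (ρ : ℝ) : IsPreconnected (Metric.ball (0 : ℂ) ρ \ {0}) := by
  have h : Metric.ball (0 : ℂ) ρ \ {0} =
      (fun q : ℝ × ℝ => (q.1 : ℂ) * Complex.exp (q.2 * Complex.I)) '' (Ioo 0 ρ ×ˢ univ) := by
    ext w
    simp only [Set.mem_sdiff, Metric.mem_ball, dist_zero_right, mem_singleton_iff, mem_image, mem_prod,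
      mem_Ioo, mem_univ, and_true, Prod.exists]
    constructor
    · rintro ⟨h1, h2⟩
      exact ⟨‖w‖, w.arg, ⟨norm_pos_iff.2 h2, h1⟩, Complex.norm_mul_exp_arg_mul_I w⟩
    · rintro ⟨a, t, ⟨h1, h2⟩, rfl⟩
      simp [Complex.norm_exp_ofReal_mul_I, abs_of_pos h1, h2, h1.ne', Complex.exp_ne_zero]
  rw [h]
  exact (isPreconnected_Ioo.prod isPreconnected_univ).image _ (by fun_prop)

lemma ncard_pow_eq {e : ℕ} (he : 0 < e) {w : ℂ} (hw : w ≠ 0) : {v : ℂ | v ^ e = w}.ncard = e := by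
  classical
  have hζ := Complex.isPrimitiveRoot_exp e he.ne'
  obtain ⟨α, hα⟩ := IsAlgClosed.exists_pow_nat_eq w he
  have h : {v : ℂ | v ^ e = w} = ((Polynomial.nthRoots e w).toFinset : Set ℂ) := by
    ext v; simp [Polynomial.mem_nthRoots he]
  rw [h, Set.ncard_coe_finset, Multiset.toFinset_card_of_nodup (hζ.nthRoots_nodup hw),
    hζ.card_nthRoots, if_pos ⟨α, hα⟩]

/-- If `f` is a closed map whose fibre over `q` is finite and `f ∘ s` tends to `q` along a filter
with a basis of sets with connected images under `s`, then `s` converges. -/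
lemma exists_tendsto_of_finite_fiber {C S Z : Type*} [TopologicalSpace C] [TopologicalSpace S]
    [CompactSpace C] [T2Space C] [T2Space S] {f : C → S} (hf : Continuous f) {q : S}
    (fin : (f ⁻¹' {q}).Finite) {l : Filter Z} [NeBot l] {s : Z → C}
    (hs : Tendsto (fun z => f (s z)) l (𝓝 q))
    (hconn : ∀ U ∈ l, ∃ U' ∈ l, U' ⊆ U ∧ IsPreconnected (s '' U')) :
    ∃ x, f x = q ∧ Tendsto s l (𝓝 x) := by
  obtain ⟨V, hV, disj⟩ := fin.t2_separation
  -- Since `f` is closed, the preimages of neighbourhoods of `q` shrink into any given neighbourhood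
  -- of the fibre.
  have key : ∀ N : C → Set C, (∀ x ∈ f ⁻¹' {q}, N x ∈ 𝓝 x) →
      ∀ᶠ z in l, ∃ x, f x = q ∧ s z ∈ N x := by
    intro N hN
    have h1 : (⋃ x ∈ f ⁻¹' {q}, N x) ∈ 𝓝ˢ (f ⁻¹' {q}) := by
      rw [mem_nhdsSet_iff_forall]
      intro x hx
      exact mem_of_superset (hN x hx) (subset_biUnion_of_mem hx)
    obtain ⟨W, hW, hWV⟩ := isClosedMap_iff_comap_nhds_le.mp hf.isClosedMap h1
    filter_upwards [hs hW] with z hz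
    have := hWV hz
    simp only [mem_iUnion, mem_preimage, mem_singleton_iff, exists_prop] at this
    exact this
  obtain ⟨U', hU', hsub, hpre⟩ := hconn _ (key V fun x _ => (hV x).2.mem_nhds (hV x).1)
  obtain ⟨z₀, hz₀⟩ := Filter.nonempty_of_mem hU'
  obtain ⟨x, hx, hxz⟩ := hsub hz₀
  -- A connected set covered by the disjoint open sets `V y` stays in the one that it meets.
  have hall : s '' U' ⊆ V x := by
    refine hpre.subset_left_of_subset_union (v := ⋃ y ∈ (f ⁻¹' {q}) \ {x}, V y) (hV x).2
      (isOpen_biUnion fun y _ => (hV y).2) ?_ ?_ ⟨_, mem_image_of_mem s hz₀, hxz⟩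
    · rw [disjoint_iUnion₂_right]
      intro y hy
      exact disj hx hy.1 (fun h => hy.2 h.symm)
    · rintro _ ⟨z, hz, rfl⟩
      obtain ⟨y, hy, hyz⟩ := hsub hz
      by_cases hxy : y = x
      · exact Or.inl (hxy ▸ hyz)
      · exact Or.inr (mem_biUnion (show y ∈ (f ⁻¹' {q}) \ {x} from ⟨hy, hxy⟩) hyz)
  refine ⟨x, hx, fun N hN => ?_⟩
  classical
  -- Only the neighbourhood of `x` is shrunk to `N`; the other alternatives are excluded because `s`
  -- already stays in `V x`.
  have h2 := key (fun y => if y = x then N ∩ V x else V y) (by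
    intro y _
    split_ifs with h
    · subst h; exact inter_mem hN ((hV y).2.mem_nhds (hV y).1)
    · exact (hV y).2.mem_nhds (hV y).1)
  rw [mem_map]
  filter_upwards [h2, hU'] with z hz hzU
  obtain ⟨y, hy, hyz⟩ := hz
  split_ifs at hyz with h
  · exact hyz.1
  · exact absurd (hall (mem_image_of_mem s hzU))
      (Set.disjoint_left.1 (disj hy hx h) hyz)

/-! ### The local structure of a branched cover -/

section Local

variable {C : Type} [TopologicalSpace C] {f : C → Sphere} {x : C} {e : ℕ}

/-- Near a point of ramification index `e`, there are arbitrarily small connected punctured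
neighbourhoods which `f` maps `e`-to-one. -/
lemma HasRamificationIndex.exists_nhds (h : HasRamificationIndex f x e) {N : Set C} (hN : N ∈ 𝓝 x) :
    ∃ N' ⊆ N, IsOpen N' ∧ x ∈ N' ∧ IsPreconnected (N' \ {x}) ∧ (∀ y ∈ N', f y = f x → y = x) ∧
      ∀ᶠ z in 𝓝 (f x), z ≠ f x → {y ∈ N' | f y = z}.ncard = e := by
  obtain ⟨he, φ, ψ, hx, hx0, hfx, hfx0, hpow⟩ := h
  have h0 : (0 : ℂ) ∈ φ.target := hx0 ▸ φ.map_source hx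
  have hsymm0 : φ.symm 0 = x := by rw [← hx0, φ.left_inv hx]
  have h1 : φ.symm ⁻¹' N ∩ φ.target ∈ 𝓝 (0 : ℂ) := by
    refine inter_mem ?_ (φ.open_target.mem_nhds h0)
    exact (φ.symm.continuousAt h0).preimage_mem_nhds (by rwa [hsymm0])
  obtain ⟨δ, hδ, hball⟩ := Metric.mem_nhds_iff.1 h1
  have hbt : Metric.ball (0 : ℂ) δ ⊆ φ.target := fun w hw => (hball hw).2
  have himg : ∀ y, y ∈ φ.symm '' Metric.ball (0 : ℂ) δ ↔ y ∈ φ.source ∧ ‖φ y‖ < δ := by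
    intro y
    constructor
    · rintro ⟨w, hw, rfl⟩
      refine ⟨φ.map_target (hbt hw), ?_⟩
      rw [φ.right_inv (hbt hw)]
      simpa using hw
    · rintro ⟨hy, hy'⟩
      exact ⟨φ y, by simpa using hy', φ.left_inv hy⟩
  refine ⟨φ.symm '' Metric.ball 0 δ, ?_, ?_, ?_, ?_, ?_, ?_⟩
  · rintro _ ⟨w, hw, rfl⟩
    exact (hball hw).1
  · exact φ.symm.isOpen_image_of_subset_source Metric.isOpen_ball hbt
  · exact ⟨0, by simpa using hδ, hsymm0⟩
  · have : φ.symm '' Metric.ball 0 δ \ {x} = φ.symm '' (Metric.ball 0 δ \ {0}) := by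
      ext y
      constructor
      · rintro ⟨⟨w, hw, rfl⟩, hy⟩
        refine ⟨w, ⟨hw, fun h0 => hy ?_⟩, rfl⟩
        rw [mem_singleton_iff] at h0 ⊢
        rw [h0, hsymm0]
      · rintro ⟨w, ⟨hw, hw0⟩, rfl⟩
        refine ⟨⟨w, hw, rfl⟩, fun h => hw0 ?_⟩
        rw [mem_singleton_iff] at h ⊢
        rw [← φ.right_inv (hbt hw), h, hx0]
    rw [this]
    exact (isPreconnected_punctured_ball δ).image _
      (φ.symm.continuousOn.mono (sdiff_subset.trans hbt))
  · intro y hy hfy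
    obtain ⟨hy1, -⟩ := (himg y).1 hy
    have := (hpow y hy1).2
    rw [hfy, hfx0] at this
    have h2 : φ y = 0 := by
      simpa [he.ne'] using this.symm
    rw [← φ.left_inv hy1, h2, hsymm0]
  -- With radius `δ ^ e` in the target, all `e` roots of `ψ z` lie in the ball of radius `δ`.
  · have h2 : ψ.source ∩ ψ ⁻¹' Metric.ball 0 (δ ^ e) ∈ 𝓝 (f x) := by
      refine inter_mem (ψ.open_source.mem_nhds hfx) ?_
      refine (ψ.continuousAt hfx).preimage_mem_nhds ?_
      rw [hfx0]
      exact Metric.ball_mem_nhds _ (by positivity)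
    filter_upwards [h2] with z hz hzx
    have hz0 : ψ z ≠ 0 := by
      intro h
      exact hzx (ψ.injOn hz.1 hfx (by rw [h, hfx0]))
    rw [← ncard_pow_eq he hz0]
    symm
    refine Set.ncard_congr (fun v _ => φ.symm v) ?_ ?_ ?_
    · intro v hv
      have hv1 : v ∈ Metric.ball (0 : ℂ) δ := by
        have h3 : ‖ψ z‖ < δ ^ e := by simpa using hz.2
        rw [← (show v ^ e = ψ z from hv), norm_pow] at h3
        simpa using lt_of_pow_lt_pow_left₀ e hδ.le h3
      refine ⟨mem_image_of_mem _ hv1, ?_⟩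
      obtain ⟨h4, h5⟩ := hpow _ (φ.map_target (hbt hv1))
      rw [φ.right_inv (hbt hv1), show v ^ e = ψ z from hv] at h5
      exact ψ.injOn h4 hz.1 h5
    · intro v w hv hw hvw
      have aux : ∀ v : ℂ, v ^ e = ψ z → v ∈ φ.target := by
        intro v hv
        have h3 : ‖ψ z‖ < δ ^ e := by simpa using hz.2
        rw [← hv, norm_pow] at h3
        exact hbt (by simpa using lt_of_pow_lt_pow_left₀ e hδ.le h3)
      rw [← φ.right_inv (aux v hv), hvw, φ.right_inv (aux w hw)]
    · rintro y ⟨hy, hyz⟩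
      obtain ⟨hy1, hy2⟩ := (himg y).1 hy
      refine ⟨φ y, ?_, φ.left_inv hy1⟩
      have := (hpow y hy1).2
      rw [hyz] at this
      exact this.symm

/-- A branched cover is an open map. -/
lemma HasRamificationIndex.nhds_le_map (h : HasRamificationIndex f x e) : 𝓝 (f x) ≤ map f (𝓝 x) := by
  intro N hN
  obtain ⟨N', hN', -, hx, -, -, hev⟩ := h.exists_nhds (mem_map.1 hN)
  filter_upwards [hev] with z hz
  by_cases hzx : z = f x
  · rw [hzx]; exact hN' hx
  · have h1 := hz hzx
    have h2 : {y ∈ N' | f y = z}.Nonempty := by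
      exact Set.nonempty_of_ncard_ne_zero (h1 ▸ h.1.ne')
    obtain ⟨y, hy, rfl⟩ := h2
    exact hN' hy

/-- The model `w ↦ w ^ 1` is the identity, so the chart upstairs followed by the inverse chart of
the sphere is `f` itself. This feeds the covering property away from the branch points. -/
lemma HasRamificationIndex.exists_openPartialHomeomorph (h : HasRamificationIndex f x 1) :
    ∃ φ : OpenPartialHomeomorph C Sphere, x ∈ φ.source ∧ EqOn f φ φ.source := by
  obtain ⟨-, φ, ψ, hx, hx0, hfx, hfx0, hpow⟩ := h
  refine ⟨φ.trans ψ.symm, ?_, ?_⟩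
  · simp only [OpenPartialHomeomorph.trans_source, OpenPartialHomeomorph.symm_source, mem_inter_iff,
      mem_preimage]
    refine ⟨hx, ?_⟩
    rw [hx0, ← hfx0]
    exact ψ.map_source hfx
  · intro y hy
    have hy1 : y ∈ φ.source := by
      have := hy
      simp only [OpenPartialHomeomorph.trans_source, mem_inter_iff] at this
      exact this.1
    obtain ⟨h1, h2⟩ := hpow y hy1
    rw [pow_one] at h2
    simp only [OpenPartialHomeomorph.coe_trans, Function.comp_apply]
    rw [← h2, ψ.left_inv h1]

end Local

namespace BranchedCover

variable (X : BranchedCover)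

/-- The fibre is compact, and it is discrete because in the local model a point is alone over its
image. -/
lemma finite_fiber (q : Sphere) : (X.f ⁻¹' {q}).Finite := by
  have hc : IsCompact (X.f ⁻¹' {q}) := (isClosed_singleton.preimage X.continuous_f).isCompact
  refine hc.finite ?_
  rw [isDiscrete_iff_forall_mem_exists_isOpen]
  intro x hx
  obtain ⟨e, he⟩ := X.locally_power x
  obtain ⟨N, -, ho, hxN, -, hN, -⟩ := he.exists_nhds univ_mem
  refine ⟨N, ho, ?_⟩
  ext y
  constructor
  · rintro ⟨hy1, hy2⟩
    exact hN y hy1 (by rw [show X.f y = q from hy2, show X.f x = q from hx])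
  · rintro rfl
    exact ⟨hxN, hx⟩

lemma isOpenMap : IsOpenMap X.f := by
  rw [isOpenMap_iff_nhds_le]
  intro x
  obtain ⟨e, he⟩ := X.locally_power x
  exact he.nhds_le_map

end BranchedCover

end Hurwitz

end

noncomputable section

namespace Hurwitz

open Set Filter Topology

/-! ### Geometry of the sphere -/

/-- The sign of a side of the real circle. -/
def sg (ε : Bool) : ℝ := cond ε 1 (-1)

lemma sg_mul_sg (ε : Bool) : sg ε * sg ε = 1 := by cases ε <;> simp [sg]

lemma sg_not (ε : Bool) : sg (!ε) = -sg ε := by cases ε <;> simp [sg]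

/-- The imaginary part, extended by `0` to `∞`. -/
def him (q : Sphere) : ℝ := OnePoint.elim q 0 Complex.im

@[simp] lemma him_infty : him (OnePoint.infty : Sphere) = 0 := rfl

@[simp] lemma him_coe (z : ℂ) : him (z : Sphere) = z.im := rfl

/-- The open half planes. -/
def openHalf (ε : Bool) : Set Sphere := {q | 0 < sg ε * him q}

/-- The closed half planes, containing `∞`. -/
def closedHalf (ε : Bool) : Set Sphere := {q | 0 ≤ sg ε * him q}

lemma openHalf_eq (ε : Bool) :
    openHalf ε = ((↑) : ℂ → Sphere) '' {z : ℂ | 0 < sg ε * z.im} := by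
  ext q
  induction q using OnePoint.rec with
  | infty => simp [openHalf]
  | coe z => simp [openHalf]

lemma isOpen_openHalf (ε : Bool) : IsOpen (openHalf ε) := by
  rw [openHalf_eq, OnePoint.isOpen_image_coe]
  exact isOpen_lt continuous_const (by fun_prop)

lemma openHalf_subset (ε : Bool) : openHalf ε ⊆ closedHalf ε := fun q (h : 0 < sg ε * him q) => h.le

lemma compl_closedHalf (ε : Bool) : (closedHalf ε)ᶜ = openHalf (!ε) := by
  ext q; simp [closedHalf, openHalf, sg_not]

lemma isClosed_closedHalf (ε : Bool) : IsClosed (closedHalf ε) := by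
  rw [← isOpen_compl_iff, compl_closedHalf]; exact isOpen_openHalf _

lemma mem_closedHalf_of_him_eq_zero {q : Sphere} (h : him q = 0) (ε : Bool) : q ∈ closedHalf ε := by
  simp [closedHalf, h]

lemma exists_mem_closedHalf (q : Sphere) : ∃ ε, q ∈ closedHalf ε := by
  rcases le_total 0 (him q) with h | h
  · exact ⟨true, by simpa [closedHalf, sg] using h⟩
  · exact ⟨false, by simpa [closedHalf, sg] using h⟩

lemma him_eq_zero_or_mem_openHalf {q : Sphere} {ε : Bool} (h : q ∈ closedHalf ε) :
    him q = 0 ∨ q ∈ openHalf ε := by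
  rcases (show 0 ≤ sg ε * him q from h).eq_or_lt with h | h
  · left; cases ε <;> simpa [sg] using h.symm
  · exact Or.inr h

lemma him_ne_zero_of_mem_openHalf {q : Sphere} {ε : Bool} (h : q ∈ openHalf ε) : him q ≠ 0 := by
  intro h0; simp [openHalf, h0] at h

lemma openHalf_disjoint_closedHalf {q : Sphere} {ε ε' : Bool} (h : q ∈ openHalf ε)
    (h' : q ∈ closedHalf ε') : ε' = ε := by
  cases ε <;> cases ε' <;> simp_all [openHalf, closedHalf, sg] <;> linarith

lemma convex_halfPlane (ε : Bool) : Convex ℝ {z : ℂ | 0 < sg ε * z.im} := by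
  have : {z : ℂ | 0 < sg ε * z.im} = (fun z : ℂ => sg ε * z.im) ⁻¹' Ioi 0 := rfl
  rw [this]
  exact (convex_Ioi 0).is_linear_preimage ⟨by intros; simp; ring, by intros; simp; ring⟩

/-- The base points. -/
def basePt (ε : Bool) : Sphere := ((sg ε * Complex.I : ℂ) : Sphere)

lemma basePt_mem (ε : Bool) : basePt ε ∈ openHalf ε := by
  simp [basePt, openHalf, sg_mul_sg]

lemma isPreconnected_openHalf (ε : Bool) : IsPreconnected (openHalf ε) := by
  rw [openHalf_eq]
  exact (convex_halfPlane ε).isPreconnected.image _ OnePoint.continuous_coe.continuousOn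

/-- The map `z ↦ -1/z`. -/
def negInv (q : Sphere) : Sphere :=
  OnePoint.elim q ((0 : ℂ) : Sphere) (fun z => if z = 0 then OnePoint.infty else ((-z⁻¹ : ℂ) : Sphere))

@[simp] lemma negInv_infty : negInv OnePoint.infty = ((0 : ℂ) : Sphere) := rfl

@[simp] lemma negInv_zero : negInv ((0 : ℂ) : Sphere) = OnePoint.infty := by
  simp [negInv]

lemma negInv_coe {z : ℂ} (hz : z ≠ 0) : negInv (z : Sphere) = ((-z⁻¹ : ℂ) : Sphere) := by
  simp [negInv, hz]

lemma negInv_negInv (q : Sphere) : negInv (negInv q) = q := by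
  induction q using OnePoint.rec with
  | infty => simp
  | coe z =>
    by_cases hz : z = 0
    · subst hz; simp
    · rw [negInv_coe hz, negInv_coe (by simpa using hz)]; simp

lemma continuous_negInv : Continuous negInv := by
  rw [OnePoint.continuous_iff]
  constructor
  · rw [negInv_infty, Filter.coclosedCompact_eq_cocompact, ← Metric.cobounded_eq_cocompact]
    have h : Tendsto (fun z : ℂ => ((-z⁻¹ : ℂ) : Sphere)) (Bornology.cobounded ℂ)
        (𝓝 ((0 : ℂ) : Sphere)) := by
      refine (OnePoint.continuous_coe.tendsto _).comp ?_
      simpa using (tendsto_inv₀_cobounded (α := ℂ)).neg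
    refine h.congr' ?_
    filter_upwards [Bornology.eventually_ne_cobounded (0 : ℂ)] with z hz
    rw [negInv_coe hz]
  · rw [continuous_iff_continuousAt]
    intro z
    by_cases hz : z = 0
    · subst hz
      rw [← continuousWithinAt_compl_self]
      unfold ContinuousWithinAt
      beta_reduce
      rw [negInv_zero]
      have h : Tendsto (fun z : ℂ => ((-z⁻¹ : ℂ) : Sphere)) (𝓝[≠] 0) (𝓝 OnePoint.infty) := by
        refine OnePoint.tendsto_coe_infty.comp ?_
        rw [Filter.coclosedCompact_eq_cocompact, ← Metric.cobounded_eq_cocompact]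
        exact tendsto_neg_cobounded.comp (tendsto_inv₀_nhdsNE_zero (α := ℂ))
      refine h.congr' ?_
      filter_upwards [self_mem_nhdsWithin] with z hz
      rw [negInv_coe hz]
    · have h : ContinuousAt (fun z : ℂ => ((-z⁻¹ : ℂ) : Sphere)) z :=
        OnePoint.continuous_coe.continuousAt.comp (continuousAt_inv₀ hz).neg
      refine h.congr ?_
      filter_upwards [isOpen_ne.mem_nhds hz] with w hw
      rw [negInv_coe hw]

/-- The homeomorphism `z ↦ -1/z` of the sphere. -/
def negInvHomeomorph : Sphere ≃ₜ Sphere where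
  toFun := negInv
  invFun := negInv
  left_inv := negInv_negInv
  right_inv := negInv_negInv
  continuous_toFun := continuous_negInv
  continuous_invFun := continuous_negInv

/-! ### The arcs between the branch points -/

section Arcs

variable {r : ℕ} (b : Fin r → ℝ)

/-- `∞` and the points `b i`. -/
def vertices : Set Sphere := insert OnePoint.infty (range fun i => ((b i : ℂ) : Sphere))

/-- The number of branch points to the left of `x`. -/
def cutLT (x : ℝ) : Fin (r + 1) :=
  ⟨(Finset.univ.filter fun i => b i < x).card,
    Nat.lt_succ_of_le ((Finset.card_filter_le _ _).trans (by simp))⟩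

/-- The number of branch points not to the right of `x`. -/
def cutLE (x : ℝ) : Fin (r + 1) :=
  ⟨(Finset.univ.filter fun i => b i ≤ x).card,
    Nat.lt_succ_of_le ((Finset.card_filter_le _ _).trans (by simp))⟩

lemma cutLT_val (x : ℝ) : (cutLT b x : ℕ) = (Finset.univ.filter fun i => b i < x).card := rfl

lemma cutLE_val (x : ℝ) : (cutLE b x : ℕ) = (Finset.univ.filter fun i => b i ≤ x).card := rfl

/-- The index of the arc to the left of a point of the real circle. -/
def lidx (q : Sphere) : Fin (r + 1) := OnePoint.elim q (Fin.last r) fun z => cutLT b z.re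

/-- The index of the arc to the right of a point of the real circle. -/
def ridx (q : Sphere) : Fin (r + 1) := OnePoint.elim q 0 fun z => cutLE b z.re

@[simp] lemma lidx_infty : lidx b OnePoint.infty = Fin.last r := rfl
@[simp] lemma ridx_infty : ridx b OnePoint.infty = 0 := rfl
@[simp] lemma lidx_coe (z : ℂ) : lidx b (z : Sphere) = cutLT b z.re := rfl
@[simp] lemma ridx_coe (z : ℂ) : ridx b (z : Sphere) = cutLE b z.re := rfl

lemma him_of_mem_vertices {q : Sphere} (h : q ∈ vertices b) : him q = 0 := by
  rcases h with rfl | ⟨i, rfl⟩ <;> simp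

lemma notMem_vertices_of_mem_openHalf {q : Sphere} {ε : Bool} (h : q ∈ openHalf ε) :
    q ∉ vertices b := fun h' => him_ne_zero_of_mem_openHalf h (him_of_mem_vertices b h')

lemma finite_vertices : (vertices b).Finite := (finite_range _).insert _

lemma exists_real_of_him_eq_zero {q : Sphere} (h : him q = 0) (hq : q ∉ vertices b) :
    ∃ x : ℝ, q = ((x : ℂ) : Sphere) ∧ ∀ i, b i ≠ x := by
  induction q using OnePoint.rec with
  | infty => exact absurd (mem_insert _ _) hq
  | coe z =>
    have hz : z = ((z.re : ℝ) : ℂ) := Complex.ext (by simp) (by simpa using h)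
    refine ⟨z.re, by rw [← hz], fun i hi => hq (Or.inr ⟨i, ?_⟩)⟩
    simp only [hi, ← hz]

lemma cutLT_eq_cutLE {x : ℝ} (h : ∀ i, b i ≠ x) : cutLT b x = cutLE b x := by
  unfold cutLT cutLE
  congr 2
  ext i
  simp [(h i).le_iff_lt]

/-- Off the vertices strict and weak comparison with the branch points agree, so both indices name
the arc containing the point. -/
lemma lidx_eq_ridx {q : Sphere} (h : him q = 0) (hq : q ∉ vertices b) : lidx b q = ridx b q := by
  obtain ⟨x, rfl, hx⟩ := exists_real_of_him_eq_zero b h hq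
  simpa using cutLT_eq_cutLE b hx

/-- A local parametrisation of the sphere at a point of the real circle which respects the half
planes and the arcs. -/
structure LocalParam (q : Sphere) where
  h : ℂ → Sphere
  emb : IsOpenEmbedding h
  zero : h 0 = q
  him_pos : ∀ ε w, ‖w‖ < 1 → (0 < sg ε * him (h w) ↔ 0 < sg ε * w.im)
  notMem : ∀ w, ‖w‖ < 1 → w ≠ 0 → h w ∉ vertices b
  right : ∀ t : ℝ, 0 < t → t < 1 → lidx b (h t) = ridx b q
  left : ∀ t : ℝ, 0 < t → t < 1 → lidx b (h (-t : ℝ)) = lidx b q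

lemma exists_gap (x : ℝ) : ∃ ρ > 0, ∀ i, |b i - x| < ρ → b i = x := by
  have : ∀ᶠ ρ in 𝓝[>] (0 : ℝ), ∀ i, |b i - x| < ρ → b i = x := by
    rw [eventually_all]
    intro i
    by_cases h : b i = x
    · simp [h]
    · have : 0 < |b i - x| := abs_pos.2 (sub_ne_zero.2 h)
      filter_upwards [nhdsWithin_le_nhds (Iio_mem_nhds this)] with ρ hρ h'
      exact absurd h' (not_lt.2 (le_of_lt hρ))
  obtain ⟨ρ, hρ, hρ0⟩ := (this.and self_mem_nhdsWithin).exists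
  exact ⟨ρ, hρ0, hρ⟩

lemma isOpenEmbedding_affine {ρ : ℝ} (hρ : 0 < ρ) (x : ℂ) :
    IsOpenEmbedding fun w : ℂ => (ρ : ℂ) * w + x := by
  have h := ((Homeomorph.mulLeft₀ (ρ : ℂ) (by exact_mod_cast hρ.ne')).trans
    (Homeomorph.addRight x)).isOpenEmbedding
  exact h

/-- The local parametrisation at a finite point. -/
def LocalParam.finite (x ρ : ℝ) (hρ : 0 < ρ) (h : ∀ i, |b i - x| < ρ → b i = x) :
    LocalParam b ((x : ℂ) : Sphere) where
  h w := ((ρ * w + x : ℂ) : Sphere)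
  emb := OnePoint.isOpenEmbedding_coe.comp (isOpenEmbedding_affine hρ x)
  zero := by simp
  him_pos ε w _ := by
    have : sg ε * him ((ρ * w + x : ℂ) : Sphere) = ρ * (sg ε * w.im) := by simp; ring
    rw [this, mul_pos_iff_of_pos_left hρ]
  notMem w hw hw0 := by
    rintro (h' | ⟨i, hi⟩)
    · exact OnePoint.coe_ne_infty _ h'
    · have h1 : ((b i : ℂ) : ℂ) = ρ * w + x := OnePoint.coe_injective hi
      have h2 : ((b i - x : ℝ) : ℂ) = ρ * w := by push_cast; rw [h1]; ring
      have h3 : |b i - x| = ρ * ‖w‖ := by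
        rw [← Real.norm_eq_abs, ← Complex.norm_real, h2, norm_mul, Complex.norm_real,
          Real.norm_of_nonneg hρ.le]
      have h4 := h i (by rw [h3]; nlinarith)
      rw [h4, sub_self, abs_zero] at h3
      exact hw0 (norm_eq_zero.1 ((mul_eq_zero.1 h3.symm).resolve_left hρ.ne'))
  right t ht ht1 := by
    simp only [lidx_coe, ridx_coe]
    unfold cutLT cutLE
    congr 2
    ext i
    simp only [Finset.mem_filter, Finset.mem_univ, true_and]
    have : (ρ * (t : ℂ) + x).re = ρ * t + x := by simp
    rw [this, Complex.ofReal_re]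
    have ht' := mul_pos hρ ht
    constructor
    · intro h'
      by_contra hlt
      push Not at hlt
      have := h i (by rw [abs_of_pos (by linarith)]; nlinarith)
      linarith
    · intro h'; linarith
  left t ht ht1 := by
    simp only [lidx_coe]
    unfold cutLT
    congr 2
    ext i
    simp only [Finset.mem_filter, Finset.mem_univ, true_and]
    have : (ρ * ((-t : ℝ) : ℂ) + x).re = -(ρ * t) + x := by simp
    rw [this, Complex.ofReal_re]
    have ht' := mul_pos hρ ht
    constructor
    · intro h'; linarith
    · intro h'
      by_contra hlt
      push Not at hlt
      have := h i (by rw [abs_of_neg (by linarith)]; nlinarith)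
      linarith

lemma abs_lt_inv_mul {ρ t y : ℝ} (hρ : 0 < ρ) (ht : 0 < t) (ht1 : t < 1) (h : ρ * |y| < 1) :
    |y| < (ρ * t)⁻¹ := by
  rw [← one_div, lt_div_iff₀ (by positivity)]
  nlinarith [abs_nonneg y, mul_nonneg hρ.le (abs_nonneg y)]

/-- The local parametrisation at `∞`. -/
def LocalParam.infinite (ρ : ℝ) (hρ : 0 < ρ) (h : ∀ i, ρ * |b i| < 1) :
    LocalParam b OnePoint.infty where
  -- The map `-1/z` preserves the half planes and the direction of the circle: small positive
  -- parameters land far to the left on the line, in arc `0`, and negative ones far to the right, in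
  -- the last arc.
  h w := negInv ((ρ * w + (0 : ℝ) : ℂ) : Sphere)
  emb := negInvHomeomorph.isOpenEmbedding.comp
    (OnePoint.isOpenEmbedding_coe.comp (isOpenEmbedding_affine hρ _))
  zero := by simp
  him_pos ε w _ := by
    by_cases hw : w = 0
    · simp [hw]
    · have h1 : (ρ * w + (0 : ℝ) : ℂ) ≠ 0 := by simp [hρ.ne', hw]
      rw [negInv_coe h1]
      have h2 : sg ε * him ((-(ρ * w + (0 : ℝ))⁻¹ : ℂ) : Sphere) =
          (ρ / Complex.normSq (ρ * w)) * (sg ε * w.im) := by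
        simp [Complex.inv_im]; field_simp
      have h3 : 0 < ρ / Complex.normSq (ρ * w) := by
        apply div_pos hρ
        rw [Complex.normSq_pos]; simpa using h1
      rw [h2, mul_pos_iff_of_pos_left h3]
  notMem w hw hw0 := by
    have h1 : (ρ * w + (0 : ℝ) : ℂ) ≠ 0 := by simp [hρ.ne', hw0]
    rw [negInv_coe h1]
    rintro (h' | ⟨i, hi⟩)
    · exact OnePoint.coe_ne_infty _ h'
    · have h2 : (b i : ℂ) = -(ρ * w + (0 : ℝ))⁻¹ := OnePoint.coe_injective hi
      have h3 : |b i| = (ρ * ‖w‖)⁻¹ := by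
        rw [← Real.norm_eq_abs, ← Complex.norm_real, h2]
        simp [abs_of_pos hρ]
      have h4 := h i
      have hw' : 0 < ‖w‖ := norm_pos_iff.2 hw0
      rw [h3, mul_inv, ← mul_assoc, mul_inv_cancel₀ hρ.ne', one_mul] at h4
      rw [inv_lt_one₀ hw'] at h4
      linarith
  right t ht ht1 := by
    have h1 : (ρ * (t : ℂ) + (0 : ℝ) : ℂ) ≠ 0 := by simp [hρ.ne', ht.ne']
    rw [negInv_coe h1, lidx_coe, ridx_infty]
    have h2 : (-(ρ * (t : ℂ) + (0 : ℝ))⁻¹ : ℂ).re = -(ρ * t)⁻¹ := by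
      rw [show (-(ρ * (t : ℂ) + (0 : ℝ))⁻¹ : ℂ) = ((-(ρ * t)⁻¹ : ℝ) : ℂ) by push_cast; simp,
        Complex.ofReal_re]
    rw [h2]
    ext
    simp only [cutLT, Fin.val_zero, Finset.card_eq_zero, Finset.filter_eq_empty_iff,
      Finset.mem_univ, true_implies, not_lt]
    intro i
    have h6 := abs_lt_inv_mul hρ ht ht1 (h i)
    have h5 := neg_abs_le (b i)
    linarith
  left t ht ht1 := by
    have h1 : (ρ * ((-t : ℝ) : ℂ) + (0 : ℝ) : ℂ) ≠ 0 := by simp [hρ.ne', ht.ne']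
    rw [negInv_coe h1, lidx_coe, lidx_infty]
    have h2 : (-(ρ * ((-t : ℝ) : ℂ) + (0 : ℝ))⁻¹ : ℂ).re = (ρ * t)⁻¹ := by
      rw [show (-(ρ * ((-t : ℝ) : ℂ) + (0 : ℝ))⁻¹ : ℂ) = (((ρ * t)⁻¹ : ℝ) : ℂ) by
        push_cast; simp, Complex.ofReal_re]
    rw [h2]
    ext
    have h3 : (Finset.univ.filter fun i => b i < (ρ * t)⁻¹) = Finset.univ :=
      Finset.filter_true_of_mem fun i _ =>
        (le_abs_self _).trans_lt (abs_lt_inv_mul hρ ht ht1 (h i))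
    rw [cutLT_val, h3]; simp

/-- It suffices to choose the scale `ρ` so small that the unit disc of the parameter contains no
vertex besides its centre; at `∞` this means `ρ * |b i| < 1` for all `i`. -/
lemma exists_localParam {q : Sphere} (hq : him q = 0) : Nonempty (LocalParam b q) := by
  induction q using OnePoint.rec with
  | infty =>
    have : ∀ᶠ ρ in 𝓝[>] (0 : ℝ), ∀ i, ρ * |b i| < 1 := by
      rw [eventually_all]
      intro i
      refine nhdsWithin_le_nhds ?_
      have : Tendsto (fun ρ : ℝ => ρ * |b i|) (𝓝 0) (𝓝 (0 * |b i|)) :=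
        tendsto_id.mul tendsto_const_nhds
      rw [zero_mul] at this
      exact this (Iio_mem_nhds one_pos)
    obtain ⟨ρ, hρ, hρ0⟩ := (this.and self_mem_nhdsWithin).exists
    exact ⟨LocalParam.infinite b ρ hρ0 hρ⟩
  | coe z =>
    have hz : z = ((z.re : ℝ) : ℂ) := Complex.ext (by simp) (by simpa using hq)
    obtain ⟨ρ, hρ, h⟩ := exists_gap b z.re
    rw [hz]
    exact ⟨LocalParam.finite b z.re ρ hρ h⟩

/-- The open arcs into which the vertices divide the real circle. -/
def arc (j : Fin (r + 1)) : Set Sphere := {q | him q = 0 ∧ q ∉ vertices b ∧ lidx b q = j}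

/-- The open arcs, without the point at infinity as subsets of the real line. -/
def arcReal (j : Fin (r + 1)) : Set ℝ := {x | (∀ i, b i ≠ x) ∧ cutLT b x = j}

lemma coe_notMem_vertices {x : ℝ} (h : ∀ i, b i ≠ x) : ((x : ℂ) : Sphere) ∉ vertices b := by
  rintro (h' | ⟨i, hi⟩)
  · exact OnePoint.coe_ne_infty _ h'
  · have := OnePoint.coe_injective hi
    exact h i (by exact_mod_cast this)

lemma arc_eq (j : Fin (r + 1)) : arc b j = (fun x : ℝ => ((x : ℂ) : Sphere)) '' arcReal b j := by
  ext q
  constructor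
  · rintro ⟨h1, h2, h3⟩
    obtain ⟨x, rfl, hx⟩ := exists_real_of_him_eq_zero b h1 h2
    exact ⟨x, ⟨hx, by simpa using h3⟩, rfl⟩
  · rintro ⟨x, ⟨hx, h3⟩, rfl⟩
    exact ⟨by simp, coe_notMem_vertices b hx, by simpa using h3⟩

lemma cutLT_mono {x y : ℝ} (h : x ≤ y) : cutLT b x ≤ cutLT b y := by
  rw [Fin.le_def, cutLT_val, cutLT_val]
  apply Finset.card_le_card
  intro i
  simp only [Finset.mem_filter, Finset.mem_univ, true_and]
  intro hi; linarith

lemma cutLT_lt {x y : ℝ} {i : Fin r} (h : x ≤ b i) (h' : b i < y) : cutLT b x < cutLT b y := by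
  rw [Fin.lt_def, cutLT_val, cutLT_val]
  apply Finset.card_lt_card
  refine Finset.ssubset_iff_subset_ne.2 ⟨?_, ?_⟩
  · intro i'
    simp only [Finset.mem_filter, Finset.mem_univ, true_and]
    intro hi; linarith
  · intro heq
    have : i ∈ Finset.univ.filter fun i => b i < x := by rw [heq]; simpa using h'
    simp only [Finset.mem_filter, Finset.mem_univ, true_and] at this
    linarith

/-- A branch point between two points strictly increases the number of branch points to the left, so
none lies between points with the same count. -/
lemma ordConnected_arcReal (j : Fin (r + 1)) : OrdConnected (arcReal b j) := by
  refine ⟨?_⟩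
  rintro x ⟨hx, hxj⟩ y ⟨hy, hyj⟩ z ⟨hxz, hzy⟩
  refine ⟨fun i hi => ?_, ?_⟩
  · have h1 : b i < y := lt_of_le_of_ne (hi ▸ hzy) (hy i)
    have := cutLT_lt b (hi ▸ hxz : x ≤ b i) h1
    rw [hxj, hyj] at this
    exact lt_irrefl _ this
  · exact le_antisymm (hyj ▸ cutLT_mono b hzy) (hxj ▸ cutLT_mono b hxz)

lemma isPreconnected_arc (j : Fin (r + 1)) : IsPreconnected (arc b j) := by
  rw [arc_eq]
  refine (ordConnected_arcReal b j).isPreconnected.image _ (Continuous.continuousOn ?_)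
  exact OnePoint.continuous_coe.comp Complex.continuous_ofReal

lemma arcReal_nonempty (hb : StrictMono b) (j : Fin (r + 1)) : (arcReal b j).Nonempty := by
  -- Such an `x` lies left of all branch points, between two consecutive ones or right of all of
  -- them, according to `j`.
  obtain ⟨x, hx1, hx2⟩ : ∃ x : ℝ, (∀ i : Fin r, i.castSucc < j → b i < x) ∧
      ∀ i : Fin r, j ≤ i.castSucc → x < b i := by
    have hfin : (range b).Finite := finite_range b
    obtain ⟨m, hm⟩ := hfin.bddBelow
    obtain ⟨M, hM⟩ := hfin.bddAbove
    rcases Fin.eq_zero_or_eq_succ j with rfl | ⟨j, rfl⟩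
    · exact ⟨m - 1, fun i hi => absurd hi (by simp), fun i _ => by linarith [hm ⟨i, rfl⟩]⟩
    · by_cases hj : (j : ℕ) + 1 < r
      · obtain ⟨x, hx1, hx2⟩ := exists_between (hb (show j < ⟨j + 1, hj⟩ from Nat.lt_succ_self _))
        refine ⟨x, fun i hi => ?_, fun i hi => ?_⟩
        · exact (hb.monotone (show i ≤ j from Nat.lt_succ_iff.1 hi)).trans_lt hx1
        · exact hx2.trans_le (hb.monotone (show (⟨j + 1, hj⟩ : Fin r) ≤ i from hi))
      · refine ⟨M + 1, fun i _ => by linarith [hM ⟨i, rfl⟩], fun i hi => ?_⟩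
        have : (j : ℕ) + 1 ≤ i := hi
        omega
  refine ⟨x, fun i hi => ?_, ?_⟩
  · rcases lt_or_ge i.castSucc j with h | h
    · exact (hx1 i h).ne hi
    · exact (hx2 i h).ne' hi
  · have h1 : (Finset.univ.filter fun i => b i < x) = Finset.univ.filter fun i : Fin r => (i : ℕ) < j := by
      ext i
      simp only [Finset.mem_filter, Finset.mem_univ, true_and]
      constructor
      · intro h; by_contra h'
        exact lt_asymm h (hx2 i (not_lt.1 h'))
      · exact fun h => hx1 i h
    ext
    rw [cutLT_val, h1, Fin.card_filter_val_lt]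
    have := j.2
    omega

lemma arc_nonempty (hb : StrictMono b) (j : Fin (r + 1)) : (arc b j).Nonempty := by
  rw [arc_eq]; exact (arcReal_nonempty b hb j).image _

lemma lidx_branch (hb : StrictMono b) (i : Fin r) : lidx b ((b i : ℂ) : Sphere) = i.castSucc := by
  have h1 : (Finset.univ.filter fun j => b j < b i) = Finset.Iio i := by
    ext j; simp [hb.lt_iff_lt]
  ext
  rw [lidx_coe, Complex.ofReal_re, cutLT_val, h1]
  simp

lemma ridx_branch (hb : StrictMono b) (i : Fin r) : ridx b ((b i : ℂ) : Sphere) = i.succ := by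
  have h1 : (Finset.univ.filter fun j => b j ≤ b i) = Finset.Iic i := by
    ext j; simp [hb.le_iff_le]
  ext
  rw [ridx_coe, Complex.ofReal_re, cutLE_val, h1]
  simp

namespace LocalParam

variable {b} {q : Sphere} (P : LocalParam b q)

lemma him_eq_zero_iff {w : ℂ} (hw : ‖w‖ < 1) : him (P.h w) = 0 ↔ w.im = 0 := by
  have h1 := P.him_pos true w hw
  have h2 := P.him_pos false w hw
  simp only [sg, cond_true, cond_false, one_mul, neg_mul, Left.neg_pos_iff] at h1 h2
  constructor
  · intro h; rw [h] at h1 h2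
    exact le_antisymm (not_lt.1 fun h' => lt_irrefl _ (h1.2 h')) (not_lt.1 fun h' => lt_irrefl _ (h2.2 h'))
  · intro h; rw [h] at h1 h2
    exact le_antisymm (not_lt.1 fun h' => lt_irrefl _ (h1.1 h')) (not_lt.1 fun h' => lt_irrefl _ (h2.1 h'))

lemma mem_openHalf {ε : Bool} {w : ℂ} (hw : ‖w‖ < 1) : P.h w ∈ openHalf ε ↔ 0 < sg ε * w.im :=
  P.him_pos ε w hw

lemma mem_closedHalf {ε : Bool} {w : ℂ} (hw : ‖w‖ < 1) : P.h w ∈ closedHalf ε ↔ 0 ≤ sg ε * w.im := by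
  have := P.him_pos (!ε) w hw
  rw [sg_not, neg_mul, neg_mul, Left.neg_pos_iff, Left.neg_pos_iff, ← not_le, ← not_le, not_iff_not] at this
  exact this

include P in
lemma him_eq_zero : him q = 0 := by
  rw [← P.zero, P.him_eq_zero_iff (by simp)]; simp

lemma lidx_eq_or {w : ℂ} (hw : ‖w‖ < 1) (h0 : w ≠ 0) (him : w.im = 0) :
    lidx b (P.h w) = lidx b q ∨ lidx b (P.h w) = ridx b q := by
  have hz : w = ((w.re : ℝ) : ℂ) := Complex.ext (by simp) (by simpa using him)
  rw [hz, Complex.norm_real, Real.norm_eq_abs] at hw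
  have h0' : w.re ≠ 0 := fun h => h0 (by rw [hz, h]; simp)
  rcases lt_or_gt_of_ne h0' with h | h
  · left
    rw [hz, ← neg_neg w.re]
    exact P.left _ (by linarith) (by rw [abs_of_neg h] at hw; exact hw)
  · right
    rw [hz]
    exact P.right _ h (by rw [abs_of_pos h] at hw; exact hw)

lemma nhds_hasBasis : (𝓝 q).HasBasis (fun ρ : ℝ => 0 < ρ ∧ ρ < 1) fun ρ => P.h '' Metric.ball 0 ρ := by
  have h1 : 𝓝 q = map P.h (𝓝 0) := by rw [P.emb.map_nhds_eq, P.zero]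
  rw [h1]
  refine HasBasis.map _ ?_
  refine Metric.nhds_basis_ball.to_hasBasis ?_ ?_
  · intro ρ hρ
    refine ⟨min ρ (1 / 2), ⟨lt_min hρ (by norm_num), (min_le_right _ _).trans_lt (by norm_num)⟩, ?_⟩
    exact Metric.ball_subset_ball (min_le_left _ _)
  · intro ρ hρ
    exact ⟨ρ, hρ.1, le_rfl⟩

/-- The trace of a half plane on a small disc. -/
lemma image_ball_inter_openHalf (ε : Bool) {ρ : ℝ} (hρ : ρ < 1) :
    P.h '' Metric.ball 0 ρ ∩ openHalf ε = P.h '' (Metric.ball 0 ρ ∩ {w | 0 < sg ε * w.im}) := by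
  ext z
  constructor
  · rintro ⟨⟨w, hw, rfl⟩, hz⟩
    exact ⟨w, ⟨hw, (P.mem_openHalf ((mem_ball_zero_iff.1 hw).trans hρ)).1 hz⟩, rfl⟩
  · rintro ⟨w, ⟨hw, hw'⟩, rfl⟩
    exact ⟨⟨w, hw, rfl⟩, (P.mem_openHalf ((mem_ball_zero_iff.1 hw).trans hρ)).2 hw'⟩

lemma isPreconnected_inter_openHalf (ε : Bool) {ρ : ℝ} (hρ : ρ < 1) :
    IsPreconnected (P.h '' Metric.ball 0 ρ ∩ openHalf ε) := by
  rw [P.image_ball_inter_openHalf ε hρ]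
  exact ((convex_ball _ _).inter (convex_halfPlane ε)).isPreconnected.image _
    P.emb.continuous.continuousOn

include P in
lemma mem_closure_openHalf (ε : Bool) : q ∈ closure (openHalf ε) := by
  rw [mem_closure_iff_nhds_basis P.nhds_hasBasis]
  rintro ρ ⟨hρ, hρ1⟩
  refine ⟨P.h ((sg ε * (ρ / 2) : ℝ) * Complex.I), ?_, ?_⟩
  · rw [P.mem_openHalf]
    · simp [← mul_assoc, sg_mul_sg, hρ]
    · cases ε <;> simp [sg, abs_of_pos hρ] <;> linarith
  · refine mem_image_of_mem _ ?_
    cases ε <;> simp [sg, abs_of_pos hρ] <;> linarith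

end LocalParam

lemma closedHalf_subset_closure (ε : Bool) : closedHalf ε ⊆ closure (openHalf ε) := by
  intro q hq
  rcases him_eq_zero_or_mem_openHalf hq with h | h
  -- Vertices play no role here, so the empty family of branch points is used.
  · obtain ⟨P⟩ := exists_localParam (fun i : Fin 0 => (0 : ℝ)) h
    exact P.mem_closure_openHalf ε
  · exact subset_closure h

end Arcs

end Hurwitz

end

noncomputable section

namespace Hurwitz

open Set Filter Topology

/-! ### Sheets of a branched cover over the half planes -/

/-- The sets where `t` agrees with a given `s k` are closed, finite in number and disjoint. The
index is therefore a locally constant function on the connected set `A`. -/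
lemma exists_eqOn_of_family {Z C ι : Type*} [TopologicalSpace Z] [TopologicalSpace C] [T2Space C]
    [Finite ι] {A : Set Z} (hA : IsPreconnected A) (hne : A.Nonempty) {s : ι → Z → C}
    (hs : ∀ k, ContinuousOn (s k) A) {t : Z → C} (ht : ContinuousOn t A)
    (hts : ∀ z ∈ A, ∃ k, t z = s k z) (hinj : ∀ k l, ∀ z ∈ A, s k z = s l z → k = l) :
    ∃ k, EqOn t (s k) A := by
  obtain ⟨z₀, hz₀⟩ := hne
  have : Nonempty ι := ⟨(hts z₀ hz₀).choose⟩
  choose! G hG using hts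
  have hcl : ∀ k, IsClosed {z : A | t z = s k z} := fun k =>
    isClosed_eq (continuousOn_iff_continuous_domRestrict.1 ht)
      (continuousOn_iff_continuous_domRestrict.1 (hs k))
  let _ : TopologicalSpace ι := ⊥
  have : DiscreteTopology ι := ⟨rfl⟩
  have hcont : ContinuousOn G A := by
    rw [continuousOn_iff_continuous_domRestrict, continuous_iff_isClosed]
    intro T _
    have : A.domRestrict G ⁻¹' T = ⋃ k ∈ T, {z : A | t z = s k z} := by
      ext z
      simp only [mem_preimage, domRestrict_apply, mem_iUnion, mem_ofPred_eq, exists_prop]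
      constructor
      · intro h; exact ⟨_, h, hG z z.2⟩
      · rintro ⟨k, hk, h⟩
        rwa [hinj (G z) k z z.2 ((hG z z.2).symm.trans h)]
    rw [this]
    exact (toFinite T).isClosed_biUnion fun k _ => hcl k
  refine ⟨G z₀, fun z hz => ?_⟩
  rw [hG z hz, hA.constant hcont hz hz₀]

/-- This filter allows a sheet at `q` to be tested on nearby points of the open half plane different
from `q`, also when `q` lies on the boundary. -/
lemma openHalf_nhdsWithin_neBot {ε : Bool} {q : Sphere} (hq : q ∈ closedHalf ε) :
    NeBot (𝓝[openHalf ε \ {q}] q) := by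
  rcases him_eq_zero_or_mem_openHalf hq with h | h
  · have : openHalf ε \ {q} = openHalf ε :=
      sdiff_singleton_eq_self fun h' => him_ne_zero_of_mem_openHalf h' h
    rw [this]
    exact mem_closure_iff_nhdsWithin_neBot.1 (closedHalf_subset_closure ε hq)
  · have h1 : 𝓝[openHalf ε \ {q}] q = 𝓝[≠] q := by
      rw [sdiff_eq]
      exact nhdsWithin_inter_of_mem (nhdsWithin_le_nhds ((isOpen_openHalf ε).mem_nhds h))
    rw [h1]
    infer_instance

namespace BranchedCover

variable (X : BranchedCover) {r : ℕ} (b : Fin r → ℝ)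

lemma isCoveringMapOn (h : ∀ x, X.f x ∉ vertices b → HasRamificationIndex X.f x 1) :
    IsCoveringMapOn X.f (vertices b)ᶜ := by
  refine IsCoveringMapOn.of_isLocalHomeomorphOn X.continuous_f ?_
  refine IsLocalHomeomorphOn.mk X.f _ fun x hx => ?_
  obtain ⟨φ, h1, h2⟩ := (h x hx).exists_openPartialHomeomorph
  exact ⟨φ, h1, h2⟩

/-- The half plane is contractible and locally path connected and avoids the vertices, so its
inclusion into the sphere lifts uniquely through the covering once one value is prescribed. -/
lemma exists_section_on_openHalf (hX : IsCoveringMapOn X.f (vertices b)ᶜ) (ε : Bool) {x : X.C}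
    (hx : X.f x ∈ openHalf ε) :
    ∃ s : Sphere → X.C, ContinuousOn s (openHalf ε) ∧ (∀ z ∈ openHalf ε, X.f (s z) = z) ∧
      s (X.f x) = x ∧ ∀ t : Sphere → X.C, ContinuousOn t (openHalf ε) →
        (∀ z ∈ openHalf ε, X.f (t z) = z) → t (X.f x) = x → EqOn t s (openHalf ε) := by
  let A := {z : ℂ | 0 < sg ε * z.im}
  have hmem : ∀ z : A, ((z : ℂ) : Sphere) ∈ openHalf ε := fun z => z.2
  have : ContractibleSpace A := (convex_halfPlane ε).contractibleSpace
    ⟨sg ε * Complex.I, by simp [sg_mul_sg]⟩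
  have : LocallyPathConnectedSpace A :=
    (isOpen_lt continuous_const (by fun_prop) : IsOpen A).locallyPathConnectedSpace
  let ι : C(A, Sphere) := ⟨fun z => ((z : ℂ) : Sphere),
    OnePoint.continuous_coe.comp continuous_subtype_val⟩
  obtain ⟨z₀, hz₀⟩ : ∃ z₀ : A, ((z₀ : ℂ) : Sphere) = X.f x := by
    rw [openHalf_eq] at hx
    obtain ⟨z, hz, h⟩ := hx
    exact ⟨⟨z, hz⟩, h⟩
  obtain ⟨F, ⟨hF1, hF2⟩, huniq⟩ := hX.existsUnique_continuousMap_lifts ι (a₀ := z₀) (e₀ := x)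
    hz₀.symm (fun a => notMem_vertices_of_mem_openHalf b (hmem a))
  classical
  let pt : Sphere → ℂ := fun q => OnePoint.elim q 0 id
  have hpt : ContinuousOn pt (openHalf ε) := by
    rw [openHalf_eq]
    rintro _ ⟨z, hz, rfl⟩
    refine ContinuousAt.continuousWithinAt ?_
    rw [OnePoint.continuousAt_coe]
    exact continuousAt_id
  have hptmem : ∀ q ∈ openHalf ε, pt q ∈ A ∧ ((pt q : ℂ) : Sphere) = q := by
    rw [openHalf_eq]
    rintro _ ⟨z, hz, rfl⟩
    exact ⟨hz, rfl⟩
  let s : Sphere → X.C := fun q => if h : pt q ∈ A then F ⟨pt q, h⟩ else x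
  have hs : ∀ q (h : pt q ∈ A), s q = F ⟨pt q, h⟩ := fun q h => dif_pos h
  refine ⟨s, ?_, ?_, ?_, ?_⟩
  · rw [continuousOn_iff_continuous_domRestrict]
    have h1 : (openHalf ε).domRestrict s = fun q => F ⟨pt q.val, (hptmem q.val q.property).1⟩ := by
      funext q; exact hs q _
    rw [h1]
    exact F.continuous.comp ((continuousOn_iff_continuous_domRestrict.1 hpt).subtype_mk _)
  · intro q hq
    rw [hs q (hptmem q hq).1]
    exact (congrFun hF2 _).trans (hptmem q hq).2
  · have h2 := (hptmem _ hx).1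
    rw [hs _ h2]
    refine Eq.trans ?_ hF1
    congr 1
    apply Subtype.ext
    change pt (X.f x) = z₀
    rw [← hz₀]; rfl
  · intro t ht1 ht2 ht3 q hq
    have h3 := huniq ⟨fun a => t ((a : ℂ) : Sphere),
      ht1.comp_continuous ι.continuous hmem⟩ ⟨by
        change t _ = x
        rw [hz₀, ht3], by
        funext a
        exact ht2 _ (hmem a)⟩
    have h4 := (hptmem q hq)
    rw [hs q h4.1, ← h3]
    change t q = t ((pt q : ℂ) : Sphere)
    rw [h4.2]

/-- Half discs at a boundary point are connected and fibres are finite, so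
`exists_tendsto_of_finite_fiber` gives a limit of the section, even over a branch point. The section
equation persists by density. -/
lemma extendFrom_section (ε : Bool) {s : Sphere → X.C} (hs : ContinuousOn s (openHalf ε))
    (hfs : ∀ z ∈ openHalf ε, X.f (s z) = z) :
    ContinuousOn (extendFrom (openHalf ε) s) (closedHalf ε) ∧
      EqOn (extendFrom (openHalf ε) s) s (openHalf ε) ∧
      ∀ z ∈ closedHalf ε, X.f (extendFrom (openHalf ε) s z) = z := by
  have h1 : ∀ z ∈ openHalf ε, Tendsto s (𝓝[openHalf ε] z) (𝓝 (s z)) := fun z hz => hs z hz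
  have h2 : ∀ q ∈ closedHalf ε, ∃ y, Tendsto s (𝓝[openHalf ε] q) (𝓝 y) := by
    intro q hq
    rcases him_eq_zero_or_mem_openHalf hq with h | h
    · have : NeBot (𝓝[openHalf ε] q) :=
        mem_closure_iff_nhdsWithin_neBot.1 (closedHalf_subset_closure ε hq)
      obtain ⟨P⟩ := exists_localParam (fun i : Fin 0 => (0 : ℝ)) h
      obtain ⟨x, -, hx⟩ := exists_tendsto_of_finite_fiber (l := 𝓝[openHalf ε] q) (s := s)
        X.continuous_f (X.finite_fiber q) (by
          have h3 : Tendsto id (𝓝[openHalf ε] q) (𝓝 q) := tendsto_id.mono_left nhdsWithin_le_nhds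
          refine h3.congr' ?_
          filter_upwards [self_mem_nhdsWithin] with z hz
          exact (hfs z hz).symm) (by
          intro U hU
          obtain ⟨V, hV, hVU⟩ := mem_nhdsWithin_iff_exists_mem_nhds_inter.1 hU
          obtain ⟨ρ, ⟨hρ, hρ1⟩, hρV⟩ := P.nhds_hasBasis.mem_iff.1 hV
          refine ⟨P.h '' Metric.ball 0 ρ ∩ openHalf ε, ?_, ?_, ?_⟩
          · exact inter_mem (nhdsWithin_le_nhds (P.nhds_hasBasis.mem_of_mem ⟨hρ, hρ1⟩))
              self_mem_nhdsWithin
          · exact (inter_subset_inter_left _ hρV).trans hVU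
          · exact (P.isPreconnected_inter_openHalf ε hρ1).image _ (hs.mono inter_subset_right))
      exact ⟨x, hx⟩
    · exact ⟨_, h1 q h⟩
  have h3 := continuousOn_extendFrom (closedHalf_subset_closure ε) h2
  have h4 : EqOn (extendFrom (openHalf ε) s) s (openHalf ε) := fun z hz =>
    extendFrom_eq (subset_closure hz) (h1 z hz)
  refine ⟨h3, h4, ?_⟩
  have h5 : EqOn (fun z => X.f (extendFrom (openHalf ε) s z)) id (openHalf ε) := fun z hz => by
    change X.f _ = z
    rw [h4 hz, hfs z hz]
  exact h5.of_subset_closure (X.continuous_f.comp_continuousOn h3) continuousOn_id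
    (openHalf_subset ε) (closedHalf_subset_closure ε)

/-- A full system of sheets over a closed half plane. -/
structure IsHalfSheets (ε : Bool) {d : ℕ} (s : Fin d → Sphere → X.C) : Prop where
  cont : ∀ k, ContinuousOn (s k) (closedHalf ε)
  f_s : ∀ k, ∀ z ∈ closedHalf ε, X.f (s k z) = z
  surj : ∀ x, X.f x ∈ closedHalf ε → ∃ k, s k (X.f x) = x
  inj : ∀ k l, ∀ z ∈ closedHalf ε, z ∉ vertices b → s k z = s l z → k = l

/-- The sheets over the closed half plane have compact images, so their union is closed. Since `f`
is open, the preimage of the open half plane is dense in that of the closed one. -/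
lemma surj_of_surj_openHalf (ε : Bool) {d : ℕ} {s : Fin d → Sphere → X.C}
    (hs : ∀ k, ContinuousOn (s k) (closedHalf ε)) (hfs : ∀ k, ∀ z ∈ closedHalf ε, X.f (s k z) = z)
    (h : ∀ x, X.f x ∈ openHalf ε → ∃ k, s k (X.f x) = x) (x : X.C) (hx : X.f x ∈ closedHalf ε) :
    ∃ k, s k (X.f x) = x := by
  have hcl : IsClosed (⋃ k, s k '' closedHalf ε) := isClosed_iUnion_of_finite fun k =>
    ((isClosed_closedHalf ε).isCompact.image_of_continuousOn (hs k)).isClosed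
  have h1 : X.f ⁻¹' openHalf ε ⊆ ⋃ k, s k '' closedHalf ε := by
    intro y hy
    obtain ⟨k, hk⟩ := h y hy
    exact mem_iUnion.2 ⟨k, X.f y, openHalf_subset ε hy, hk⟩
  have h2 : x ∈ closure (X.f ⁻¹' openHalf ε) := by
    rw [mem_closure_iff_nhds]
    intro N hN
    have h3 := X.isOpenMap.image_mem_nhds hN
    obtain ⟨z, ⟨y, hy, rfl⟩, hz⟩ := mem_closure_iff_nhds.1 (closedHalf_subset_closure ε hx) _ h3
    exact ⟨y, hy, hz⟩
  obtain ⟨k, z, hz, hk⟩ := mem_iUnion.1 (hcl.closure_subset_iff.2 h1 h2)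
  refine ⟨k, ?_⟩
  rw [← hk, hfs k z hz]

lemma exists_isHalfSheets (h : ∀ x, X.f x ∉ vertices b → HasRamificationIndex X.f x 1) (ε : Bool)
    {d : ℕ} (ν : Fin d ≃ X.f ⁻¹' {basePt ε}) :
    ∃ s : Fin d → Sphere → X.C, X.IsHalfSheets b ε s ∧ ∀ k, s k (basePt ε) = ν k := by
  have hX := X.isCoveringMapOn b h
  have hν : ∀ k, X.f (ν k) = basePt ε := fun k => (ν k).2
  have := fun k => X.exists_section_on_openHalf b hX ε (x := ν k) (by rw [hν]; exact basePt_mem ε)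
  choose s₀ h1 h2 h3 h4 using this
  simp only [hν] at h3 h4
  obtain ⟨s, h5⟩ : ∃ s : Fin d → Sphere → X.C, ∀ k, ContinuousOn (s k) (closedHalf ε) ∧
      EqOn (s k) (s₀ k) (openHalf ε) ∧ ∀ z ∈ closedHalf ε, X.f (s k z) = z :=
    ⟨_, fun k => X.extendFrom_section ε (h1 k) (h2 k)⟩
  have hbase : ∀ k, s k (basePt ε) = ν k := fun k => by rw [(h5 k).2.1 (basePt_mem ε), h3]
  -- Two sections that agree at one point agree at the base point by uniqueness of lifts, where `ν`
  -- separates them.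
  have hinj : ∀ k l, ∀ z ∈ openHalf ε, s k z = s l z → k = l := by
    intro k l z hz hkl
    rw [(h5 k).2.1 hz, (h5 l).2.1 hz] at hkl
    obtain ⟨t, -, -, -, ht⟩ := X.exists_section_on_openHalf b hX ε (x := s₀ k z)
      (by rw [h2 k z hz]; exact hz)
    rw [h2 k z hz] at ht
    have h6 := ht _ (h1 k) (h2 k) rfl (basePt_mem ε)
    have h7 := ht _ (h1 l) (h2 l) hkl.symm (basePt_mem ε)
    rw [← h7, h3, h3] at h6
    exact ν.injective (Subtype.ext h6)
  refine ⟨s, ⟨fun k => (h5 k).1, fun k => (h5 k).2.2, ?_, ?_⟩, hbase⟩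
  · refine X.surj_of_surj_openHalf ε (fun k => (h5 k).1) (fun k => (h5 k).2.2) ?_
    intro x hx
    obtain ⟨t, ht1, ht2, ht3, -⟩ := X.exists_section_on_openHalf b hX ε hx
    -- The sheet through `x` is identified by following the section through `x` to the base point.
    let k := ν.symm ⟨t (basePt ε), ht2 _ (basePt_mem ε)⟩
    refine ⟨k, ?_⟩
    rw [(h5 k).2.1 hx, ← h4 k t ht1 ht2 (by simp [k]) hx, ht3]
  · intro k l z hz hzV hkl
    by_contra hne
    have := openHalf_nhdsWithin_neBot hz
    have hx := h (s k z) (by rwa [(h5 k).2.2 z hz])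
    obtain ⟨φ, hφ, hφf⟩ := hx.exists_openPartialHomeomorph
    have hk : Tendsto (s k) (𝓝[openHalf ε \ {z}] z) (𝓝 (s k z)) :=
      ((h5 k).1 z hz).mono_left (nhdsWithin_mono _ (sdiff_subset.trans (openHalf_subset ε)))
    have hl : Tendsto (s l) (𝓝[openHalf ε \ {z}] z) (𝓝 (s l z)) :=
      ((h5 l).1 z hz).mono_left (nhdsWithin_mono _ (sdiff_subset.trans (openHalf_subset ε)))
    -- Two sheets that meet over `z` would both enter a neighbourhood on which `f` is injective, and
    -- so coincide over nearby points of the open half plane.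
    have hev : ∀ᶠ w in 𝓝[openHalf ε \ {z}] z, False := by
      filter_upwards [hk (φ.open_source.mem_nhds hφ),
        hl (φ.open_source.mem_nhds (hkl ▸ hφ)), self_mem_nhdsWithin] with w hw1 hw2 hw3
      refine hne (hinj k l w hw3.1 (φ.injOn hw1 hw2 ?_))
      rw [← hφf hw1, ← hφf hw2, (h5 k).2.2 w (openHalf_subset ε hw3.1),
        (h5 l).2.2 w (openHalf_subset ε hw3.1)]
    exact hev.exists.elim fun _ h => h

end BranchedCover

end Hurwitz

end

/-! ### Sheets over both half planes, gluing permutations and monodromy -/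

noncomputable section

namespace Hurwitz

open Set Filter Topology

open Equiv (Perm)

/-- A labelling of the sheets of a branched cover over the two half planes, together with the
permutations by which the sheets are glued along the arcs. -/
structure Sheets {r : ℕ} (b : Fin r → ℝ) (d : ℕ) (X : BranchedCover) where
  s : Bool → Fin d → Sphere → X.C
  half : ∀ ε, X.IsHalfSheets b ε (s ε)
  g : Fin (r + 1) → Perm (Fin d)
  g_zero : g 0 = 1
  glue : ∀ z k, him z = 0 → z ∉ vertices b → s true k z = s false (g (lidx b z) k) z

namespace BranchedCover

variable {X : BranchedCover} {r : ℕ} {b : Fin r → ℝ} {d : ℕ}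

/-- An arc is connected and free of vertices, and over it the lower sheets are pairwise disjoint and
exhaust the fibres. Each upper sheet therefore continues into one lower sheet along the whole arc.
-/
lemma IsHalfSheets.arc_perm {s t : Fin d → Sphere → X.C}
    (hs : X.IsHalfSheets b true s) (ht : X.IsHalfSheets b false t) (hb : StrictMono b)
    (j : Fin (r + 1)) : ∃ g : Perm (Fin d), ∀ k, ∀ z ∈ arc b j, s k z = t (g k) z := by
  have hsub : ∀ ε, arc b j ⊆ closedHalf ε := fun ε z hz => mem_closedHalf_of_him_eq_zero hz.1 ε
  have h : ∀ k, ∃ l, EqOn (s k) (t l) (arc b j) := fun k => by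
    refine exists_eqOn_of_family (isPreconnected_arc b j) (arc_nonempty b hb j)
      (fun l => (ht.cont l).mono (hsub _)) ((hs.cont k).mono (hsub _)) (fun z hz => ?_)
      (fun l l' z hz => ht.inj l l' z (hsub _ hz) hz.2.1)
    have h1 := hs.f_s k z (hsub _ hz)
    obtain ⟨l, hl⟩ := ht.surj (s k z) (by rw [h1]; exact hsub _ hz)
    rw [h1] at hl
    exact ⟨l, hl.symm⟩
  choose g hg using h
  obtain ⟨z, hz⟩ := arc_nonempty b hb j
  have hinj : Function.Injective g := by
    intro k l hkl
    refine hs.inj k l z (hsub _ hz) hz.2.1 ?_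
    rw [hg k hz, hg l hz, hkl]
  exact ⟨Equiv.ofBijective g (Finite.injective_iff_bijective.1 hinj), fun k z hz => hg k hz⟩

lemma IsHalfSheets.reindex {ε : Bool} {s : Fin d → Sphere → X.C} (hs : X.IsHalfSheets b ε s)
    (g : Perm (Fin d)) : X.IsHalfSheets b ε fun k => s (g k) where
  cont k := hs.cont _
  f_s k := hs.f_s _
  surj x hx := by
    obtain ⟨k, hk⟩ := hs.surj x hx
    exact ⟨g.symm k, by simpa using hk⟩
  inj k l z hz hz' h := g.injective (hs.inj _ _ z hz hz' h)

/-- Every numbering of the base fibre extends to a labelling of the sheets. -/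
lemma exists_sheets (hb : StrictMono b)
    (h : ∀ x, X.f x ∉ vertices b → HasRamificationIndex X.f x 1)
    (hd : ∀ q, q ∉ vertices b → Nat.card (X.f ⁻¹' {q}) = d)
    (ν : Fin d ≃ X.f ⁻¹' {basePt true}) :
    ∃ S : Sheets b d X, ∀ k, S.s true k (basePt true) = ν k := by
  have : Finite (X.f ⁻¹' {basePt false}) := X.finite_fiber _
  let ν' : Fin d ≃ X.f ⁻¹' {basePt false} :=
    (Finite.equivFinOfCardEq (hd _ (notMem_vertices_of_mem_openHalf b (basePt_mem false)))).symm
  obtain ⟨s, hs, hsν⟩ := X.exists_isHalfSheets b h true ν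
  obtain ⟨t, ht, -⟩ := X.exists_isHalfSheets b h false ν'
  choose g hg using fun j => hs.arc_perm ht hb j
  -- Renumbering the lower sheets through arc `0` achieves `g 0 = 1` and multiplies the other
  -- gluings by `(g 0)⁻¹` on the left.
  refine ⟨⟨fun ε => cond ε s fun k => t (g 0 k), ?_, fun j => (g 0)⁻¹ * g j, by simp, ?_⟩, hsν⟩
  · rintro (_ | _)
    · exact ht.reindex (g 0)
    · exact hs
  · intro z k h1 h2
    simpa using hg (lidx b z) k z ⟨h1, h2, rfl⟩

end BranchedCover

namespace Sheets

variable {X Y : BranchedCover} {r : ℕ} {b : Fin r → ℝ} {d : ℕ} (S : Sheets b d X)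

lemma cont (ε : Bool) (k : Fin d) : ContinuousOn (S.s ε k) (closedHalf ε) := (S.half ε).cont k

lemma f_s {ε : Bool} (k : Fin d) {z : Sphere} (hz : z ∈ closedHalf ε) : X.f (S.s ε k z) = z :=
  (S.half ε).f_s k z hz

lemma surj {ε : Bool} {x : X.C} (hx : X.f x ∈ closedHalf ε) : ∃ k, S.s ε k (X.f x) = x :=
  (S.half ε).surj x hx

lemma inj {ε : Bool} {k l : Fin d} {z : Sphere} (hz : z ∈ closedHalf ε) (hz' : z ∉ vertices b)
    (h : S.s ε k z = S.s ε l z) : k = l := (S.half ε).inj k l z hz hz' h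

lemma isClosed_image (ε : Bool) (k : Fin d) {T : Set Sphere} (hT : IsClosed T)
    (hsub : T ⊆ closedHalf ε) : IsClosed (S.s ε k '' T) :=
  (hT.isCompact.image_of_continuousOn ((S.cont ε k).mono hsub)).isClosed

/-- Over the connected open half plane a sheet of one labelling is a sheet of the other, recognised
by its value at the base point. Density extends this to the boundary. -/
lemma eqOn_of_eq_basePt (S' : Sheets b d X) {ε : Bool} {k l : Fin d}
    (h : S.s ε k (basePt ε) = S'.s ε l (basePt ε)) : EqOn (S.s ε k) (S'.s ε l) (closedHalf ε) := by
  have hsub := openHalf_subset ε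
  obtain ⟨m, hm⟩ := exists_eqOn_of_family (isPreconnected_openHalf ε) ⟨_, basePt_mem ε⟩
    (fun m => (S'.cont ε m).mono hsub) ((S.cont ε k).mono hsub) (fun z hz => by
      have h1 := S.f_s k (hsub hz)
      obtain ⟨m, hm⟩ := S'.surj (x := S.s ε k z) (ε := ε) (by rw [h1]; exact hsub hz)
      rw [h1] at hm
      exact ⟨m, hm.symm⟩)
    (fun m m' z hz => S'.inj (hsub hz) (notMem_vertices_of_mem_openHalf b hz))
  have hml : m = l := by
    refine S'.inj (hsub (basePt_mem ε)) (notMem_vertices_of_mem_openHalf b (basePt_mem ε)) ?_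
    rw [← hm (basePt_mem ε), h]
  subst hml
  exact hm.of_subset_closure (S.cont ε k) (S'.cont ε m) hsub (closedHalf_subset_closure ε)

/-- The gluing permutations are determined by the numbering of the base fibre. -/
lemma g_eq_of_eq_basePt (hb : StrictMono b) (S' : Sheets b d X)
    (h : ∀ k, S.s true k (basePt true) = S'.s true k (basePt true)) : S.g = S'.g := by
  have h1 : ∀ k, EqOn (S.s true k) (S'.s true k) (closedHalf true) := fun k =>
    S.eqOn_of_eq_basePt S' (h k)
  have hsub : ∀ ε {j}, arc b j ⊆ closedHalf ε := fun ε j z hz => mem_closedHalf_of_him_eq_zero hz.1 ε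
  -- Arc `0` transfers the agreement from the upper to the lower sheets, because both gluings are
  -- the identity there.
  have h2 : ∀ k, EqOn (S.s false k) (S'.s false k) (closedHalf false) := by
    intro k
    have h3 := S.f_s (ε := false) k (openHalf_subset false (basePt_mem false))
    obtain ⟨l, hl⟩ := S'.surj (x := S.s false k (basePt false)) (ε := false)
      (by rw [h3]; exact openHalf_subset false (basePt_mem false))
    rw [h3] at hl
    have h4 := S.eqOn_of_eq_basePt S' hl.symm
    obtain ⟨z, hz⟩ := arc_nonempty b hb 0
    have h5 := S.glue z k hz.1 hz.2.1
    have h6 := S'.glue z k hz.1 hz.2.1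
    rw [hz.2.2, S.g_zero, Equiv.Perm.one_apply] at h5
    rw [hz.2.2, S'.g_zero, Equiv.Perm.one_apply] at h6
    have h7 : l = k := by
      refine S'.inj (hsub false hz) hz.2.1 ?_
      rw [← h4 (hsub false hz), ← h5, ← h6, h1 k (hsub true hz)]
    rwa [h7] at h4
  funext j
  ext1 k
  obtain ⟨z, hz⟩ := arc_nonempty b hb j
  have h5 := S.glue z k hz.1 hz.2.1
  have h6 := S'.glue z k hz.1 hz.2.1
  rw [hz.2.2] at h5 h6
  refine S'.inj (hsub false hz) hz.2.1 ?_
  rw [← h2 _ (hsub false hz), ← h5, ← h6, h1 k (hsub true hz)]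

/-- The monodromy around a point of the real circle. -/
def monodromy (q : Sphere) : Perm (Fin d) := (S.g (lidx b q))⁻¹ * S.g (ridx b q)

/-- Both sheets are continuous along the circle up to `q`, so distinct limits would separate them
near `q`. The gluing relation on an open arc thereby passes to its end points. -/
lemma s_false_eq_of_tendsto {q : Sphere} {k l : Fin d} (h : him q = 0)
    (hf : ∃ᶠ z in 𝓝 q, him z = 0 ∧ S.s true k z = S.s false l z) :
    S.s true k q = S.s false l q := by
  have h1 : Tendsto (S.s true k) (𝓝[{z | him z = 0}] q) (𝓝 (S.s true k q)) :=
    (S.cont true k q (mem_closedHalf_of_him_eq_zero h _)).mono_left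
      (nhdsWithin_mono _ fun z hz => mem_closedHalf_of_him_eq_zero hz _)
  have h2 : Tendsto (S.s false l) (𝓝[{z | him z = 0}] q) (𝓝 (S.s false l q)) :=
    (S.cont false l q (mem_closedHalf_of_him_eq_zero h _)).mono_left
      (nhdsWithin_mono _ fun z hz => mem_closedHalf_of_him_eq_zero hz _)
  by_contra hne
  obtain ⟨u, v, hu, hv, huv⟩ := t2_separation_nhds hne
  have h3 : ∀ᶠ z in 𝓝 q, him z = 0 → S.s true k z ∈ u ∧ S.s false l z ∈ v :=
    eventually_nhdsWithin_iff.1 ((h1.eventually_mem hu).and (h2.eventually_mem hv))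
  obtain ⟨z, ⟨hz, hzz⟩, hzuv⟩ := (hf.and_eventually h3).exists
  obtain ⟨h4, h5⟩ := hzuv hz
  rw [hzz] at h4
  exact Set.disjoint_left.1 huv h4 h5

/-- The gluing along the arc to the right of a point of the real circle, at the point itself. -/
lemma s_true_eq_right {q : Sphere} (h : him q = 0) (k : Fin d) :
    S.s true k q = S.s false (S.g (ridx b q) k) q := by
  obtain ⟨P⟩ := exists_localParam b h
  refine S.s_false_eq_of_tendsto h ?_
  rw [P.nhds_hasBasis.frequently_iff]
  rintro ρ ⟨hρ, hρ1⟩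
  have hn : ‖((ρ / 2 : ℝ) : ℂ)‖ < ρ := by
    rw [Complex.norm_real, Real.norm_of_nonneg (by linarith)]; linarith
  refine ⟨P.h (ρ / 2 : ℝ), mem_image_of_mem _ (by simpa using hn), ?_, ?_⟩
  · rw [P.him_eq_zero_iff (hn.trans hρ1), Complex.ofReal_im]
  · rw [S.glue _ k ((P.him_eq_zero_iff (hn.trans hρ1)).2 (Complex.ofReal_im _))
      (P.notMem _ (hn.trans hρ1) (by exact_mod_cast (by linarith : ρ / 2 ≠ 0))),
      P.right _ (by linarith) (by linarith)]

lemma s_true_eq_left {q : Sphere} (h : him q = 0) (k : Fin d) :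
    S.s true k q = S.s false (S.g (lidx b q) k) q := by
  obtain ⟨P⟩ := exists_localParam b h
  refine S.s_false_eq_of_tendsto h ?_
  rw [P.nhds_hasBasis.frequently_iff]
  rintro ρ ⟨hρ, hρ1⟩
  have hn : ‖((-(ρ / 2) : ℝ) : ℂ)‖ < ρ := by
    rw [Complex.norm_real, norm_neg, Real.norm_of_nonneg (by linarith)]; linarith
  refine ⟨P.h (-(ρ / 2) : ℝ), mem_image_of_mem _ (by simpa using hn), ?_, ?_⟩
  · rw [P.him_eq_zero_iff (hn.trans hρ1), Complex.ofReal_im]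
  · rw [S.glue _ k ((P.him_eq_zero_iff (hn.trans hρ1)).2 (Complex.ofReal_im _))
      (P.notMem _ (hn.trans hρ1) (by exact_mod_cast (by linarith : -(ρ / 2) ≠ 0))),
      P.left _ (by linarith) (by linarith)]

lemma s_false_eq {q : Sphere} (h : him q = 0) (k : Fin d) :
    S.s false k q = S.s true ((S.g (ridx b q))⁻¹ k) q := by
  rw [S.s_true_eq_right h]; simp

/-- Going down across the arc to the right of `q` and up again across the arc to its left does not
change the point over `q`. -/
lemma s_monodromy {q : Sphere} (h : him q = 0) (k : Fin d) :
    S.s true (S.monodromy q k) q = S.s true k q := by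
  rw [S.s_true_eq_left h, S.s_true_eq_right h k, monodromy]
  simp

lemma s_eq_of_sameCycle {q : Sphere} (h : him q = 0) {k l : Fin d}
    (hkl : (S.monodromy q).SameCycle k l) : S.s true k q = S.s true l q := by
  obtain ⟨n, rfl⟩ := hkl
  have key : ∀ (n : ℕ) (m : Fin d), S.s true ((S.monodromy q ^ n) m) q = S.s true m q := by
    intro n
    induction n with
    | zero => simp
    | succ n ih =>
      intro m
      rw [pow_succ', Equiv.Perm.mul_apply, S.s_monodromy h, ih]
  rcases n with n | n
  · simpa using (key n k).symm
  · have := key (n + 1) ((S.monodromy q ^ (Int.negSucc n)) k)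
    rw [zpow_negSucc, ← Equiv.Perm.mul_apply, mul_inv_cancel, Equiv.Perm.one_apply] at this
    rw [zpow_negSucc]; exact this

/-- Lower sheets are numbered near `q` through the right arc. With this convention a union `K` of
monodromy cycles is respected by crossings of both arcs next to `q`. -/
lemma lidx_perm_mem_iff {q : Sphere} {K : Set (Fin d)}
    (hK : ∀ k, S.monodromy q k ∈ K ↔ k ∈ K) {j : Fin (r + 1)} (hj : j = lidx b q ∨ j = ridx b q)
    (k : Fin d) : (S.g (ridx b q))⁻¹ (S.g j k) ∈ K ↔ k ∈ K := by
  rcases hj with rfl | rfl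
  · rw [← hK ((S.g (ridx b q))⁻¹ (S.g (lidx b q) k)), monodromy]
    simp
  · simp

/-- The union of the sheets over both half planes which are numbered by `K` near `q`. -/
def sheetUnion (q : Sphere) (K : Set (Fin d)) : Set X.C :=
  ⋃ k ∈ K, (S.s true k '' closedHalf true ∪ S.s false (S.g (ridx b q) k) '' closedHalf false)

lemma isClosed_sheetUnion (q : Sphere) (K : Set (Fin d)) : IsClosed (S.sheetUnion q K) :=
  K.toFinite.isClosed_biUnion fun _ _ =>
    (S.isClosed_image _ _ (isClosed_closedHalf _) le_rfl).union
      (S.isClosed_image _ _ (isClosed_closedHalf _) le_rfl)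

lemma mem_sheetUnion {q : Sphere} {K : Set (Fin d)} {y : X.C} :
    y ∈ S.sheetUnion q K ↔ ∃ k ∈ K, (X.f y ∈ closedHalf true ∧ S.s true k (X.f y) = y) ∨
      (X.f y ∈ closedHalf false ∧ S.s false (S.g (ridx b q) k) (X.f y) = y) := by
  simp only [sheetUnion, mem_iUnion, mem_union, exists_prop]
  refine exists_congr fun k => and_congr_right fun _ => or_congr ?_ ?_
  all_goals
    constructor
    · rintro ⟨z, hz, rfl⟩
      rw [S.f_s _ hz]
      exact ⟨hz, rfl⟩
    · rintro ⟨h1, h2⟩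
      exact ⟨_, h1, h2⟩

lemma sheetUnion_union (q : Sphere) (K : Set (Fin d)) :
    S.sheetUnion q K ∪ S.sheetUnion q Kᶜ = univ := by
  refine eq_univ_of_forall fun y => ?_
  obtain ⟨ε, hε⟩ := exists_mem_closedHalf (X.f y)
  obtain ⟨k, hk⟩ := S.surj hε
  cases ε
  · by_cases h : (S.g (ridx b q))⁻¹ k ∈ K
    · exact Or.inl (S.mem_sheetUnion.2 ⟨_, h, Or.inr ⟨hε, by simpa using hk⟩⟩)
    · exact Or.inr (S.mem_sheetUnion.2 ⟨_, h, Or.inr ⟨hε, by simpa using hk⟩⟩)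
  · by_cases h : k ∈ K
    · exact Or.inl (S.mem_sheetUnion.2 ⟨_, h, Or.inl ⟨hε, hk⟩⟩)
    · exact Or.inr (S.mem_sheetUnion.2 ⟨_, h, Or.inl ⟨hε, hk⟩⟩)

/-- Sheets with different numbers do not meet over a small punctured disc. -/
lemma sheetUnion_disjoint {q : Sphere} {K : Set (Fin d)}
    (hK : ∀ k, S.monodromy q k ∈ K ↔ k ∈ K) {y : X.C} (hy : X.f y ∉ vertices b)
    (hl : him (X.f y) = 0 → lidx b (X.f y) = lidx b q ∨ lidx b (X.f y) = ridx b q)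
    (h1 : y ∈ S.sheetUnion q K) (h2 : y ∈ S.sheetUnion q Kᶜ) : False := by
  have mixed : ∀ k k', X.f y ∈ closedHalf true → S.s true k (X.f y) = y →
      X.f y ∈ closedHalf false → S.s false (S.g (ridx b q) k') (X.f y) = y → (k' ∈ K ↔ k ∈ K) := by
    intro k k' a1 a2 a3 a4
    have h0 : him (X.f y) = 0 := by
      simp only [closedHalf, sg, mem_ofPred_eq, cond_true, cond_false] at a1 a3
      linarith
    rw [S.glue _ k h0 hy, ← a4, S.f_s _ a3] at a2
    have h3 := S.inj a3 hy a2
    rw [← S.lidx_perm_mem_iff hK (hl h0) k, h3]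
    simp
  obtain ⟨k, hk, hk'⟩ := S.mem_sheetUnion.1 h1
  obtain ⟨l, hl, hl'⟩ := S.mem_sheetUnion.1 h2
  rcases hk' with ⟨a1, a2⟩ | ⟨a1, a2⟩ <;> rcases hl' with ⟨a3, a4⟩ | ⟨a3, a4⟩
  · exact hl (S.inj a1 hy (a2.trans a4.symm) ▸ hk)
  · exact hl ((mixed k l a1 a2 a3 a4).2 hk)
  · exact hl ((mixed l k a3 a4 a1 a2).1 hk)
  · exact hl ((S.g (ridx b q)).injective (S.inj a1 hy (a2.trans a4.symm)) ▸ hk)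

lemma tendsto_openHalf {ε : Bool} {q : Sphere} (hq : q ∈ closedHalf ε) (k : Fin d) :
    Tendsto (S.s ε k) (𝓝[openHalf ε \ {q}] q) (𝓝 (S.s ε k q)) :=
  (S.cont ε k q hq).mono_left (nhdsWithin_mono _ (sdiff_subset.trans (openHalf_subset ε)))

/-- Two sheets meet at a point `q` of the real circle if and only if they belong to the same cycle
of the monodromy. -/
lemma s_eq_iff_sameCycle {q : Sphere} (h : him q = 0) {k l : Fin d} :
    S.s true k q = S.s true l q ↔ (S.monodromy q).SameCycle k l := by
  refine ⟨fun hkl => ?_, S.s_eq_of_sameCycle h⟩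
  by_contra hcon
  have hq := mem_closedHalf_of_him_eq_zero h true
  set x := S.s true k q with hx
  have hfx : X.f x = q := S.f_s k hq
  set K : Set (Fin d) := {m | (S.monodromy q).SameCycle k m} with hKdef
  have hK : ∀ m, S.monodromy q m ∈ K ↔ m ∈ K := fun m => Equiv.Perm.sameCycle_apply_right
  obtain ⟨P⟩ := exists_localParam b h
  obtain ⟨e, he⟩ := X.locally_power x
  have hN : X.f ⁻¹' (P.h '' Metric.ball 0 (1 / 2)) ∈ 𝓝 x := by
    refine X.continuous_f.continuousAt.preimage_mem_nhds ?_
    rw [hfx]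
    exact P.nhds_hasBasis.mem_of_mem ⟨by norm_num, by norm_num⟩
  obtain ⟨N', hN', ho, hxN', hpre, hfib, -⟩ := he.exists_nhds hN
  have := openHalf_nhdsWithin_neBot hq
  have near : ∀ m, S.s true m q = x → ∃ z ∈ openHalf true, S.s true m z ∈ N' \ {x} := by
    intro m hm
    have h1 := (S.tendsto_openHalf hq m).eventually_mem (hm ▸ ho.mem_nhds hxN')
    obtain ⟨z, hz1, hz2⟩ := (h1.and self_mem_nhdsWithin).exists
    refine ⟨z, hz2.1, hz1, fun h2 => hz2.2 ?_⟩
    rw [mem_singleton_iff] at h2 ⊢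
    rw [← S.f_s m (openHalf_subset _ hz2.1), h2, hfx]
  obtain ⟨z₁, hz₁, hn₁⟩ := near k rfl
  obtain ⟨z₂, hz₂, hn₂⟩ := near l hkl.symm
  have mem : ∀ (m : Fin d) (z : Sphere) (K' : Set (Fin d)), z ∈ openHalf true → m ∈ K' →
      S.s true m z ∈ S.sheetUnion q K' := fun m z K' hz hm =>
    S.mem_sheetUnion.2 ⟨m, hm, Or.inl (by
      rw [S.f_s m (openHalf_subset _ hz)]; exact ⟨openHalf_subset _ hz, rfl⟩)⟩
  -- The punctured neighbourhood of `x` is connected and meets both closed sheet unions, which cover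
  -- everything. They therefore share a point over a small punctured disc, where they were shown to
  -- be disjoint.
  obtain ⟨y, hyN, hy1, hy2⟩ := isPreconnected_closed_iff.1 hpre (S.sheetUnion q K) (S.sheetUnion q Kᶜ)
    (S.isClosed_sheetUnion q K) (S.isClosed_sheetUnion q Kᶜ)
    (by rw [S.sheetUnion_union]; exact subset_univ _)
    ⟨_, hn₁, mem k z₁ K hz₁ (Equiv.Perm.SameCycle.refl _ _)⟩
    ⟨_, hn₂, mem l z₂ Kᶜ hz₂ hcon⟩
  obtain ⟨w, hw, hwy⟩ := hN' hyN.1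
  have hw1 : ‖w‖ < 1 := by
    have : ‖w‖ < 1 / 2 := by simpa using hw
    linarith
  have hw0 : w ≠ 0 := by
    rintro rfl
    exact hyN.2 (hfib y hyN.1 (by rw [← hwy, P.zero, hfx]))
  refine S.sheetUnion_disjoint hK ?_ ?_ hy1 hy2
  · rw [← hwy]; exact P.notMem w hw1 hw0
  · rw [← hwy]
    intro h0
    exact P.lidx_eq_or hw1 hw0 ((P.him_eq_zero_iff hw1).1 h0)

/-- The ramification index is the number of sheets which meet at a point. -/
lemma ramificationIndex_eq {ε : Bool} {x : X.C} {e : ℕ} (he : HasRamificationIndex X.f x e)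
    (hx : X.f x ∈ closedHalf ε) : {k | S.s ε k (X.f x) = x}.ncard = e := by
  set q := X.f x with hq
  set K := {k | S.s ε k q = x} with hK
  have h1 : ∀ k, ∃ U V : Set X.C, U ∈ 𝓝 x ∧ V ∈ 𝓝 (S.s ε k q) ∧ (k ∉ K → Disjoint U V) := by
    intro k
    by_cases hk : S.s ε k q = x
    · exact ⟨univ, univ, univ_mem, univ_mem, fun h => absurd hk h⟩
    · obtain ⟨u, v, hu, hv, huv⟩ := t2_separation_nhds (Ne.symm hk)
      exact ⟨u, v, hu, hv, fun _ => huv⟩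
  choose U V hU hV hUV using h1
  obtain ⟨N', hN', ho, hxN', -, hfib, hev⟩ := he.exists_nhds (iInter_mem.2 hU : ⋂ k, U k ∈ 𝓝 x)
  have := openHalf_nhdsWithin_neBot hx
  -- Over `z` close to `q`, the sheets through `x` have their values in `N'`, and all other sheets
  -- stay away from it.
  have h2 : ∀ᶠ z in 𝓝[openHalf ε \ {q}] q, ∀ k, S.s ε k z ∈ V k ∧ (k ∈ K → S.s ε k z ∈ N') := by
    rw [eventually_all]
    intro k
    have h3 := S.tendsto_openHalf hx k
    by_cases hk : k ∈ K
    · have h4 : S.s ε k q = x := hk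
      filter_upwards [h3.eventually_mem (hV k), h3.eventually_mem (h4 ▸ ho.mem_nhds hxN')] with z a1 a2
      exact ⟨a1, fun _ => a2⟩
    · filter_upwards [h3.eventually_mem (hV k)] with z a1
      exact ⟨a1, fun h => absurd h hk⟩
  have h3 : ∀ᶠ z in 𝓝[openHalf ε \ {q}] q, z ≠ q → {y ∈ N' | X.f y = z}.ncard = e :=
    nhdsWithin_le_nhds hev
  obtain ⟨z, ⟨hz1, hz2⟩, hz3⟩ := ((h2.and h3).and self_mem_nhdsWithin).exists
  have hzc := openHalf_subset _ hz3.1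
  rw [← hz2 hz3.2]
  refine Set.ncard_congr (fun k _ => S.s ε k z) ?_ ?_ ?_
  · intro k hk
    exact ⟨(hz1 k).2 hk, S.f_s k hzc⟩
  · intro k l _ _ hkl
    exact S.inj hzc (notMem_vertices_of_mem_openHalf b hz3.1) hkl
  · rintro y ⟨hy, rfl⟩
    obtain ⟨k, hk⟩ := S.surj hzc
    refine ⟨k, ?_, hk⟩
    by_contra hkK
    exact Set.disjoint_left.1 (hUV k hkK) (mem_iInter.1 (hN' hy) k) (hk ▸ (hz1 k).1)

/-- Some index exists at every point by `locally_power`, and the number of sheets determines it, so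
the count also implies the local form. -/
lemma hasRamificationIndex_iff {ε : Bool} {x : X.C} {e : ℕ} (hx : X.f x ∈ closedHalf ε) :
    HasRamificationIndex X.f x e ↔ {k | S.s ε k (X.f x) = x}.ncard = e := by
  refine ⟨fun h => S.ramificationIndex_eq h hx, fun h => ?_⟩
  obtain ⟨e', he'⟩ := X.locally_power x
  rwa [← h, S.ramificationIndex_eq he' hx]

include S in
lemma hasRamificationIndex_one {x : X.C} (hx : X.f x ∉ vertices b) :
    HasRamificationIndex X.f x 1 := by
  obtain ⟨ε, hε⟩ := exists_mem_closedHalf (X.f x)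
  rw [S.hasRamificationIndex_iff hε, Set.ncard_eq_one]
  obtain ⟨k, hk⟩ := S.surj hε
  refine ⟨k, ?_⟩
  ext l
  exact ⟨fun hl => S.inj hε hx (Eq.trans hl hk.symm), fun hl => by rw [show l = k from hl]; exact hk⟩

include S in
lemma card_fiber {q : Sphere} (hq : q ∉ vertices b) : Nat.card (X.f ⁻¹' {q}) = d := by
  obtain ⟨ε, hε⟩ := exists_mem_closedHalf q
  have : Function.Bijective (fun k => (⟨S.s ε k q, S.f_s k hε⟩ : X.f ⁻¹' {q})) := by
    constructor
    · intro k l h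
      exact S.inj hε hq (congrArg Subtype.val h)
    · rintro ⟨x, rfl⟩
      obtain ⟨k, hk⟩ := S.surj hε
      exact ⟨k, Subtype.ext hk⟩
  rw [← Nat.card_eq_of_bijective _ this, Nat.card_fin]

/-- A criterion for two points of sheets to agree, in terms of the gluing permutations. -/
lemma s_eq_iff {ε ε' : Bool} {k l : Fin d} {z z' : Sphere} (hz : z ∈ closedHalf ε)
    (hz' : z' ∈ closedHalf ε') : S.s ε k z = S.s ε' l z' ↔ z = z' ∧
      ((him z ≠ 0 ∧ k = l) ∨ (him z = 0 ∧ (S.monodromy z).SameCycle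
        (cond ε k ((S.g (ridx b z))⁻¹ k)) (cond ε' l ((S.g (ridx b z))⁻¹ l)))) := by
  have key : ∀ ε k, him z = 0 →
      S.s ε k z = S.s true (cond ε k ((S.g (ridx b z))⁻¹ k)) z := by
    rintro (_ | _) k h0
    · exact S.s_false_eq h0 k
    · rfl
  constructor
  · intro h
    have hzz : z = z' := by rw [← S.f_s k hz, h, S.f_s l hz']
    refine ⟨hzz, ?_⟩
    subst hzz
    by_cases h0 : him z = 0
    · right
      rw [key ε k h0, key ε' l h0, S.s_eq_iff_sameCycle h0] at h
      exact ⟨h0, h⟩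
    · left
      refine ⟨h0, ?_⟩
      have h1 := (him_eq_zero_or_mem_openHalf hz).resolve_left h0
      have h2 : ε' = ε := openHalf_disjoint_closedHalf h1 hz'
      subst h2
      exact S.inj hz (notMem_vertices_of_mem_openHalf b h1) h
  · rintro ⟨rfl, ⟨h0, rfl⟩ | ⟨h0, h⟩⟩
    · have h1 := (him_eq_zero_or_mem_openHalf hz).resolve_left h0
      have h2 : ε' = ε := openHalf_disjoint_closedHalf h1 hz'
      rw [h2]
    · rw [key ε k h0, key ε' l h0, S.s_eq_iff_sameCycle h0]
      exact h

lemma s_eq_iff_of_g_eq (S' : Sheets b d Y) (hg : S.g = S'.g) {ε ε' : Bool} {k l : Fin d}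
    {z z' : Sphere} (hz : z ∈ closedHalf ε) (hz' : z' ∈ closedHalf ε') :
    S.s ε k z = S.s ε' l z' ↔ S'.s ε k z = S'.s ε' l z' := by
  rw [S.s_eq_iff hz hz', S'.s_eq_iff hz hz', monodromy, monodromy, hg]

/-- A point is sent to the point with the same sheet and the same image in the sphere. Coincidences
between sheets depend on `g` alone, so this is well defined, and preimages of closed sets are finite
unions of compact pieces of sheets. -/
lemma exists_map (S' : Sheets b d Y) (hg : S.g = S'.g) : ∃ φ : X.C → Y.C, Continuous φ ∧
    ∀ ε k, ∀ z ∈ closedHalf ε, φ (S.s ε k z) = S'.s ε k z := by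
  have h : ∀ x : X.C, ∃ y : Y.C, ∃ ε k, X.f x ∈ closedHalf ε ∧ S.s ε k (X.f x) = x ∧
      S'.s ε k (X.f x) = y := by
    intro x
    obtain ⟨ε, hε⟩ := exists_mem_closedHalf (X.f x)
    obtain ⟨k, hk⟩ := S.surj hε
    exact ⟨_, ε, k, hε, hk, rfl⟩
  choose φ hφ using h
  have h1 : ∀ ε k, ∀ z ∈ closedHalf ε, φ (S.s ε k z) = S'.s ε k z := by
    intro ε k z hz
    obtain ⟨ε', k', h1, h2, h3⟩ := hφ (S.s ε k z)
    rw [S.f_s k hz] at h1 h2 h3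
    rw [← h3]
    exact (S.s_eq_iff_of_g_eq S' hg h1 hz).1 h2
  refine ⟨φ, ?_, h1⟩
  rw [continuous_iff_isClosed]
  intro T hT
  have h2 : φ ⁻¹' T = ⋃ ε, ⋃ k, S.s ε k '' (closedHalf ε ∩ S'.s ε k ⁻¹' T) := by
    ext x
    simp only [mem_preimage, mem_iUnion]
    constructor
    · intro hx
      obtain ⟨ε, k, a1, a2, a3⟩ := hφ x
      exact ⟨ε, k, X.f x, ⟨a1, by rw [mem_preimage, a3]; exact hx⟩, a2⟩
    · rintro ⟨ε, k, z, ⟨hz, hz'⟩, rfl⟩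
      rw [h1 ε k z hz]; exact hz'
  rw [h2]
  refine isClosed_iUnion_of_finite fun ε => isClosed_iUnion_of_finite fun k => ?_
  exact S.isClosed_image ε k ((S'.cont ε k).preimage_isClosed_of_isClosed (isClosed_closedHalf ε) hT)
    inter_subset_left

/-- Branched covers with the same gluing permutations are isomorphic. -/
lemma exists_homeomorph (S' : Sheets b d Y) (hg : S.g = S'.g) : ∃ φ : X.C ≃ₜ Y.C,
    (∀ x, Y.f (φ x) = X.f x) ∧ ∀ ε k, ∀ z ∈ closedHalf ε, φ (S.s ε k z) = S'.s ε k z := by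
  obtain ⟨φ, hφ, h1⟩ := S.exists_map S' hg
  obtain ⟨χ, hχ, h2⟩ := S'.exists_map S hg.symm
  have rep : ∀ {X : BranchedCover} (S : Sheets b d X) (x : X.C),
      ∃ ε k, X.f x ∈ closedHalf ε ∧ S.s ε k (X.f x) = x := by
    intro X S x
    obtain ⟨ε, hε⟩ := exists_mem_closedHalf (X.f x)
    obtain ⟨k, hk⟩ := S.surj hε
    exact ⟨ε, k, hε, hk⟩
  refine ⟨⟨⟨φ, χ, fun x => ?_, fun y => ?_⟩, hφ, hχ⟩, fun x => ?_, h1⟩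
  · obtain ⟨ε, k, hε, hk⟩ := rep S x
    rw [← hk, h1 ε k _ hε, h2 ε k _ hε]
  · obtain ⟨ε, k, hε, hk⟩ := rep S' y
    rw [← hk, h2 ε k _ hε, h1 ε k _ hε]
  · obtain ⟨ε, k, hε, hk⟩ := rep S x
    change Y.f (φ x) = X.f x
    rw [← hk, h1 ε k _ hε, S'.f_s k hε, S.f_s k hε]

/-- The sheets are permuted transitively. -/
lemma transitive {K : Set (Fin d)} (hK : ∀ j k, S.g j k ∈ K ↔ k ∈ K) : K = ∅ ∨ K = univ := by
  have hinv : ∀ j k, (S.g j)⁻¹ k ∈ K ↔ k ∈ K := fun j k => by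
    rw [← hK j ((S.g j)⁻¹ k)]; simp
  have hsame : ∀ (q : Sphere) (k l : Fin d), (S.monodromy q).SameCycle k l → (k ∈ K ↔ l ∈ K) := by
    have h1 : ∀ (q : Sphere) (k : Fin d), S.monodromy q k ∈ K ↔ k ∈ K := fun q k => by
      rw [monodromy, Equiv.Perm.mul_apply, hinv, hK]
    rintro q k l hkl
    obtain ⟨n, -, rfl⟩ := hkl.exists_pow_eq'
    induction n with
    | zero => simp
    | succ n ih =>
      rw [pow_succ', Equiv.Perm.mul_apply, h1]
      exact ih ⟨n, by simp⟩
  -- An invariant `K` divides the connected surface into the closed unions of sheets with numbers in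
  -- `K` and in `Kᶜ`, which do not meet.
  let A : Set (Fin d) → Set X.C := fun K => ⋃ ε, ⋃ k ∈ K, S.s ε k '' closedHalf ε
  have hA : ∀ K, IsClosed (A K) := fun K => isClosed_iUnion_of_finite fun ε =>
    K.toFinite.isClosed_biUnion fun k _ => S.isClosed_image ε k (isClosed_closedHalf ε) le_rfl
  have hmem : ∀ K ε k z, z ∈ closedHalf ε → k ∈ K → S.s ε k z ∈ A K := fun K ε k z hz hk =>
    mem_iUnion.2 ⟨ε, mem_iUnion₂.2 ⟨k, hk, mem_image_of_mem _ hz⟩⟩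
  have hU : A K ∪ A Kᶜ = univ := by
    refine eq_univ_of_forall fun y => ?_
    obtain ⟨ε, hε⟩ := exists_mem_closedHalf (X.f y)
    obtain ⟨k, hk⟩ := S.surj hε
    rw [← hk]
    by_cases h : k ∈ K
    · exact Or.inl (hmem K ε k _ hε h)
    · exact Or.inr (hmem Kᶜ ε k _ hε h)
  have hD : ∀ y, y ∈ A K → y ∈ A Kᶜ → False := by
    intro y h1 h2
    simp only [A, mem_iUnion] at h1 h2
    obtain ⟨ε, k, hk, z, hz, rfl⟩ := h1
    obtain ⟨ε', l, hl, z', hz', h⟩ := h2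
    apply hl
    rw [eq_comm, S.s_eq_iff hz hz'] at h
    obtain ⟨rfl, ⟨-, rfl⟩ | ⟨-, h⟩⟩ := h
    · exact hk
    · have h3 := hsame _ _ _ h
      cases ε <;> cases ε' <;> simp only [cond_true, cond_false, hinv] at h3 <;> exact h3.1 hk
  have hbase : ∀ ε, basePt ε ∈ closedHalf ε := fun ε => openHalf_subset ε (basePt_mem ε)
  by_contra hcon
  push Not at hcon
  obtain ⟨⟨k, hk⟩, h2⟩ := hcon
  obtain ⟨l, hl⟩ := (ne_univ_iff_exists_notMem K).1 h2
  obtain ⟨y, -, hy1, hy2⟩ := isPreconnected_closed_iff.1 (isPreconnected_univ (α := X.C)) (A K) (A Kᶜ)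
    (hA K) (hA Kᶜ) hU.ge ⟨_, mem_univ _, hmem K true k _ (hbase _) hk⟩
    ⟨_, mem_univ _, hmem Kᶜ true l _ (hbase _) hl⟩
  exact hD y hy1 hy2

end Sheets

end Hurwitz

end

noncomputable section

namespace Hurwitz

open Set Filter Topology

open Equiv (Perm)

/-! ### Tools for the construction of branched covers -/

/-- The primitive root of unity by which sheets are rotated. -/
def rootUnity (e : ℕ) : ℂ := Complex.exp (2 * Real.pi * Complex.I / e)

/-- The cycle of a permutation through `k₀` can be identified with the roots of unity. -/
lemma exists_cycle_to_roots {d : ℕ} (σ : Perm (Fin d)) (k₀ : Fin d) {e : ℕ}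
    (he : {k | σ.SameCycle k₀ k}.ncard = e) : 0 < e ∧ ∃ c : Fin d → ℂ,
      (∀ k, σ.SameCycle k₀ k → c (σ⁻¹ k) = rootUnity e * c k) ∧
      (∀ k, σ.SameCycle k₀ k → c k ^ e = 1) ∧
      (∀ k l, σ.SameCycle k₀ k → σ.SameCycle k₀ l → c k = c l → k = l) ∧
      ∀ v : ℂ, v ^ e = 1 → ∃ k, σ.SameCycle k₀ k ∧ c k = v := by
  have hper : ∀ n m : ℤ, (σ ^ n) k₀ = (σ ^ m) k₀ ↔ (e : ℤ) ∣ n - m := by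
    intro n m
    have h1 : Function.minimalPeriod (σ • ·) k₀ = e := by
      classical
      rw [MulAction.minimalPeriod_eq_card, ← he, ← Nat.card_eq_fintype_card]
      change Nat.card (MulAction.orbit (Subgroup.zpowers σ) k₀ : Set (Fin d)) = _
      rw [Nat.card_coe_set_eq]
      congr 1
      ext k
      simp only [MulAction.mem_orbit_iff, Subtype.exists, Subgroup.mem_zpowers_iff]
      constructor
      · rintro ⟨_, ⟨n, rfl⟩, h⟩
        exact ⟨n, h⟩
      · rintro ⟨n, h⟩
        exact ⟨_, ⟨n, rfl⟩, h⟩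
    rw [← h1, ← MulAction.zpow_smul_eq_iff_minimalPeriod_dvd, Equiv.Perm.smul_def, sub_eq_neg_add,
      zpow_add, Equiv.Perm.mul_apply, zpow_neg, Equiv.Perm.inv_eq_iff_eq]
  have hpos : 0 < e := by
    rw [← he, Set.ncard_pos]
    exact ⟨k₀, Equiv.Perm.SameCycle.refl _ _⟩
  have hζ : IsPrimitiveRoot (rootUnity e) e := Complex.isPrimitiveRoot_exp e hpos.ne'
  have hζ0 : rootUnity e ≠ 0 := Complex.exp_ne_zero _
  -- The point `σ ^ n k₀` receives `rootUnity e ^ (-n)`, so that `σ⁻¹` becomes multiplication by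
  -- `rootUnity e`, the factor between the two branches of the root on the negative axis. The value
  -- `0` off the cycle is irrelevant.
  have hc : ∀ k, ∃ v : ℂ, ∀ n : ℤ, (σ ^ n) k₀ = k → v = rootUnity e ^ (-n) := by
    intro k
    by_cases h : ∃ n : ℤ, (σ ^ n) k₀ = k
    · obtain ⟨n, rfl⟩ := h
      refine ⟨rootUnity e ^ (-n), fun m hm => ?_⟩
      obtain ⟨t, ht⟩ := (hper m n).1 hm
      have : -n = -m + e * t := by linarith
      rw [this, zpow_add₀ hζ0, zpow_mul, zpow_natCast, hζ.pow_eq_one, one_zpow, mul_one]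
    · exact ⟨0, fun n hn => absurd ⟨n, hn⟩ h⟩
  choose c hc using hc
  refine ⟨hpos, c, ?_, ?_, ?_, ?_⟩
  · rintro _ ⟨n, rfl⟩
    rw [hc _ n rfl, hc _ (n - 1) (by rw [sub_eq_neg_add, zpow_add, zpow_neg_one]; rfl),
      neg_sub, sub_eq_add_neg, zpow_add₀ hζ0, zpow_one]
  · rintro _ ⟨n, rfl⟩
    rw [hc _ n rfl, ← zpow_natCast, ← zpow_mul, mul_comm, zpow_mul, zpow_natCast, hζ.pow_eq_one,
      one_zpow]
  · rintro _ _ ⟨n, rfl⟩ ⟨m, rfl⟩ h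
    rw [hc _ n rfl, hc _ m rfl] at h
    rw [hper]
    have h1 : rootUnity e ^ (n - m) = 1 := by
      rw [sub_eq_add_neg, zpow_add₀ hζ0, ← h, ← zpow_add₀ hζ0, add_neg_cancel, zpow_zero]
    exact (hζ.zpow_eq_one_iff_dvd _).1 h1
  · intro v hv
    have : NeZero e := ⟨hpos.ne'⟩
    obtain ⟨i, -, rfl⟩ := hζ.eq_pow_of_pow_eq_one hv
    exact ⟨(σ ^ (-(i : ℤ))) k₀, ⟨_, rfl⟩, by rw [hc _ _ rfl]; simp⟩

/-- The branch of the `e`-th root on a closed half plane. -/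
def halfRoot (e : ℕ) (ε : Bool) (w : ℂ) : ℂ :=
  cond ε (w ^ (1 / e : ℂ)) (starRingEnd ℂ ((starRingEnd ℂ w) ^ (1 / e : ℂ)))

section HalfRoot

variable {e : ℕ} (he : 0 < e) (ε : Bool)

include he

lemma halfRoot_zero : halfRoot e ε 0 = 0 := by
  have : (1 / e : ℂ) ≠ 0 := by simp [he.ne']
  cases ε <;> simp [halfRoot, he.ne']

lemma halfRoot_pow (w : ℂ) : halfRoot e ε w ^ e = w := by
  cases ε
  · simp only [halfRoot, cond_false, ← map_pow, one_div]
    rw [Complex.cpow_nat_inv_pow _ he.ne', Complex.conj_conj]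
  · simp only [halfRoot, cond_true, one_div]
    exact Complex.cpow_nat_inv_pow _ he.ne'

lemma halfRoot_ne_zero {w : ℂ} (hw : w ≠ 0) : halfRoot e ε w ≠ 0 := by
  intro h
  have := halfRoot_pow he ε w
  rw [h, zero_pow he.ne'] at this
  exact hw this.symm

omit he in
lemma halfRoot_of_pos {t : ℝ} (ht : 0 < t) : halfRoot e true t = halfRoot e false t := by
  simp only [halfRoot, cond_true, cond_false, Complex.conj_ofReal]
  have : ((t : ℂ) ^ (1 / e : ℂ)) = ((t ^ (1 / e : ℝ) : ℝ) : ℂ) := by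
    rw [Complex.ofReal_cpow ht.le]; simp
  rw [this, Complex.conj_ofReal]

/-- The argument of `-t` is `π` seen from above and `-π` seen from below, so the roots differ by
`exp (2πi/e)`. -/
lemma halfRoot_of_neg {t : ℝ} (ht : 0 < t) :
    halfRoot e true (-t : ℝ) = rootUnity e * halfRoot e false (-t : ℝ) := by
  have he' : (e : ℂ) ≠ 0 := by exact_mod_cast he.ne'
  have ht0 : ((-t : ℝ) : ℂ) ≠ 0 := by exact_mod_cast (neg_neg_of_pos ht).ne
  simp only [halfRoot, cond_true, cond_false, Complex.conj_ofReal]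
  have h1 : Complex.log ((-t : ℝ) : ℂ) = (Real.log t : ℂ) + Real.pi * Complex.I := by
    apply Complex.ext
    · simp [Complex.log_re]
    · rw [Complex.log_im, Complex.arg_ofReal_of_neg (by linarith)]; simp
  rw [Complex.cpow_def_of_ne_zero ht0, h1, ← Complex.exp_conj, rootUnity, ← Complex.exp_add]
  congr 1
  simp only [map_mul, map_add, Complex.conj_ofReal, Complex.conj_I, map_div₀, map_one,
    Complex.conj_natCast]
  field_simp
  ring

/-- The principal logarithm is continuous from above up to the negative axis, and the lower branch
is obtained by conjugation. At `0` the positive real part of the exponent suffices. -/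
lemma continuousOn_halfRoot : ContinuousOn (halfRoot e ε) {w | 0 ≤ sg ε * w.im} := by
  have key : ContinuousOn (fun w : ℂ => w ^ (1 / e : ℂ)) {w | 0 ≤ w.im} := by
    intro w hw
    by_cases h0 : w = 0
    · subst h0
      refine ContinuousAt.continuousWithinAt ?_
      refine Complex.continuousAt_cpow_const_of_re_pos (Or.inl le_rfl) ?_
      have : (1 / e : ℂ).re = 1 / e := by
        rw [← Complex.ofReal_natCast, ← Complex.ofReal_one, ← Complex.ofReal_div, Complex.ofReal_re]
      rw [this]; positivity
    · have hlog : ContinuousWithinAt Complex.log {w | 0 ≤ w.im} w := by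
        by_cases h1 : w ∈ Complex.slitPlane
        · exact (continuousAt_clog h1).continuousWithinAt
        · rw [Complex.mem_slitPlane_iff, not_or, not_lt, not_ne_iff] at h1
          have h2 : w.re < 0 := lt_of_le_of_ne h1.1 fun h => h0 (Complex.ext h h1.2)
          exact Complex.continuousWithinAt_log_of_re_neg_of_im_zero h2 h1.2
      have h3 : ContinuousWithinAt (fun w : ℂ => Complex.exp (Complex.log w * (1 / e : ℂ)))
          {w | 0 ≤ w.im} w := (hlog.mul_const _).cexp
      refine h3.congr_of_eventuallyEq ?_ (Complex.cpow_def_of_ne_zero h0 _)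
      filter_upwards [nhdsWithin_le_nhds (isOpen_ne.mem_nhds h0)] with v hv
      exact Complex.cpow_def_of_ne_zero hv _
  cases ε
  · have h1 : halfRoot e false = fun w => starRingEnd ℂ ((starRingEnd ℂ w) ^ (1 / e : ℂ)) := rfl
    rw [h1]
    refine Complex.continuous_conj.comp_continuousOn (key.comp Complex.continuous_conj.continuousOn ?_)
    intro w hw
    simpa [sg] using hw
  · have h1 : halfRoot e true = fun w => w ^ (1 / e : ℂ) := rfl
    rw [h1]
    simpa [sg] using key

end HalfRoot

/-- A criterion for a map to be `w ↦ w ^ e` in local coordinates. -/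
lemma hasRamificationIndex_of_chart {C : Type} [TopologicalSpace C] [CompactSpace C] {f : C → Sphere}
    (hf : Continuous f) {h : ℂ → Sphere} (hh : IsOpenEmbedding h) {U : Set C} (hU : IsOpen U)
    (hU' : IsOpen (f ⁻¹' (h '' Metric.ball 0 1) \ U)) {Φ : C → ℂ} (hΦ : ContinuousOn Φ U)
    (hinj : InjOn Φ U) (himg : Φ '' U = Metric.ball 0 1) {e : ℕ} (he : 0 < e)
    (hfΦ : ∀ y ∈ U, f y = h (Φ y ^ e)) {x : C} (hx : x ∈ U) (hx0 : Φ x = 0) :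
    HasRamificationIndex f x e := by
  have hball : ∀ y ∈ U, Φ y ∈ Metric.ball (0 : ℂ) 1 := fun y hy => himg ▸ mem_image_of_mem _ hy
  have hpow : ∀ w ∈ Metric.ball (0 : ℂ) 1, w ^ e ∈ Metric.ball (0 : ℂ) 1 := by
    intro w hw
    rw [mem_ball_zero_iff] at hw ⊢
    rw [norm_pow]
    exact pow_lt_one₀ (norm_nonneg _) hw he.ne'
  set D := h '' Metric.ball 0 1 with hD
  have hUD : U ⊆ f ⁻¹' D := fun y hy => by
    rw [mem_preimage, hfΦ y hy]
    exact mem_image_of_mem _ (hpow _ (hball y hy))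
  let Φ' : U → Metric.ball (0 : ℂ) 1 := fun y => ⟨Φ y, hball y y.2⟩
  have hΦ' : Continuous Φ' := (continuousOn_iff_continuous_domRestrict.1 hΦ).subtype_mk _
  let g : Metric.ball (0 : ℂ) 1 → D := fun w => ⟨h (w ^ e), mem_image_of_mem _ (hpow _ w.2)⟩
  have hg : Continuous g :=
    (hh.continuous.comp (continuous_subtype_val.pow e)).subtype_mk _
  -- Followed by the power map, `Φ'` becomes the restriction of the proper map `f` to `U`, which is
  -- closed in the preimage of the disc. A proper continuous bijection is then a homeomorphism.
  have hproper : IsProperMap Φ' := by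
    refine isProperMap_of_comp_of_t2 hΦ' hg ?_
    have h1 : IsProperMap (D.restrictPreimage f) := hf.isProperMap.restrictPreimage D
    have h2 : IsClosedEmbedding (inclusion hUD) := by
      refine ⟨IsEmbedding.inclusion hUD, ?_⟩
      rw [range_inclusion, ← isOpen_compl_iff]
      refine ⟨_, hU', ?_⟩
      ext y
      simp only [mem_preimage, Set.mem_sdiff, mem_compl_iff, mem_ofPred_eq]
      exact ⟨fun h => h.2, fun h => ⟨y.2, h⟩⟩
    have h3 := h1.comp h2.isProperMap
    convert h3 using 1
    funext y
    exact Subtype.ext (hfΦ y y.2).symm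
  have hbij : Function.Bijective Φ' := by
    constructor
    · intro y y' hyy
      exact Subtype.ext (hinj y.2 y'.2 (congrArg Subtype.val hyy))
    · rintro ⟨w, hw⟩
      rw [← himg] at hw
      obtain ⟨y, hy, rfl⟩ := hw
      exact ⟨⟨y, hy⟩, rfl⟩
  have hhomeo : IsHomeomorph Φ' :=
    isHomeomorph_iff_continuous_isClosedMap_bijective.2 ⟨hΦ', hproper.isClosedMap, hbij⟩
  have hemb : IsOpenEmbedding fun y : U => Φ y :=
    (Metric.isOpen_ball.isOpenEmbedding_subtypeVal).comp hhomeo.isOpenEmbedding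
  have : Nonempty U := ⟨⟨x, hx⟩⟩
  let φ : OpenPartialHomeomorph C ℂ :=
    (hU.isOpenEmbedding_subtypeVal.toOpenPartialHomeomorph).symm.trans
      hemb.toOpenPartialHomeomorph
  have hsrc : φ.source = U := by
    simp [φ]
  have hφ : ∀ y ∈ U, φ y = Φ y := by
    intro y hy
    have h1 := hU.isOpenEmbedding_subtypeVal.toOpenPartialHomeomorph_left_inv (x := ⟨y, hy⟩)
    change Φ _ = Φ y
    congr 1
    exact congrArg Subtype.val h1
  refine ⟨he, φ, hh.toOpenPartialHomeomorph.symm, by rwa [hsrc], by rw [hφ x hx, hx0], ?_, ?_, ?_⟩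
  · rw [hfΦ x hx]; simp
  · rw [hfΦ x hx, hx0, zero_pow he.ne']
    exact hh.toOpenPartialHomeomorph_left_inv
  · intro y hy
    rw [hsrc] at hy
    rw [hfΦ y hy, hφ y hy]
    exact ⟨by simp, hh.toOpenPartialHomeomorph_left_inv⟩

end Hurwitz

end

noncomputable section

namespace Hurwitz

open Set Filter Topology

open Equiv (Perm)

/-! ### The branched cover with given gluing permutations -/

namespace Glue

variable {r : ℕ} (b : Fin r → ℝ) {d : ℕ} (g : Fin (r + 1) → Perm (Fin d))

/-- The disjoint union of the closed sheets. -/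
abbrev Pre (d : ℕ) : Type := Σ a : Bool × Fin d, closedHalf a.1

instance (ε : Bool) : CompactSpace (closedHalf ε) :=
  isCompact_iff_compactSpace.1 (isClosed_closedHalf ε).isCompact

/-- The number, near `q`, of the sheet of the upper half plane to which a sheet is glued along the
arc to the right of `q`. -/
def num (q : Sphere) (a : Bool × Fin d) : Fin d := cond a.1 a.2 ((g (ridx b q))⁻¹ a.2)

open Classical in
/-- The monodromy around `q`. -/
def mon (q : Sphere) : Perm (Fin d) := if him q = 0 then (g (lidx b q))⁻¹ * g (ridx b q) else 1

/-- The gluing of the sheets. -/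
@[reducible] def glueSetoid : Setoid (Pre d) where
  r p p' := (p.2 : Sphere) = p'.2 ∧ (p.1 = p'.1 ∨
    him p.2 = 0 ∧ (mon b g p.2).SameCycle (num b g p.2 p.1) (num b g p.2 p'.1))
  iseqv :=
    { refl := fun p => ⟨rfl, Or.inl rfl⟩
      symm := by
        rintro p p' ⟨h1, h2⟩
        refine ⟨h1.symm, h2.imp Eq.symm ?_⟩
        rintro ⟨h3, h4⟩
        rw [← h1]
        exact ⟨h3, h4.symm⟩
      trans := by
        rintro p p' p'' ⟨h1, h2⟩ ⟨h3, h4⟩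
        refine ⟨h1.trans h3, ?_⟩
        rw [← h1] at h4
        rcases h2 with h2 | ⟨h2, h2'⟩
        · rw [← h2] at h4; exact h4
        · rcases h4 with h4 | ⟨h4, h4'⟩
          · rw [← h4]; exact Or.inr ⟨h2, h2'⟩
          · exact Or.inr ⟨h2, h2'.trans h4'⟩ }

/-- The glued space. -/
abbrev Space : Type := Quotient (glueSetoid b g)

/-- The projection to the sphere. -/
def proj : Space b g → Sphere := Quotient.lift (fun p => (p.2 : Sphere)) fun _ _ h => h.1

variable {b g}

lemma continuous_proj : Continuous (proj b g) := by
  refine Continuous.quotient_lift ?_ _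
  exact continuous_sigma fun a => continuous_subtype_val

lemma eq_iff {p p' : Pre d} : (Quotient.mk (glueSetoid b g) p) = Quotient.mk _ p' ↔
    (p.2 : Sphere) = p'.2 ∧ (p.1 = p'.1 ∨
      him p.2 = 0 ∧ (mon b g p.2).SameCycle (num b g p.2 p.1) (num b g p.2 p'.1)) :=
  Quotient.eq

lemma mon_eq {q : Sphere} (h : him q = 0) : mon b g q = (g (lidx b q))⁻¹ * g (ridx b q) := if_pos h

lemma mon_eq_one {q : Sphere} (h : him q = 0) (hq : q ∉ vertices b) : mon b g q = 1 := by
  rw [mon_eq h, lidx_eq_ridx b h hq, inv_mul_cancel]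

lemma isOpen_preimage_star {D : Set Sphere} (hD : IsOpen D) (A : Set (Bool × Fin d)) :
    IsOpen {p : Pre d | (p.2 : Sphere) ∈ D ∧ p.1 ∈ A} := by
  rw [isOpen_sigma_iff]
  intro a
  by_cases ha : a ∈ A
  · have : (Sigma.mk a ⁻¹' {p : Pre d | (p.2 : Sphere) ∈ D ∧ p.1 ∈ A}) =
        ((↑) : closedHalf a.1 → Sphere) ⁻¹' D := by ext z; simp [ha]
    rw [this]
    exact hD.preimage continuous_subtype_val
  · have : (Sigma.mk a ⁻¹' {p : Pre d | (p.2 : Sphere) ∈ D ∧ p.1 ∈ A}) = ∅ := by ext z; simp [ha]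
    rw [this]
    exact isOpen_empty

/-- The part of the glued space over `D` which is covered by the sheets in `A`. -/
def star (D : Set Sphere) (A : Set (Bool × Fin d)) : Set (Space b g) :=
  Quotient.mk _ '' {p : Pre d | (p.2 : Sphere) ∈ D ∧ p.1 ∈ A}

/-- The set `A` of sheets is compatible with the gluing over `D`. -/
def IsSaturated (b : Fin r → ℝ) (g : Fin (r + 1) → Perm (Fin d)) (D : Set Sphere)
    (A : Set (Bool × Fin d)) : Prop :=
  ∀ p p' : Pre d, (p.2 : Sphere) ∈ D → glueSetoid b g p p' → (p.1 ∈ A ↔ p'.1 ∈ A)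

lemma IsSaturated.compl {D : Set Sphere} {A : Set (Bool × Fin d)} (h : IsSaturated b g D A) :
    IsSaturated b g D Aᶜ := fun p p' hp hpp => not_congr (h p p' hp hpp)

lemma mk_mem_star {D : Set Sphere} {A : Set (Bool × Fin d)} (h : IsSaturated b g D A) {p : Pre d} :
    Quotient.mk _ p ∈ star (b := b) (g := g) D A ↔ (p.2 : Sphere) ∈ D ∧ p.1 ∈ A := by
  constructor
  · rintro ⟨p', ⟨h1, h2⟩, h3⟩
    have h4 := Quotient.exact h3
    have h5 : (p'.2 : Sphere) = p.2 := h4.1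
    exact ⟨h5 ▸ h1, (h p' p h1 h4).1 h2⟩
  · intro hp
    exact ⟨p, hp, rfl⟩

lemma isOpen_star {D : Set Sphere} (hD : IsOpen D) {A : Set (Bool × Fin d)}
    (h : IsSaturated b g D A) : IsOpen (star (b := b) (g := g) D A) := by
  rw [← isQuotientMap_quotient_mk'.isOpen_preimage]
  convert isOpen_preimage_star hD A using 1
  ext p
  exact mk_mem_star h

lemma preimage_diff_star {D : Set Sphere} {A : Set (Bool × Fin d)} (h : IsSaturated b g D A) :
    proj b g ⁻¹' D \ star D A = star D Aᶜ := by
  ext c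
  induction c using Quotient.inductionOn with
  | h p =>
    rw [Set.mem_sdiff, mk_mem_star h, mk_mem_star h.compl]
    change (p.2 : Sphere) ∈ D ∧ _ ↔ _
    simp only [mem_compl_iff]
    tauto

/-- Points over the real circle: the sheets in a union of cycles of the monodromy. -/
lemma isSaturated_circle {q : Sphere} (P : LocalParam b q) {K : Set (Fin d)}
    (hK : ∀ k, mon b g q k ∈ K ↔ k ∈ K) :
    IsSaturated b g (P.h '' Metric.ball 0 1) {a | num b g q a ∈ K} := by
  rintro ⟨a, z⟩ ⟨a', z'⟩ ⟨w, hw, hwz⟩ ⟨h1, h2⟩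
  obtain ⟨z, hz⟩ := z
  obtain ⟨z', hz'⟩ := z'
  dsimp only at h1 h2 hwz
  subst h1
  rcases h2 with rfl | ⟨h2, h3⟩
  · rfl
  rw [mem_ball_zero_iff] at hw
  have hKinv : ∀ k, (mon b g q)⁻¹ k ∈ K ↔ k ∈ K := fun k => by
    rw [← hK ((mon b g q)⁻¹ k)]; simp
  by_cases hw0 : w = 0
  · subst hw0
    have hzq : z = q := by rw [← hwz, P.zero]
    subst hzq
    obtain ⟨n, -, h4⟩ := h3.exists_pow_eq'
    simp only [mem_ofPred_eq]
    rw [← h4]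
    clear h4
    induction n with
    | zero => simp
    | succ n ih => rw [pow_succ', Equiv.Perm.mul_apply, hK]; exact ih
  -- Away from the centre the disc has no vertex, so the monodromy is trivial and gluing is equality
  -- of numbers across one of the two arcs next to `q`.
  · have hzV : z ∉ vertices b := hwz ▸ P.notMem w hw hw0
    rw [mon_eq_one h2 hzV, Equiv.Perm.sameCycle_one] at h3
    have hR := lidx_eq_ridx b h2 hzV
    have hLR : lidx b z = lidx b q ∨ lidx b z = ridx b q := by
      rw [← hwz]
      exact P.lidx_eq_or hw hw0 ((P.him_eq_zero_iff hw).1 (by rw [hwz]; exact h2))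
    have hq := P.him_eq_zero
    have key : ∀ k l, k = (g (ridx b z))⁻¹ l → ((g (ridx b q))⁻¹ l ∈ K ↔ k ∈ K) := by
      rintro k l rfl
      rw [← hR]
      rcases hLR with h | h <;> rw [h]
      rw [← hKinv ((g (lidx b q))⁻¹ l), mon_eq hq]
      simp
    obtain ⟨ε, k⟩ := a
    obtain ⟨ε', k'⟩ := a'
    simp only [num, mem_ofPred_eq] at h3 ⊢
    cases ε <;> cases ε' <;> simp only [cond_true, cond_false] at h3 ⊢
    · rw [(g (ridx b z))⁻¹.injective h3]
    · exact key _ _ h3.symm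
    · exact (key _ _ h3).symm
    · rw [h3]

lemma isSaturated_openHalf (ε : Bool) (A : Set (Bool × Fin d)) : IsSaturated b g (openHalf ε) A := by
  rintro p p' hp ⟨h1, h2⟩
  rcases h2 with h2 | ⟨h2, -⟩
  · rw [h2]
  · exact absurd h2 (him_ne_zero_of_mem_openHalf hp)

/-- Points over different points of the sphere are separated downstairs. Two points over the same
`q` lie in the stars of complementary saturated sets of sheets, which are open: one sheet against
the rest over a half plane, or one monodromy cycle against the rest over a disc around a point of
the circle. -/
instance : T2Space (Space b g) := by
  refine ⟨fun c c' hne => ?_⟩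
  by_cases hf : proj b g c = proj b g c'
  swap
  · obtain ⟨u, v, hu, hv, h1, h2, h3⟩ := t2_separation hf
    exact ⟨_, _, hu.preimage continuous_proj, hv.preimage continuous_proj, h1, h2,
      h3.preimage _⟩
  suffices ∃ D : Set Sphere, ∃ A : Set (Bool × Fin d), IsOpen D ∧ IsSaturated b g D A ∧
      c ∈ star D A ∧ c' ∈ star D Aᶜ by
    obtain ⟨D, A, hD, hA, h1, h2⟩ := this
    refine ⟨_, _, isOpen_star hD hA, isOpen_star hD hA.compl, h1, h2, ?_⟩
    rw [← preimage_diff_star hA]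
    exact disjoint_sdiff_right
  induction c using Quotient.inductionOn with
  | h p =>
  induction c' using Quotient.inductionOn with
  | h p' =>
  have hpp : (p.2 : Sphere) = p'.2 := hf
  rw [ne_eq, eq_iff, not_and] at hne
  have h1 := hne hpp
  push Not at h1
  obtain ⟨h1, h2⟩ := h1
  by_cases h0 : him p.2 = 0
  · obtain ⟨P⟩ := exists_localParam b h0
    have hK := isSaturated_circle (g := g) P
      (K := {k | (mon b g p.2).SameCycle (num b g p.2 p.1) k})
      (fun k => Equiv.Perm.sameCycle_apply_right)
    have hpD : (p.2 : Sphere) ∈ P.h '' Metric.ball 0 1 := ⟨0, by simp, P.zero⟩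
    refine ⟨_, _, P.emb.isOpenMap _ Metric.isOpen_ball, hK, ?_, ?_⟩
    · rw [mk_mem_star hK]
      exact ⟨hpD, Equiv.Perm.SameCycle.refl _ _⟩
    · rw [mk_mem_star hK.compl]
      exact ⟨hpp ▸ hpD, h2 h0⟩
  · have h3 := (him_eq_zero_or_mem_openHalf p.2.2).resolve_left h0
    have hK := isSaturated_openHalf (b := b) (g := g) p.1.1 {p.1}
    refine ⟨_, _, isOpen_openHalf p.1.1, hK, ?_, ?_⟩
    · rw [mk_mem_star hK]
      exact ⟨h3, rfl⟩
    · rw [mk_mem_star hK.compl]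
      exact ⟨hpp ▸ h3, fun h => h1 (Eq.symm h)⟩

/-- Functions on the glued space can be defined on the disjoint union of the sheets. -/
lemma exists_function {D : Set Sphere} (hD : IsOpen D) {A : Set (Bool × Fin d)}
    (hA : IsSaturated b g D A) (F : Bool × Fin d → Sphere → ℂ)
    (hF : ∀ a ∈ A, ContinuousOn (F a) (D ∩ closedHalf a.1))
    (hFr : ∀ p p' : Pre d, (p.2 : Sphere) ∈ D → p.1 ∈ A → glueSetoid b g p p' →
      F p.1 p.2 = F p'.1 p'.2) :
    ∃ Φ : Space b g → ℂ, ContinuousOn Φ (star D A) ∧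
      ∀ p : Pre d, (p.2 : Sphere) ∈ D → p.1 ∈ A → Φ (Quotient.mk _ p) = F p.1 p.2 := by
  let Φ : Space b g → ℂ := fun c => F c.out.1 c.out.2
  have hΦ : ∀ p : Pre d, (p.2 : Sphere) ∈ D → p.1 ∈ A → Φ (Quotient.mk _ p) = F p.1 p.2 := by
    intro p hp hpA
    exact (hFr p _ hp hpA (Quotient.exact (Quotient.out_eq _).symm)).symm
  refine ⟨Φ, ?_, hΦ⟩
  rw [isQuotientMap_quotient_mk'.continuousOn_isOpen_iff (isOpen_star hD hA)]
  rintro ⟨a, z⟩ hp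
  have hp' := (mk_mem_star hA).1 hp
  refine ContinuousAt.continuousWithinAt ?_
  rw [ContinuousAt, Sigma.nhds_mk, tendsto_map'_iff]
  have h1 : ContinuousAt (fun z : closedHalf a.1 => F a z) z := by
    have h2 := hF a hp'.2 z ⟨hp'.1, z.2⟩
    have h3 : ContinuousWithinAt (F a) (closedHalf a.1) z := by
      refine h2.mono_of_mem_nhdsWithin ?_
      exact inter_mem (nhdsWithin_le_nhds (hD.mem_nhds hp'.1)) self_mem_nhdsWithin
    exact (continuousWithinAt_iff_continuousAt_domRestrict (F a) z.2).1 h3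
  have h4 : Φ (Quotient.mk _ ⟨a, z⟩) = F a z := hΦ _ hp'.1 hp'.2
  have h5 : Tendsto (fun z : closedHalf a.1 => F a z) (𝓝 z) (𝓝 (Φ (Quotient.mk _ ⟨a, z⟩))) := by
    rw [h4]; exact h1
  refine h5.congr' ?_
  filter_upwards [(hD.preimage continuous_subtype_val).mem_nhds hp'.1] with z' hz'
  exact (hΦ ⟨a, z'⟩ hz' hp'.2).symm

/-- Nothing is glued over an open half plane, so a disc in a single sheet serves as chart. -/
lemma ramification_openHalf {p : Pre d} (hp : him p.2 ≠ 0) :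
    HasRamificationIndex (proj b g) (Quotient.mk _ p) 1 := by
  have h3 := (him_eq_zero_or_mem_openHalf p.2.2).resolve_left hp
  obtain ⟨z₀, hz₀, hz₀p⟩ : ∃ z₀ : ℂ, 0 < sg p.1.1 * z₀.im ∧ (z₀ : Sphere) = p.2 := by
    rw [openHalf_eq] at h3; exact h3
  obtain ⟨ρ, hρ, hball⟩ := Metric.isOpen_iff.1
    (isOpen_lt continuous_const (by fun_prop) : IsOpen {z : ℂ | 0 < sg p.1.1 * z.im}) z₀ hz₀
  let h : ℂ → Sphere := fun w => ((ρ * w + z₀ : ℂ) : Sphere)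
  have hh : IsOpenEmbedding h := OnePoint.isOpenEmbedding_coe.comp (isOpenEmbedding_affine hρ z₀)
  set D := h '' Metric.ball 0 1 with hDdef
  have hDH : D ⊆ openHalf p.1.1 := by
    rintro _ ⟨w, hw, rfl⟩
    rw [openHalf_eq]
    refine ⟨_, hball ?_, rfl⟩
    rw [mem_ball_zero_iff] at hw
    rw [Metric.mem_ball, dist_eq_norm, add_sub_cancel_right, norm_mul, Complex.norm_real,
      Real.norm_of_nonneg hρ.le]
    nlinarith
  have hD : IsOpen D := hh.isOpenMap _ Metric.isOpen_ball
  have hA : IsSaturated b g D {p.1} := fun p₁ p₂ h1 h2 => isSaturated_openHalf _ _ p₁ p₂ (hDH h1) h2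
  have : Nonempty ℂ := ⟨0⟩
  let w := hh.toOpenPartialHomeomorph.symm
  have hw : ∀ v, w (h v) = v := fun v => hh.toOpenPartialHomeomorph_left_inv
  obtain ⟨Φ, hΦ, hΦF⟩ := exists_function hD hA (fun _ z => w z) (fun a _ => by
      refine (w.continuousOn_toFun.mono ?_)
      rintro z ⟨⟨v, -, rfl⟩, -⟩
      simp [w])
    (fun p₁ p₂ h1 h2 h3 => by rw [h3.1])
  have hrep : ∀ c ∈ star (b := b) (g := g) D {p.1}, ∃ (v : ℂ) (hv : h v ∈ closedHalf p.1.1),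
      v ∈ Metric.ball 0 1 ∧ c = Quotient.mk _ ⟨p.1, h v, hv⟩ ∧ Φ c = v := by
    rintro _ ⟨⟨a, z⟩, ⟨⟨v, hv, hvz⟩, rfl : a = p.1⟩, rfl⟩
    obtain ⟨z, hz⟩ := z
    dsimp only at hvz
    subst hvz
    refine ⟨v, hz, hv, rfl, ?_⟩
    exact (hΦF ⟨p.1, ⟨h v, hz⟩⟩ ⟨v, hv, rfl⟩ rfl).trans (hw v)
  have h0 : h 0 = p.2 := by simp [h, hz₀p]
  have hpD : (p.2 : Sphere) ∈ D := ⟨0, by simp, h0⟩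
  refine hasRamificationIndex_of_chart continuous_proj hh (isOpen_star hD hA) ?_ hΦ ?_ ?_
    one_pos ?_ ((mk_mem_star hA).2 ⟨hpD, rfl⟩) ?_
  · rw [preimage_diff_star hA]; exact isOpen_star hD hA.compl
  · intro c hc c' hc' hcc
    obtain ⟨v, hv, -, rfl, h1⟩ := hrep c hc
    obtain ⟨v', hv', -, rfl, h2⟩ := hrep c' hc'
    rw [h1, h2] at hcc
    subst hcc
    rfl
  · ext v
    constructor
    · rintro ⟨c, hc, rfl⟩
      obtain ⟨v, hv, hb, rfl, h1⟩ := hrep c hc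
      rwa [h1]
    · intro hv
      have hvD : h v ∈ D := ⟨v, hv, rfl⟩
      refine ⟨Quotient.mk _ ⟨p.1, h v, openHalf_subset _ (hDH hvD)⟩,
        (mk_mem_star hA).2 ⟨hvD, rfl⟩, ?_⟩
      exact (hΦF ⟨p.1, ⟨h v, openHalf_subset _ (hDH hvD)⟩⟩ hvD rfl).trans (hw v)
  · intro c hc
    obtain ⟨v, hv, hb, rfl, h1⟩ := hrep c hc
    rw [h1, pow_one]
    rfl
  · rw [hΦF _ hpD rfl]
    rw [← h0, hw]

/-- The local coordinate near a point over the real circle separates points. -/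
lemma coord_eq_iff {q : Sphere} (P : LocalParam b q) {k₀ : Fin d} {e : ℕ} (he : 0 < e)
    {c : Fin d → ℂ}
    (hc1 : ∀ k, (mon b g q).SameCycle k₀ k → c ((mon b g q)⁻¹ k) = rootUnity e * c k)
    (hc2 : ∀ k l, (mon b g q).SameCycle k₀ k → (mon b g q).SameCycle k₀ l → c k = c l → k = l)
    {v : ℂ} (hv : ‖v‖ < 1) {a a' : Bool × Fin d} (hva : P.h v ∈ closedHalf a.1)
    (hva' : P.h v ∈ closedHalf a'.1) (ha : (mon b g q).SameCycle k₀ (num b g q a))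
    (ha' : (mon b g q).SameCycle k₀ (num b g q a')) :
    c (num b g q a) * halfRoot e a.1 v = c (num b g q a') * halfRoot e a'.1 v ↔
      glueSetoid b g ⟨a, P.h v, hva⟩ ⟨a', P.h v, hva'⟩ := by
  have hq := P.him_eq_zero
  change _ ↔ P.h v = P.h v ∧ (a = a' ∨ him (P.h v) = 0 ∧
    (mon b g (P.h v)).SameCycle (num b g (P.h v) a) (num b g (P.h v) a'))
  by_cases hv0 : v = 0
  · subst hv0
    rw [halfRoot_zero he, halfRoot_zero he, P.zero]
    simp only [mul_zero, true_iff, true_and]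
    exact Or.inr ⟨hq, ha.symm.trans ha'⟩
  have hV := P.notMem v hv hv0
  have hmon : him (P.h v) = 0 → mon b g (P.h v) = 1 := fun h => mon_eq_one h hV
  have mixed : ∀ k k' : Fin d, P.h v ∈ closedHalf true → P.h v ∈ closedHalf false →
      (mon b g q).SameCycle k₀ (num b g q (true, k)) →
      (mon b g q).SameCycle k₀ (num b g q (false, k')) →
      (c (num b g q (true, k)) * halfRoot e true v = c (num b g q (false, k')) * halfRoot e false v ↔
        num b g (P.h v) (true, k) = num b g (P.h v) (false, k')) := by
    intro k k' h1 h2 h3 h4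
    simp only [num, cond_true, cond_false] at h3 h4 ⊢
    have him : v.im = 0 := by
      rw [P.mem_closedHalf hv] at h1 h2
      simp only [sg, cond_true, cond_false] at h1 h2
      linarith
    have hzv : v = ((v.re : ℝ) : ℂ) := Complex.ext (by simp) (by simpa using him)
    have hR := lidx_eq_ridx b ((P.him_eq_zero_iff hv).2 him) hV
    have hre0 : v.re ≠ 0 := fun h => hv0 (by rw [hzv, h]; simp)
    have hroot := halfRoot_ne_zero he false hv0
    rw [hzv, Complex.norm_real, Real.norm_eq_abs] at hv
    rw [← hR]
    -- On the left arc the branches of the root differ by `rootUnity e`, which is compensated by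
    -- passing from `k` to the preimage of `k` under the monodromy. On the right arc both the
    -- branches and the numbers agree.
    rcases lt_or_gt_of_ne hre0 with ht | ht
    · rw [abs_of_neg ht] at hv
      have h5 : lidx b (P.h v) = lidx b q := by
        rw [hzv, ← neg_neg v.re]; exact P.left _ (by linarith) hv
      have h6 : halfRoot e true v = rootUnity e * halfRoot e false v := by
        have := halfRoot_of_neg he (neg_pos.2 ht)
        rwa [neg_neg, ← hzv] at this
      rw [h5, h6, ← mul_assoc, mul_left_inj' hroot, mul_comm, ← hc1 k h3]
      constructor
      · intro h
        have h7 := hc2 _ _ (h3.trans ⟨-1, by simp⟩) h4 h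
        rw [mon_eq hq, mul_inv_rev, inv_inv, Equiv.Perm.mul_apply] at h7
        rw [Equiv.Perm.eq_inv_iff_eq]
        exact (g (ridx b q))⁻¹.injective h7
      · intro h
        rw [mon_eq hq, mul_inv_rev, inv_inv, Equiv.Perm.mul_apply, h]
        simp
    · rw [abs_of_pos ht] at hv
      have h5 : lidx b (P.h v) = ridx b q := by
        rw [hzv]; exact P.right _ ht hv
      have h6 : halfRoot e true v = halfRoot e false v := by
        have := halfRoot_of_pos (e := e) ht
        rwa [← hzv] at this
      rw [h5, h6, mul_left_inj' hroot]
      exact ⟨fun h => hc2 _ _ h3 h4 h, fun h => by rw [← h]⟩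
  have him0 : P.h v ∈ closedHalf true → P.h v ∈ closedHalf false → him (P.h v) = 0 := by
    intro h1 h2
    simp only [closedHalf, sg, mem_ofPred_eq, cond_true, cond_false] at h1 h2
    linarith
  have hinj : ∀ q ε, Function.Injective fun k => num b g q (ε, k) := by
    rintro q (_ | _) k k' h
    · exact (g (ridx b q))⁻¹.injective h
    · exact h
  have same : ∀ ε k k', num b g (P.h v) (ε, k) = num b g (P.h v) (ε, k') ↔ (ε, k) = (ε, k') := by
    intro ε k k'
    exact ⟨fun h => by rw [hinj _ _ h], fun h => by rw [h]⟩
  obtain ⟨ε, k⟩ := a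
  obtain ⟨ε', k'⟩ := a'
  by_cases hεε : ε = ε'
  · subst hεε
    simp only [true_and]
    rw [mul_left_inj' (halfRoot_ne_zero he ε hv0)]
    constructor
    · intro h
      left
      rw [hinj _ _ (hc2 _ _ ha ha' h)]
    · rintro (h | ⟨h, h'⟩)
      · rw [h]
      · rw [hmon h, Equiv.Perm.sameCycle_one, same] at h'
        rw [h']
  · have hne : (ε, k) ≠ (ε', k') := fun h => hεε (congrArg Prod.fst h)
    cases ε <;> cases ε' <;> first | exact absurd rfl hεε | skip
    · have h0 := him0 hva' hva
      simp only [true_and, hne, false_or, h0, hmon h0, Equiv.Perm.sameCycle_one]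
      rw [eq_comm, mixed k' k hva' hva ha' ha, eq_comm]
    · have h0 := him0 hva hva'
      simp only [true_and, hne, false_or, h0, hmon h0, Equiv.Perm.sameCycle_one]
      exact mixed k k' hva hva' ha ha'

/-- The sheets of one monodromy cycle fit together to a disc. On each of them a branch of the `e`-th
root of the parameter is rotated by the root of unity `c` of the sheet, and the gluing makes this a
single injective coordinate whose `e`-th power is the parameter on the sphere. -/
lemma ramification_circle {p : Pre d} (hp : him p.2 = 0) :
    ∃ e, HasRamificationIndex (proj b g) (Quotient.mk _ p) e := by
  obtain ⟨q, hq⟩ : ∃ q : Sphere, q = p.2 := ⟨_, rfl⟩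
  rw [← hq] at hp
  obtain ⟨P⟩ := exists_localParam b hp
  set k₀ := num b g q p.1 with hk₀
  obtain ⟨he, c, hc1, hcpow, hc2, hcsurj⟩ := exists_cycle_to_roots (mon b g q) k₀ rfl
  set e := {k | (mon b g q).SameCycle k₀ k}.ncard
  refine ⟨e, ?_⟩
  have hh := P.emb
  set D := P.h '' Metric.ball 0 1 with hDdef
  have hD : IsOpen D := hh.isOpenMap _ Metric.isOpen_ball
  set A : Set (Bool × Fin d) := {a | num b g q a ∈ {k | (mon b g q).SameCycle k₀ k}} with hAdef
  have hA : IsSaturated b g D A := isSaturated_circle P fun k => Equiv.Perm.sameCycle_apply_right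
  have : Nonempty ℂ := ⟨0⟩
  let w := hh.toOpenPartialHomeomorph.symm
  have hw : ∀ v, w (P.h v) = v := fun v => hh.toOpenPartialHomeomorph_left_inv
  obtain ⟨Φ, hΦ, hΦF⟩ := exists_function (b := b) (g := g) hD hA
    (fun a z => c (num b g q a) * halfRoot e a.1 (w z)) (fun a _ => by
      refine continuousOn_const.mul (ContinuousOn.comp (g := halfRoot e a.1) (f := w)
        (continuousOn_halfRoot he a.1) (w.continuousOn_toFun.mono ?_) ?_)
      · rintro z ⟨⟨v, -, rfl⟩, -⟩
        simp [w]
      · rintro z ⟨⟨v, hv, rfl⟩, hz⟩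
        rw [mem_ofPred_eq, hw]
        exact (P.mem_closedHalf (mem_ball_zero_iff.1 hv)).1 hz) (by
      rintro ⟨a, z, hz⟩ ⟨a', z', hz'⟩ ⟨v, hv, hvz⟩ h2 h3
      have hzz : z = z' := h3.1
      subst hzz
      dsimp only at hvz
      subst hvz
      have h4 := (hA _ _ ⟨v, hv, rfl⟩ h3).1 h2
      dsimp only
      rw [hw]
      exact (coord_eq_iff P he hc1 hc2 (mem_ball_zero_iff.1 hv) hz hz' h2 h4).2 h3)
  have hval : ∀ (a : Bool × Fin d) (v : ℂ) (hv : P.h v ∈ closedHalf a.1), v ∈ Metric.ball (0 : ℂ) 1 →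
      a ∈ A → Φ (Quotient.mk _ ⟨a, P.h v, hv⟩) = c (num b g q a) * halfRoot e a.1 v := by
    intro a v hv hvb ha
    refine (hΦF ⟨a, P.h v, hv⟩ ⟨v, hvb, rfl⟩ ha).trans ?_
    change _ * halfRoot e a.1 (w (P.h v)) = _
    rw [hw]
  have hrep : ∀ x ∈ star (b := b) (g := g) D A, ∃ (a : Bool × Fin d) (v : ℂ)
      (hv : P.h v ∈ closedHalf a.1), a ∈ A ∧ v ∈ Metric.ball 0 1 ∧ x = Quotient.mk _ ⟨a, P.h v, hv⟩ ∧
        Φ x = c (num b g q a) * halfRoot e a.1 v ∧ Φ x ^ e = v := by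
    rintro _ ⟨⟨a, z, hz⟩, ⟨⟨v, hv, hvz⟩, ha⟩, rfl⟩
    dsimp only at hvz
    subst hvz
    refine ⟨a, v, hz, ha, hv, rfl, hval a v hz hv ha, ?_⟩
    rw [hval a v hz hv ha, mul_pow, hcpow _ ha, one_mul, halfRoot_pow he]
  have hpD : (p.2 : Sphere) ∈ D := ⟨0, by simp, by rw [P.zero, hq]⟩
  have hpA : p.1 ∈ A := Equiv.Perm.SameCycle.refl _ _
  refine hasRamificationIndex_of_chart continuous_proj hh (isOpen_star hD hA) ?_ hΦ ?_ ?_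
    he ?_ ((mk_mem_star hA).2 ⟨hpD, hpA⟩) ?_
  · rw [preimage_diff_star hA]; exact isOpen_star hD hA.compl
  · intro x hx x' hx' hxx
    obtain ⟨a, v, hv, ha, hvb, rfl, h1, h2⟩ := hrep x hx
    obtain ⟨a', v', hv', ha', hvb', rfl, h1', h2'⟩ := hrep x' hx'
    have hvv : v = v' := by rw [← h2, ← h2', hxx]
    subst hvv
    rw [h1, h1'] at hxx
    exact Quotient.sound ((coord_eq_iff P he hc1 hc2 (mem_ball_zero_iff.1 hvb) hv hv' ha ha').1 hxx)
  · ext u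
    rw [mem_ball_zero_iff]
    constructor
    · rintro ⟨x, hx, rfl⟩
      obtain ⟨a, v, hv, ha, hvb, rfl, h1, h2⟩ := hrep x hx
      rw [mem_ball_zero_iff, ← h2, norm_pow] at hvb
      by_contra hcon
      exact absurd hvb (not_lt.2 (one_le_pow₀ (not_lt.1 hcon)))
    · intro hu
      have hub : u ^ e ∈ Metric.ball (0 : ℂ) 1 := by
        rw [mem_ball_zero_iff, norm_pow]; exact pow_lt_one₀ (norm_nonneg _) hu he.ne'
      by_cases hu0 : u = 0
      · subst hu0
        refine ⟨Quotient.mk _ p, (mk_mem_star hA).2 ⟨hpD, hpA⟩, ?_⟩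
        obtain ⟨a, v, hv, ha, hvb, hx, h1, h2⟩ := hrep _ ((mk_mem_star hA).2 ⟨hpD, hpA⟩)
        have h3 : (p.2 : Sphere) = P.h v := (Quotient.exact hx).1
        rw [← hq] at h3
        have h4 := P.emb.injective (P.zero.trans h3)
        rw [← h4] at h2
        exact pow_eq_zero_iff he.ne' |>.1 h2
      · obtain ⟨ε, hε⟩ := exists_mem_closedHalf (P.h (u ^ e))
        have hroot := halfRoot_ne_zero he ε (pow_ne_zero e hu0)
        -- The quotient of `u` by the chosen branch at `u ^ e` is an `e`-th root of unity and
        -- selects the sheet containing the point with coordinate `u`.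
        obtain ⟨k, hk, hck⟩ := hcsurj (u / halfRoot e ε (u ^ e)) (by
          rw [div_pow, halfRoot_pow he, div_self (pow_ne_zero e hu0)])
        have hnum : ∃ k', num b g q (ε, k') = k := by
          cases ε
          · exact ⟨g (ridx b q) k, by simp [num]⟩
          · exact ⟨k, rfl⟩
        obtain ⟨k', rfl⟩ := hnum
        have hkA : (ε, k') ∈ A := hk
        refine ⟨Quotient.mk _ ⟨(ε, k'), P.h (u ^ e), hε⟩,
          (mk_mem_star hA).2 ⟨⟨_, hub, rfl⟩, hkA⟩, ?_⟩
        rw [hval _ _ hε hub hkA, hck, div_mul_cancel₀ _ hroot]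
  · intro x hx
    obtain ⟨a, v, hv, ha, hvb, rfl, h1, h2⟩ := hrep x hx
    rw [h2]
    rfl
  · rw [hΦF _ hpD hpA, ← hq, ← P.zero, hw, halfRoot_zero he, mul_zero]

lemma exists_ramification (x : Space b g) : ∃ e, HasRamificationIndex (proj b g) x e := by
  induction x using Quotient.inductionOn with
  | h p =>
    by_cases hp : him p.2 = 0
    · exact ramification_circle hp
    · exact ⟨1, ramification_openHalf hp⟩

lemma mk_eq_of_arc (hb : StrictMono b) (j : Fin (r + 1)) (k : Fin d) :
    ∃ z : Sphere, ∃ (h : z ∈ closedHalf true) (h' : z ∈ closedHalf false),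
      (Quotient.mk (glueSetoid b g) ⟨(true, k), z, h⟩) = Quotient.mk _ ⟨(false, g j k), z, h'⟩ := by
  obtain ⟨z, hz⟩ := arc_nonempty b hb j
  refine ⟨z, mem_closedHalf_of_him_eq_zero hz.1 _, mem_closedHalf_of_him_eq_zero hz.1 _, ?_⟩
  refine eq_iff.2 ⟨rfl, Or.inr ⟨hz.1, ?_⟩⟩
  change (mon b g z).SameCycle (num b g z (true, k)) (num b g z (false, g j k))
  rw [mon_eq_one hz.1 hz.2.1, Equiv.Perm.sameCycle_one]
  simp only [num, cond_true, cond_false]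
  rw [← lidx_eq_ridx b hz.1 hz.2.1, hz.2.2]
  simp

lemma isPreconnected_closedHalf (ε : Bool) : IsPreconnected (closedHalf ε) :=
  (isPreconnected_openHalf ε).subset_closure (openHalf_subset ε) (closedHalf_subset_closure ε)

/-- A clopen set contains each connected sheet wholly or not at all. Gluing along arc `0` identifies
the index sets above and below, gluing along the other arcs makes this index set invariant, and
transitivity leaves only the trivial cases. -/
lemma connectedSpace (h0 : g 0 = 1) (hb : StrictMono b) [Nonempty (Fin d)]
    (htr : ∀ K : Set (Fin d), (∀ j k, g j k ∈ K ↔ k ∈ K) → K = ∅ ∨ K = univ) :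
    ConnectedSpace (Space b g) := by
  have hne : Nonempty (Space b g) := ⟨Quotient.mk _ ⟨(true, Classical.arbitrary _), basePt true,
    openHalf_subset _ (basePt_mem _)⟩⟩
  have : PreconnectedSpace (Space b g) := by
    rw [preconnectedSpace_iff_clopen]
    intro W hW
    have hsheet : ∀ (a : Bool × Fin d) (z z' : closedHalf a.1),
        (Quotient.mk (glueSetoid b g) ⟨a, z⟩ ∈ W ↔ Quotient.mk (glueSetoid b g) ⟨a, z'⟩ ∈ W) := by
      intro a
      have hpre : PreconnectedSpace (closedHalf a.1) :=
        isPreconnected_iff_preconnectedSpace.1 (isPreconnected_closedHalf a.1)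
      have hcont : Continuous fun z : closedHalf a.1 => Quotient.mk (glueSetoid b g) ⟨a, z⟩ :=
        continuous_quotient_mk'.comp continuous_sigmaMk
      intro z z'
      rcases isClopen_iff.1 (hW.preimage hcont) with h | h
      · have h1 : ∀ z, Quotient.mk (glueSetoid b g) ⟨a, z⟩ ∉ W := fun z hz => by
          have : z ∈ (fun z : closedHalf a.1 => Quotient.mk (glueSetoid b g) ⟨a, z⟩) ⁻¹' W := hz
          rw [h] at this; exact this
        exact iff_of_false (h1 _) (h1 _)
      · have h1 : ∀ z, Quotient.mk (glueSetoid b g) ⟨a, z⟩ ∈ W := fun z => by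
          have : z ∈ (fun z : closedHalf a.1 => Quotient.mk (glueSetoid b g) ⟨a, z⟩) ⁻¹' W := by
            rw [h]; trivial
          exact this
        exact iff_of_true (h1 _) (h1 _)
    have hbase : ∀ ε, basePt ε ∈ closedHalf ε := fun ε => openHalf_subset _ (basePt_mem _)
    set K : Bool → Set (Fin d) := fun ε => {k | Quotient.mk (glueSetoid b g)
      ⟨(ε, k), basePt ε, hbase ε⟩ ∈ W} with hK
    have hmem : ∀ (a : Bool × Fin d) (z : closedHalf a.1),
        Quotient.mk (glueSetoid b g) ⟨a, z⟩ ∈ W ↔ a.2 ∈ K a.1 := fun a z => hsheet a z _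
    have h1 : ∀ j k, k ∈ K true ↔ g j k ∈ K false := by
      intro j k
      obtain ⟨z, h, h', heq⟩ := mk_eq_of_arc hb j k
      rw [← hmem (true, k) ⟨z, h⟩, ← hmem (false, g j k) ⟨z, h'⟩, heq]
    have h2 : ∀ k, k ∈ K true ↔ k ∈ K false := fun k => by
      rw [h1 0 k, h0, Equiv.Perm.one_apply]
    rcases htr (K true) (fun j k => by rw [h2, ← h1]) with h | h
    · left
      refine eq_empty_of_forall_notMem fun x => ?_
      induction x using Quotient.inductionOn with
      | h p =>
        obtain ⟨⟨ε, k⟩, z⟩ := p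
        rw [hmem]
        cases ε
        · rw [← h2, h]; exact notMem_empty _
        · rw [h]; exact notMem_empty _
    · right
      refine eq_univ_of_forall fun x => ?_
      induction x using Quotient.inductionOn with
      | h p =>
        obtain ⟨⟨ε, k⟩, z⟩ := p
        rw [hmem]
        cases ε
        · rw [← h2, h]; exact mem_univ _
        · rw [h]; exact mem_univ _
  exact ⟨hne⟩

end Glue

open Glue in
/-- Every transitive system of gluing permutations comes from a branched cover. -/
lemma exists_branchedCover {r d : ℕ} {b : Fin r → ℝ} (hb : StrictMono b) (hd : 0 < d)
    {g : Fin (r + 1) → Perm (Fin d)} (h0 : g 0 = 1)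
    (htr : ∀ K : Set (Fin d), (∀ j k, g j k ∈ K ↔ k ∈ K) → K = ∅ ∨ K = univ) :
    ∃ (X : BranchedCover) (S : Sheets b d X), S.g = g := by
  have : Nonempty (Fin d) := ⟨⟨0, hd⟩⟩
  have hconn : ConnectedSpace (Space b g) := connectedSpace h0 hb htr
  let X : BranchedCover :=
    { C := Space b g
      f := proj b g
      continuous_f := continuous_proj
      locally_power := exists_ramification }
  classical
  let x₀ : X.C := Classical.arbitrary (Space b g)
  let s : Bool → Fin d → Sphere → X.C := fun ε k z =>
    if h : z ∈ closedHalf ε then Quotient.mk (glueSetoid b g) ⟨(ε, k), z, h⟩ else x₀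
  have hs : ∀ ε k z (h : z ∈ closedHalf ε), s ε k z = Quotient.mk (glueSetoid b g) ⟨(ε, k), z, h⟩ :=
    fun ε k z h => dif_pos h
  refine ⟨X, ⟨s, fun ε => ⟨fun k => ?_, fun k z hz => ?_, fun x hx => ?_, fun k l z hz hzV h => ?_⟩,
    g, h0, fun z k h1 h2 => ?_⟩, rfl⟩
  · rw [continuousOn_iff_continuous_domRestrict]
    have h1 : (closedHalf ε).domRestrict (s ε k) =
        fun z => Quotient.mk (glueSetoid b g) ⟨(ε, k), z⟩ := by
      funext z; exact hs ε k z z.2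
    rw [h1]
    exact continuous_quotient_mk'.comp (continuous_sigmaMk (σ := fun a : Bool × Fin d => closedHalf a.1)
      (i := (ε, k)))
  · rw [hs ε k z hz]; rfl
  · obtain ⟨⟨⟨ε', k⟩, z, hz⟩, rfl⟩ := Quotient.exists_rep x
    change z ∈ closedHalf ε at hx
    change ∃ k', s ε k' z = _
    by_cases hε : ε' = ε
    · subst hε
      exact ⟨k, hs _ _ _ _⟩
    · have hz0 : him z = 0 := by
        rcases him_eq_zero_or_mem_openHalf hx with h | h
        · exact h
        · exact absurd (openHalf_disjoint_closedHalf h hz) hε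
      have key : ∃ k', num b g z (ε, k') = num b g z (ε', k) := by
        cases ε <;> cases ε' <;> first | exact absurd rfl hε | skip
        · exact ⟨g (ridx b z) k, by simp [num]⟩
        · exact ⟨(g (ridx b z))⁻¹ k, by simp [num]⟩
      obtain ⟨k', hk'⟩ := key
      refine ⟨k', ?_⟩
      rw [hs _ _ _ hx]
      refine Glue.eq_iff.2 ⟨rfl, Or.inr ⟨hz0, ?_⟩⟩
      change (mon b g z).SameCycle (num b g z (ε, k')) (num b g z (ε', k))
      rw [hk']
  · rw [hs _ _ _ hz, hs _ _ _ hz] at h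
    obtain ⟨-, h1 | ⟨h1, h2⟩⟩ := Glue.eq_iff.1 h
    · exact congrArg Prod.snd h1
    · change (mon b g z).SameCycle (num b g z (ε, k)) (num b g z (ε, l)) at h2
      rw [mon_eq_one h1 hzV, Equiv.Perm.sameCycle_one] at h2
      cases ε
      · exact (g (ridx b z))⁻¹.injective h2
      · exact h2
  · rw [hs _ _ _ (mem_closedHalf_of_him_eq_zero h1 _), hs _ _ _ (mem_closedHalf_of_him_eq_zero h1 _)]
    refine Glue.eq_iff.2 ⟨rfl, Or.inr ⟨h1, ?_⟩⟩
    change (mon b g z).SameCycle (num b g z (true, k)) (num b g z (false, g (lidx b z) k))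
    rw [mon_eq_one h1 h2, Equiv.Perm.sameCycle_one, lidx_eq_ridx b h1 h2]
    simp [num]

end Hurwitz

end

noncomputable section

namespace Hurwitz

open Set Filter Topology

open Equiv (Perm)

/-! ### The genus of a branched cover -/

lemma nonempty_homeomorph_halfPlane (ε : Bool) :
    Nonempty ({z : ℂ | 0 < sg ε * z.im} ≃ₜ (Fin 2 → ℝ)) := by
  have hinv : ∀ v : Fin 2 → ℝ, 0 < sg ε * ((v 0 : ℂ) + (sg ε * Real.exp (v 1) : ℝ) * Complex.I).im := by
    intro v
    have : sg ε * ((v 0 : ℂ) + (sg ε * Real.exp (v 1) : ℝ) * Complex.I).im =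
        (sg ε * sg ε) * Real.exp (v 1) := by
      rw [Complex.add_im, Complex.ofReal_im, zero_add, Complex.im_ofReal_mul, Complex.I_im]
      ring
    rw [this, sg_mul_sg, one_mul]
    exact Real.exp_pos _
  refine ⟨⟨⟨fun z => ![(z : ℂ).re, Real.log (sg ε * (z : ℂ).im)],
    fun v => ⟨(v 0 : ℂ) + (sg ε * Real.exp (v 1) : ℝ) * Complex.I, hinv v⟩, ?_, ?_⟩, ?_, ?_⟩⟩
  · rintro ⟨z, hz⟩
    apply Subtype.ext
    have hz' : 0 < sg ε * z.im := hz
    apply Complex.ext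
    · simp
    · simp only [Matrix.cons_val_zero, Matrix.cons_val_one, Real.exp_log hz', Complex.add_im,
        Complex.ofReal_im, zero_add, Complex.im_ofReal_mul, Complex.I_im, mul_one]
      rw [← mul_assoc, sg_mul_sg, one_mul]
  · intro v
    ext i
    fin_cases i
    · simp
    · simp only [Fin.mk_one, Matrix.cons_val_one, Complex.add_im, Complex.ofReal_im, zero_add,
        Complex.im_ofReal_mul, Complex.I_im, mul_one]
      simp [← mul_assoc, sg_mul_sg]
  · refine continuous_pi fun i => ?_
    fin_cases i
    · simp only [Fin.zero_eta, Matrix.cons_val_zero]; fun_prop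
    · simp only [Fin.mk_one, Matrix.cons_val_one]
      exact Continuous.log (by fun_prop) fun z => ne_of_gt (show 0 < sg ε * (z : ℂ).im from z.2)
  · exact Continuous.subtype_mk (by fun_prop) _

lemma nonempty_homeomorph_Ioo {x y : ℝ} (h : x < y) : Nonempty (Ioo x y ≃ₜ ℝ) := by
  have h1 := (OpenPartialHomeomorph.univBall ((x + y) / 2) ((y - x) / 2)).toHomeomorphSourceTarget
  rw [OpenPartialHomeomorph.univBall_source, OpenPartialHomeomorph.univBall_target _ (by linarith),
    Real.ball_eq_Ioo, show (x + y) / 2 - (y - x) / 2 = x by ring,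
    show (x + y) / 2 + (y - x) / 2 = y by ring] at h1
  exact ⟨h1.symm.trans (Homeomorph.Set.univ ℝ)⟩

lemma nonempty_homeomorph_Ioi (x : ℝ) : Nonempty (Ioi x ≃ₜ ℝ) := by
  refine ⟨⟨⟨fun y => Real.log (y - x), fun y => ⟨Real.exp y + x, ?_⟩, ?_, ?_⟩, ?_, ?_⟩⟩
  · simpa using Real.exp_pos y
  · rintro ⟨y, hy⟩
    apply Subtype.ext
    simp [Real.exp_log (sub_pos.2 hy)]
  · intro y; simp
  · exact Continuous.log (by fun_prop) fun y => (sub_pos.2 y.2).ne'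
  · exact Continuous.subtype_mk (by fun_prop) _

lemma nonempty_homeomorph_Iio (x : ℝ) : Nonempty (Iio x ≃ₜ ℝ) := by
  refine ⟨⟨⟨fun y => Real.log (x - y), fun y => ⟨x - Real.exp y, ?_⟩, ?_, ?_⟩, ?_, ?_⟩⟩
  · simpa using Real.exp_pos y
  · rintro ⟨y, hy⟩
    apply Subtype.ext
    simp [Real.exp_log (sub_pos.2 hy)]
  · intro y; simp
  · exact Continuous.log (by fun_prop) fun y => (sub_pos.2 y.2).ne'
  · exact Continuous.subtype_mk (by fun_prop) _

/-- Of the ten kinds of preconnected subsets of the line, those with an end point are not open, and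
the remaining nonempty ones have explicit homeomorphisms to the line. -/
lemma nonempty_homeomorph_of_isOpen {T : Set ℝ} (ho : IsOpen T) (hc : IsPreconnected T)
    (hne : T.Nonempty) : Nonempty (T ≃ₜ ℝ) := by
  have hint := ho.interior_eq
  have h := hc.mem_intervals
  simp only [mem_insert_iff, mem_singleton_iff] at h
  have hIcc : ∀ x y : ℝ, T = Icc x y → False := by
    rintro x y rfl
    rw [interior_Icc] at hint
    have h1 : x ≤ y := nonempty_Icc.1 hne
    have h2 := hint.ge (left_mem_Icc.2 h1)
    exact lt_irrefl _ h2.1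
  have hIco : ∀ x y : ℝ, T = Ico x y → False := by
    rintro x y rfl
    rw [interior_Ico] at hint
    have h1 : x < y := nonempty_Ico.1 hne
    have h2 := hint.ge (left_mem_Ico.2 h1)
    exact lt_irrefl _ h2.1
  have hIoc : ∀ x y : ℝ, T = Ioc x y → False := by
    rintro x y rfl
    rw [interior_Ioc] at hint
    have h1 : x < y := nonempty_Ioc.1 hne
    have h2 := hint.ge (right_mem_Ioc.2 h1)
    exact lt_irrefl _ h2.2
  have hIci : ∀ x : ℝ, T = Ici x → False := by
    rintro x rfl
    rw [interior_Ici] at hint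
    have h2 : x < x := hint.ge self_mem_Ici
    exact lt_irrefl _ h2
  have hIic : ∀ x : ℝ, T = Iic x → False := by
    rintro x rfl
    rw [interior_Iic] at hint
    have h2 : x < x := hint.ge self_mem_Iic
    exact lt_irrefl _ h2
  rcases h with h | h | h | h | h | h | h | h | h | h
  · exact (hIcc _ _ h).elim
  · exact (hIco _ _ h).elim
  · exact (hIoc _ _ h).elim
  · rw [h] at hne ⊢
    exact nonempty_homeomorph_Ioo (nonempty_Ioo.1 hne)
  · exact (hIci _ h).elim
  · rw [h]; exact nonempty_homeomorph_Ioi _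
  · exact (hIic _ h).elim
  · rw [h]; exact nonempty_homeomorph_Iio _
  · rw [h]; exact ⟨Homeomorph.Set.univ ℝ⟩
  · rw [h] at hne; exact absurd hne not_nonempty_empty

section

variable {r : ℕ} (b : Fin r → ℝ)

lemma isOpen_arcReal (j : Fin (r + 1)) : IsOpen (arcReal b j) := by
  rw [Metric.isOpen_iff]
  rintro x ⟨hx, hxj⟩
  obtain ⟨ρ, hρ, h⟩ := exists_gap b x
  have h1 : ∀ i, ρ ≤ |b i - x| := fun i => not_lt.1 fun h' => hx i (h i h')
  refine ⟨ρ, hρ, fun y hy => ⟨fun i hi => ?_, ?_⟩⟩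
  · have := h1 i
    rw [hi, ← Real.dist_eq] at this
    exact absurd hy (not_lt.2 this)
  · rw [← hxj]
    unfold cutLT
    congr 2
    ext i
    simp only [Finset.mem_filter, Finset.mem_univ, true_and]
    have h2 := h1 i
    rw [Metric.mem_ball, Real.dist_eq, abs_lt] at hy
    rcases le_abs'.1 h2 with h3 | h3 <;> constructor <;> intro <;> linarith

lemma nonempty_homeomorph_arc (hb : StrictMono b) (j : Fin (r + 1)) :
    Nonempty (arc b j ≃ₜ (Fin 1 → ℝ)) := by
  obtain ⟨h⟩ := nonempty_homeomorph_of_isOpen (isOpen_arcReal b j)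
    (ordConnected_arcReal b j).isPreconnected (arcReal_nonempty b hb j)
  have hemb : IsEmbedding fun x : ℝ => ((x : ℂ) : Sphere) :=
    OnePoint.isOpenEmbedding_coe.isEmbedding.comp Complex.isometry_ofReal.isEmbedding
  rw [arc_eq]
  exact ⟨(hemb.homeomorphImage (arcReal b j)).symm.trans (h.trans (Homeomorph.funUnique (Fin 1) ℝ).symm)⟩

lemma nonempty_homeomorph_openHalf (ε : Bool) : Nonempty (openHalf ε ≃ₜ (Fin 2 → ℝ)) := by
  obtain ⟨h⟩ := nonempty_homeomorph_halfPlane ε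
  rw [openHalf_eq]
  exact ⟨(OnePoint.isOpenEmbedding_coe.isEmbedding.homeomorphImage _).symm.trans h⟩

lemma isClosed_circle : IsClosed {q : Sphere | him q = 0} := by
  have : {q : Sphere | him q = 0} = closedHalf true ∩ closedHalf false := by
    ext q
    simp only [closedHalf, sg, mem_ofPred_eq, mem_inter_iff, cond_true, cond_false]
    constructor
    · intro h; rw [h]; simp
    · rintro ⟨h1, h2⟩; linarith
  rw [this]
  exact (isClosed_closedHalf _).inter (isClosed_closedHalf _)

/-- Near a point of the circle that is not a vertex the index of the arc is constant, so a limit of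
arc `j` is a vertex or lies on arc `j`. -/
lemma closure_arc_subset (j : Fin (r + 1)) : closure (arc b j) ⊆ vertices b ∪ arc b j := by
  intro q hq
  have h0 : him q = 0 := (isClosed_circle.closure_subset_iff.2 fun z hz => hz.1) hq
  by_cases hV : q ∈ vertices b
  · exact Or.inl hV
  · right
    refine ⟨h0, hV, ?_⟩
    obtain ⟨P⟩ := exists_localParam b h0
    obtain ⟨z, hz, w, hw, rfl⟩ := (mem_closure_iff_nhds_basis P.nhds_hasBasis).1 hq (1 / 2)
      ⟨by norm_num, by norm_num⟩
    have hw1 : ‖w‖ < 1 := by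
      have := mem_ball_zero_iff.1 hw
      linarith
    by_cases hw0 : w = 0
    · rw [hw0, P.zero] at hz; exact hz.2.2
    · rw [← hz.2.2]
      rcases P.lidx_eq_or hw1 hw0 ((P.him_eq_zero_iff hw1).1 hz.1) with h | h
      · exact h.symm
      · rw [h, lidx_eq_ridx b h0 hV]

end

namespace Sheets

variable {X : BranchedCover} {r : ℕ} {b : Fin r → ℝ} {d : ℕ} (S : Sheets b d X)

lemma mem_image_iff {ε : Bool} {k : Fin d} {T : Set Sphere} (hT : T ⊆ closedHalf ε) {x : X.C} :
    x ∈ S.s ε k '' T ↔ X.f x ∈ T ∧ S.s ε k (X.f x) = x := by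
  constructor
  · rintro ⟨z, hz, rfl⟩
    rw [S.f_s k (hT hz)]
    exact ⟨hz, rfl⟩
  · rintro ⟨h1, h2⟩
    exact ⟨_, h1, h2⟩

/-- A sheet is homeomorphic to its image in the sphere. -/
def imageHomeomorph {ε : Bool} (k : Fin d) {T : Set Sphere} (hT : T ⊆ closedHalf ε) :
    S.s ε k '' T ≃ₜ T where
  toFun x := ⟨X.f x, ((S.mem_image_iff hT).1 x.2).1⟩
  invFun z := ⟨S.s ε k z, mem_image_of_mem _ z.2⟩
  left_inv x := Subtype.ext ((S.mem_image_iff hT).1 x.2).2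
  right_inv z := Subtype.ext (S.f_s k (hT z.2))
  continuous_toFun := (X.continuous_f.comp continuous_subtype_val).subtype_mk _
  continuous_invFun := Continuous.subtype_mk
    (continuousOn_iff_continuous_domRestrict.1 ((S.cont ε k).mono hT)) _

lemma arc_subset (j : Fin (r + 1)) (ε : Bool) : arc b j ⊆ closedHalf ε :=
  fun _ hz => mem_closedHalf_of_him_eq_zero hz.1 ε

/-- The indices of the cells of dimension `k`. -/
def CellIdx (_ : Sheets b d X) : Fin 3 → Type
  | 0 => X.f ⁻¹' vertices b
  | 1 => Fin (r + 1) × Fin d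
  | 2 => Bool × Fin d

/-- The cells of the decomposition of a branched cover by the preimages of the real circle and the
vertices. -/
def cell : (k : Fin 3) → S.CellIdx k → Set X.C
  | 0 => fun x => {x.1}
  | 1 => fun a => S.s true a.2 '' arc b a.1
  | 2 => fun a => S.s a.1 a.2 '' openHalf a.1

lemma finite_vertexFiber : (X.f ⁻¹' vertices b).Finite := by
  have : X.f ⁻¹' vertices b = ⋃ q ∈ vertices b, X.f ⁻¹' {q} := by ext; simp
  rw [this]
  exact (finite_vertices b).biUnion fun q _ => X.finite_fiber q

instance (k : Fin 3) : Finite (S.CellIdx k) :=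
  match k with
  | 0 => (finite_vertexFiber (X := X) (b := b)).to_subtype
  | 1 => inferInstanceAs (Finite (Fin (r + 1) × Fin d))
  | 2 => inferInstanceAs (Finite (Bool × Fin d))

lemma cell_homeomorph (hb : StrictMono b) : ∀ k (i : S.CellIdx k),
    Nonempty (S.cell k i ≃ₜ (Fin (k : ℕ) → ℝ))
  | 0, i => by
    have : Unique (S.cell 0 i) := inferInstanceAs (Unique ({i.1} : Set X.C))
    have : Unique (Fin ((0 : Fin 3) : ℕ) → ℝ) := inferInstanceAs (Unique (Fin 0 → ℝ))
    exact ⟨Homeomorph.homeomorphOfUnique _ _⟩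
  | 1, i => by
    obtain ⟨h⟩ := nonempty_homeomorph_arc b hb i.1
    exact ⟨(S.imageHomeomorph i.2 (arc_subset i.1 true)).trans h⟩
  | 2, i => by
    obtain ⟨h⟩ := nonempty_homeomorph_openHalf i.1
    exact ⟨(S.imageHomeomorph i.2 (openHalf_subset i.1)).trans h⟩

lemma mem_cell_one {a : Fin (r + 1) × Fin d} {x : X.C} :
    x ∈ S.cell 1 a ↔ X.f x ∈ arc b a.1 ∧ S.s true a.2 (X.f x) = x :=
  S.mem_image_iff (arc_subset a.1 true)

lemma mem_cell_two {a : Bool × Fin d} {x : X.C} :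
    x ∈ S.cell 2 a ↔ X.f x ∈ openHalf a.1 ∧ S.s a.1 a.2 (X.f x) = x :=
  S.mem_image_iff (openHalf_subset a.1)

lemma existsUnique_cell (x : X.C) : ∃! a : Σ k, S.CellIdx k, x ∈ S.cell a.1 a.2 := by
  have h0 : ∀ a : S.CellIdx 0, x ∈ S.cell 0 a → X.f x ∈ vertices b ∧ a.1 = x := by
    intro a ha
    have h1 : x = a.1 := ha
    exact ⟨h1 ▸ a.2, h1.symm⟩
  by_cases hV : X.f x ∈ vertices b
  · refine ⟨⟨0, ⟨x, hV⟩⟩, rfl, ?_⟩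
    rintro ⟨k, a⟩ ha
    fin_cases k
    · obtain rfl : a = ⟨x, hV⟩ := Subtype.ext (h0 a ha).2
      rfl
    · exact absurd hV (S.mem_cell_one.1 ha).1.2.1
    · exact absurd hV (notMem_vertices_of_mem_openHalf b (S.mem_cell_two.1 ha).1)
  by_cases hC : him (X.f x) = 0
  · have hx := mem_closedHalf_of_him_eq_zero hC true
    obtain ⟨k, hk⟩ := S.surj hx
    refine ⟨⟨1, (lidx b (X.f x), k)⟩, S.mem_cell_one.2 ⟨⟨hC, hV, rfl⟩, hk⟩, ?_⟩
    rintro ⟨k', a⟩ ha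
    fin_cases k'
    · exact absurd (h0 a ha).1 hV
    · obtain ⟨h1, h2⟩ := S.mem_cell_one.1 ha
      obtain rfl : a = (lidx b (X.f x), k) :=
        Prod.ext h1.2.2.symm (S.inj hx hV (h2.trans hk.symm))
      rfl
    · exact absurd hC (him_ne_zero_of_mem_openHalf (S.mem_cell_two.1 ha).1)
  · obtain ⟨ε, hε⟩ := exists_mem_closedHalf (X.f x)
    have hε' := (him_eq_zero_or_mem_openHalf hε).resolve_left hC
    obtain ⟨k, hk⟩ := S.surj hε
    refine ⟨⟨2, (ε, k)⟩, S.mem_cell_two.2 ⟨hε', hk⟩, ?_⟩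
    rintro ⟨k', a⟩ ha
    fin_cases k'
    · exact absurd (h0 a ha).1 hV
    · exact absurd (S.mem_cell_one.1 ha).1.1 hC
    · obtain ⟨h1, h2⟩ := S.mem_cell_two.1 ha
      obtain ⟨ε', k'⟩ := a
      obtain rfl : ε' = ε := (openHalf_disjoint_closedHalf h1 hε).symm
      obtain rfl : k' = k := S.inj hε hV (h2.trans hk.symm)
      rfl

/-- A cell together with its boundary lies in one closed sheet, where a point is determined by its
image. New boundary points therefore lie over vertices or, for the two-dimensional cells, over arcs.
-/
lemma closure_cell (k : Fin 3) (i : S.CellIdx k) :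
    closure (S.cell k i) \ S.cell k i ⊆ ⋃ (j : Fin 3) (_ : j < k) (i' : S.CellIdx j), S.cell j i' := by
  have mem0 : ∀ x, X.f x ∈ vertices b → ∀ k : Fin 3, 0 < k →
      x ∈ ⋃ (j : Fin 3) (_ : j < k) (i' : S.CellIdx j), S.cell j i' := by
    intro x hx k hk
    exact mem_iUnion₂.2 ⟨0, hk, mem_iUnion.2 ⟨⟨x, hx⟩, rfl⟩⟩
  fin_cases k
  · have : closure (S.cell 0 i) = S.cell 0 i := closure_singleton
    intro x hx
    exact absurd (this ▸ hx.1) hx.2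
  · rintro x ⟨hx, hx'⟩
    have h1 : S.cell 1 i ⊆ S.s true i.2 '' closedHalf true := image_mono (arc_subset i.1 true)
    have h2 := (S.isClosed_image true i.2 (isClosed_closedHalf true) le_rfl).closure_subset_iff.2 h1 hx
    have h3 : X.f x ∈ closure (arc b i.1) := by
      have h4 : MapsTo X.f (S.cell 1 i) (arc b i.1) := fun y hy => (S.mem_cell_one.1 hy).1
      exact h4.closure X.continuous_f hx
    rcases closure_arc_subset b i.1 h3 with h4 | h4
    · exact mem0 x h4 _ (by decide)
    · exact absurd (S.mem_cell_one.2 ⟨h4, ((S.mem_image_iff le_rfl).1 h2).2⟩) hx'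
  · rintro x ⟨hx, hx'⟩
    have h1 : S.cell 2 i ⊆ S.s i.1 i.2 '' closedHalf i.1 := image_mono (openHalf_subset i.1)
    have h2 := (S.isClosed_image i.1 i.2 (isClosed_closedHalf i.1) le_rfl).closure_subset_iff.2 h1 hx
    obtain ⟨h3, h4⟩ := (S.mem_image_iff le_rfl).1 h2
    rcases him_eq_zero_or_mem_openHalf h3 with h5 | h5
    · by_cases hV : X.f x ∈ vertices b
      · exact mem0 x hV _ (by decide)
      · obtain ⟨k, hk⟩ := S.surj (mem_closedHalf_of_him_eq_zero h5 true)
        refine mem_iUnion₂.2 ⟨1, by decide, mem_iUnion.2 ⟨(lidx b (X.f x), k), ?_⟩⟩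
        exact S.mem_cell_one.2 ⟨⟨h5, hV, rfl⟩, hk⟩
    · exact absurd (S.mem_cell_two.2 ⟨h5, h4⟩) hx'

include S in
/-- The genus of a branched cover, by the Riemann–Hurwitz formula. -/
lemma hasGenus (hb : StrictMono b) {γ : ℕ}
    (h : (Nat.card (X.f ⁻¹' vertices b) : ℤ) - (r + 1) * d + 2 * d = 2 - 2 * γ) :
    HasGenus X.C γ := by
  let e := fun k => Finite.equivFin (S.CellIdx k)
  refine ⟨fun k => Nat.card (S.CellIdx k), fun k i => S.cell k ((e k).symm i), fun k i =>
    S.cell_homeomorph hb k _, fun x => ?_, fun k i => ?_, ?_⟩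
  · obtain ⟨⟨k, a⟩, ha, huniq⟩ := S.existsUnique_cell x
    refine ⟨⟨k, e k a⟩, by simpa using ha, ?_⟩
    rintro ⟨k', a'⟩ ha'
    have := huniq ⟨k', (e k').symm a'⟩ ha'
    obtain ⟨rfl, h2⟩ := Sigma.mk.inj_iff.1 this
    rw [heq_iff_eq, Equiv.symm_apply_eq] at h2
    rw [h2]
  · refine (S.closure_cell k _).trans ?_
    intro x hx
    obtain ⟨j, hj, hx⟩ := mem_iUnion₂.1 hx
    obtain ⟨i', hx⟩ := mem_iUnion.1 hx
    exact mem_iUnion₂.2 ⟨j, hj, mem_iUnion.2 ⟨e j i', by simpa using hx⟩⟩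
  · have h1 : Nat.card (S.CellIdx 1) = (r + 1) * d := by
      change Nat.card (Fin (r + 1) × Fin d) = _
      simp
    have h2 : Nat.card (S.CellIdx 2) = 2 * d := by
      change Nat.card (Bool × Fin d) = _
      simp
    beta_reduce
    rw [h1, h2]
    push_cast
    exact h

end Sheets

end Hurwitz

end

noncomputable section

namespace Hurwitz

open Set Filter Topology

open Equiv (Perm)

/-! ### Covers with real branch points and their monodromy -/

lemma sameCycle_swap_iff {α : Type} [DecidableEq α] {k l i j : α} :
    (Equiv.swap k l).SameCycle i j ↔ i = j ∨ Equiv.swap k l i = j := by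
  constructor
  · rintro ⟨n, rfl⟩
    rcases Int.even_or_odd' n with ⟨c, rfl | rfl⟩
    · left; rw [zpow_mul, zpow_ofNat, sq, Equiv.swap_mul_self, one_zpow]; rfl
    · right; rw [zpow_add_one, zpow_mul, zpow_ofNat, sq, Equiv.swap_mul_self, one_zpow, one_mul]
  · rintro (rfl | rfl)
    · exact Perm.SameCycle.refl _ _
    · exact ⟨1, by simp⟩

namespace Sheets

variable {X Y : BranchedCover} {r : ℕ} {b : Fin r → ℝ} {d : ℕ} (S : Sheets b d X)

lemma inftyMem (ε : Bool) : (OnePoint.infty : Sphere) ∈ closedHalf ε :=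
  mem_closedHalf_of_him_eq_zero him_infty ε

/-- To the right of `∞` lies arc `0` with trivial gluing and to its left the last arc, so the
monodromy at `∞` is the inverse of the last gluing permutation. -/
lemma s_infty_eq_iff {k l : Fin d} : S.s true k OnePoint.infty = S.s true l OnePoint.infty ↔
    (S.g (Fin.last r)).SameCycle k l := by
  rw [S.s_eq_iff_sameCycle him_infty, monodromy, lidx_infty, ridx_infty, S.g_zero, mul_one,
    Perm.sameCycle_inv]

lemma s_branch_eq_iff (hb : StrictMono b) {i : Fin r} {k l : Fin d} :
    S.s true k ((b i : ℂ) : Sphere) = S.s true l ((b i : ℂ) : Sphere) ↔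
    ((S.g i.castSucc)⁻¹ * S.g i.succ).SameCycle k l := by
  rw [S.s_eq_iff_sameCycle (by simp), monodromy, lidx_branch b hb, ridx_branch b hb]

/-- The sheets of an isomorphic cover. -/
def map (φ : X.C ≃ₜ Y.C) (hφ : ∀ x, Y.f (φ x) = X.f x) : Sheets b d Y where
  s ε k z := φ (S.s ε k z)
  half ε :=
    { cont := fun k => φ.continuous.comp_continuousOn (S.cont ε k)
      f_s := fun k z hz => by rw [hφ, S.f_s k hz]
      surj := fun y hy => by
        have h1 : X.f (φ.symm y) = Y.f y := by rw [← hφ, φ.apply_symm_apply]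
        obtain ⟨k, hk⟩ := S.surj (x := φ.symm y) (h1 ▸ hy)
        exact ⟨k, by rw [← h1, hk, φ.apply_symm_apply]⟩
      inj := fun k l z hz hz' h => S.inj hz hz' (φ.injective h) }
  g := S.g
  g_zero := S.g_zero
  glue z k h1 h2 := congrArg φ (S.glue z k h1 h2)

lemma eqOn_false (S' : Sheets b d X) (hb : StrictMono b) (hg : S.g = S'.g)
    (h : ∀ k, S.s true k (basePt true) = S'.s true k (basePt true)) (k : Fin d) :
    EqOn (S.s false k) (S'.s false k) (closedHalf false) := by
  obtain ⟨z, hz0, hzV, -⟩ := arc_nonempty b hb 0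
  have hz := mem_closedHalf_of_him_eq_zero hz0
  have h1 : S.s false k z = S'.s false k z := by
    rw [S.s_false_eq hz0, S'.s_false_eq hz0, hg, S.eqOn_of_eq_basePt S' (h _) (hz _)]
  have hbase : X.f (S.s false k (basePt false)) = basePt false :=
    S.f_s k (openHalf_subset _ (basePt_mem _))
  obtain ⟨l, hl⟩ := S'.surj (ε := false) (x := S.s false k (basePt false))
    (by rw [hbase]; exact openHalf_subset _ (basePt_mem _))
  rw [hbase] at hl
  have h2 := S.eqOn_of_eq_basePt S' hl.symm
  obtain rfl : k = l := S'.inj (hz _) hzV (h1.symm.trans (h2 (hz _)))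
  exact h2

/-- The images of the sheets under `φ` and `χ` are two labellings of `Y` with the same gluing and
the same base points, hence equal. It follows that isomorphisms act freely on numberings. -/
lemma eq_of_eq_basePt (hb : StrictMono b) {φ χ : X.C ≃ₜ Y.C} (hφ : ∀ x, Y.f (φ x) = X.f x)
    (hχ : ∀ x, Y.f (χ x) = X.f x)
    (h : ∀ k, φ (S.s true k (basePt true)) = χ (S.s true k (basePt true))) : φ = χ := by
  ext x
  obtain ⟨ε, hε⟩ := exists_mem_closedHalf (X.f x)
  obtain ⟨k, hk⟩ := S.surj hε
  rw [← hk]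
  cases ε
  · exact (S.map φ hφ).eqOn_false (S.map χ hχ) hb rfl h k hε
  · exact (S.map φ hφ).eqOn_of_eq_basePt (S.map χ hχ) (h k) hε

/-- The numbering of the sheets by the points over the base point. -/
def basePtEquiv : Fin d ≃ X.f ⁻¹' {basePt true} :=
  Equiv.ofBijective (fun k => ⟨S.s true k (basePt true), S.f_s k (openHalf_subset _ (basePt_mem _))⟩)
    ⟨fun _ _ h => S.inj (openHalf_subset _ (basePt_mem _))
        (notMem_vertices_of_mem_openHalf b (basePt_mem _)) (congrArg Subtype.val h), by
      rintro ⟨x, hx⟩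
      have hx' : X.f x = basePt true := hx
      obtain ⟨k, hk⟩ := S.surj (ε := true) (x := x) (hx' ▸ openHalf_subset _ (basePt_mem _))
      exact ⟨k, Subtype.ext ((congrArg (S.s true k) hx').symm.trans hk)⟩⟩

/-- Points over `b i` correspond to cycles of the monodromy with the ramification index as length:
one point gives a cycle of length two, and all others give fixed points. -/
lemma isSwap_of_simple (hb : StrictMono b) {i : Fin r} {x : X.C} (hx : X.f x = ((b i : ℂ) : Sphere))
    (h2 : HasRamificationIndex X.f x 2)
    (h1 : ∀ y, X.f y = ((b i : ℂ) : Sphere) → y ≠ x → HasRamificationIndex X.f y 1) :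
    ((S.g i.castSucc)⁻¹ * S.g i.succ).IsSwap := by
  set P := (S.g i.castSucc)⁻¹ * S.g i.succ
  have hmem : ((b i : ℂ) : Sphere) ∈ closedHalf true := mem_closedHalf_of_him_eq_zero (by simp) _
  rw [S.hasRamificationIndex_iff (ε := true) (hx ▸ hmem), hx, Set.ncard_eq_two] at h2
  obtain ⟨k, l, hkl, h2⟩ := h2
  have hP : ∀ j, S.s true (P j) ((b i : ℂ) : Sphere) = S.s true j ((b i : ℂ) : Sphere) := fun j =>
    (S.s_branch_eq_iff hb).2 ⟨-1, by rw [zpow_neg_one, Perm.inv_eq_iff_eq]⟩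
  have hmem2 : ∀ j, S.s true j ((b i : ℂ) : Sphere) = x ↔ j = k ∨ j = l := fun j => by
    simpa using Set.ext_iff.1 h2 j
  have hk := (hmem2 k).2 (Or.inl rfl)
  have hl := (hmem2 l).2 (Or.inr rfl)
  have hsc : P.SameCycle k l := (S.s_branch_eq_iff hb).1 (hk.trans hl.symm)
  have hPk : P k = l := by
    refine ((hmem2 _).1 ((hP k).trans hk)).resolve_left fun h => hkl ?_
    exact hsc.eq_of_left h
  have hPl : P l = k := by
    refine ((hmem2 _).1 ((hP l).trans hl)).resolve_right fun h => hkl ?_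
    exact (hsc.symm.eq_of_left h).symm
  refine ⟨k, l, hkl, Equiv.ext fun j => ?_⟩
  by_cases hjk : j = k
  · rw [hjk, hPk, Equiv.swap_apply_left]
  by_cases hjl : j = l
  · rw [hjl, hPl, Equiv.swap_apply_right]
  rw [Equiv.swap_apply_of_ne_of_ne hjk hjl]
  have hj : S.s true j ((b i : ℂ) : Sphere) ≠ x := fun h => by
    rcases (hmem2 j).1 h with h | h <;> contradiction
  have hf := S.f_s j hmem
  have := h1 _ hf hj
  rw [S.hasRamificationIndex_iff (ε := true) (by rw [hf]; exact hmem), hf, Set.ncard_eq_one] at this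
  obtain ⟨m, hm⟩ := this
  have e1 : j ∈ ({m} : Set (Fin d)) := hm ▸ rfl
  have e2 : P j ∈ ({m} : Set (Fin d)) := hm ▸ hP j
  rw [mem_singleton_iff] at e1 e2
  rw [e2, e1]

lemma simple_of_isSwap (hb : StrictMono b) {i : Fin r}
    (h : ((S.g i.castSucc)⁻¹ * S.g i.succ).IsSwap) :
    ∃ x, X.f x = ((b i : ℂ) : Sphere) ∧ HasRamificationIndex X.f x 2 ∧
      ∀ y, X.f y = ((b i : ℂ) : Sphere) → y ≠ x → HasRamificationIndex X.f y 1 := by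
  have hmem : ((b i : ℂ) : Sphere) ∈ closedHalf true := mem_closedHalf_of_him_eq_zero (by simp) _
  obtain ⟨k, l, hkl, hP⟩ := h
  have key : ∀ j j', S.s true j ((b i : ℂ) : Sphere) = S.s true j' ((b i : ℂ) : Sphere) ↔
      j = j' ∨ Equiv.swap k l j = j' := fun j j' => by
    rw [S.s_branch_eq_iff hb, hP, sameCycle_swap_iff]
  refine ⟨S.s true k ((b i : ℂ) : Sphere), S.f_s k hmem, ?_, fun y hy hyk => ?_⟩
  · rw [S.hasRamificationIndex_iff (ε := true) (by rw [S.f_s k hmem]; exact hmem), S.f_s k hmem,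
      Set.ncard_eq_two]
    refine ⟨k, l, hkl, Set.ext fun j => ?_⟩
    rw [mem_ofPred_eq, eq_comm, key, Equiv.swap_apply_left]
    simp [eq_comm]
  · obtain ⟨j, hj⟩ := S.surj (ε := true) (x := y) (hy ▸ hmem)
    rw [S.hasRamificationIndex_iff (ε := true) (by rw [hy]; exact hmem), Set.ncard_eq_one]
    refine ⟨j, Set.ext fun j' => ?_⟩
    rw [hy] at hj ⊢
    rw [mem_ofPred_eq, ← hj, eq_comm, key, mem_singleton_iff]
    rw [← hj, ne_eq, eq_comm, key, Equiv.swap_apply_left] at hyk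
    push Not at hyk
    rw [Equiv.swap_apply_of_ne_of_ne hyk.1.symm hyk.2.symm]
    simp [eq_comm]

/-- Only the sheets `k` and `l` come together over `b i`, so leaving out `l` keeps exactly one sheet
for each point. -/
lemma card_fiber_branch (hb : StrictMono b) {i : Fin r}
    (h : ((S.g i.castSucc)⁻¹ * S.g i.succ).IsSwap) :
    Nat.card (X.f ⁻¹' {((b i : ℂ) : Sphere)}) = d - 1 := by
  have hmem : ((b i : ℂ) : Sphere) ∈ closedHalf true := mem_closedHalf_of_him_eq_zero (by simp) _
  obtain ⟨k, l, hkl, hP⟩ := h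
  have key : ∀ j j', S.s true j ((b i : ℂ) : Sphere) = S.s true j' ((b i : ℂ) : Sphere) ↔
      j = j' ∨ Equiv.swap k l j = j' := fun j j' => by
    rw [S.s_branch_eq_iff hb, hP, sameCycle_swap_iff]
  have h1 : Function.Bijective (fun j : {j : Fin d // j ≠ l} =>
      (⟨S.s true j ((b i : ℂ) : Sphere), S.f_s _ hmem⟩ : X.f ⁻¹' {((b i : ℂ) : Sphere)})) := by
    constructor
    · rintro ⟨j, hj⟩ ⟨j', hj'⟩ h
      apply Subtype.ext
      rcases (key j j').1 (congrArg Subtype.val h) with h | h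
      · exact h
      · by_cases hjk : j = k
        · rw [hjk, Equiv.swap_apply_left] at h; exact absurd h.symm hj'
        · rwa [Equiv.swap_apply_of_ne_of_ne hjk hj] at h
    · rintro ⟨x, hx⟩
      have hx' : X.f x = ((b i : ℂ) : Sphere) := hx
      obtain ⟨j, hj⟩ := S.surj (ε := true) (x := x) (hx' ▸ hmem)
      rw [hx'] at hj
      by_cases hjl : j = l
      · exact ⟨⟨k, hkl⟩, Subtype.ext (((key k j).2 (Or.inr (by simp [hjl]))).trans hj)⟩
      · exact ⟨⟨j, hjl⟩, Subtype.ext hj⟩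
  rw [← Nat.card_eq_of_bijective _ h1]
  simp [Fintype.card_subtype_compl]

end Sheets

lemma notMem_vertices_iff {r : ℕ} {b : Fin r → ℝ} {q : Sphere} :
    q ∉ vertices b ↔ q ≠ OnePoint.infty ∧ ∀ i, q ≠ ((b i : ℂ) : Sphere) := by
  simp [vertices, eq_comm]

end Hurwitz

end

noncomputable section

namespace Hurwitz

open Set Filter Topology

open Equiv (Perm)

/-! ### Counting covers with real branch points -/

instance fintypeLabels (m : ℕ+ →₀ ℕ) : Fintype (Σ a : ℕ+, Fin (m a)) where
  elems := m.support.sigma fun _ => Finset.univ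
  complete := by
    rintro ⟨a, i⟩
    simpa using (i.pos).ne'

lemma sum_labels {M : Type} [AddCommMonoid M] (m : ℕ+ →₀ ℕ) (F : ℕ+ → M) :
    ∑ s : Σ a : ℕ+, Fin (m a), F s.1 = m.sum fun a k => k • F a := by
  change ∑ s ∈ m.support.sigma (fun _ => Finset.univ), F s.1 = _
  rw [Finset.sum_sigma]
  simp [Finsupp.sum]

/-- The combinatorial data which classify the covers with real branch points and numbered sheets:
the permutations by which the sheets are glued along the arcs of the real line, and the label of
the point over `∞` to which each sheet leads. -/
structure IsMonodromy (d : ℕ) {r : ℕ} (m : ℕ+ →₀ ℕ)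
    (t : (Fin (r + 1) → Perm (Fin d)) × (Fin d → Σ a : ℕ+, Fin (m a))) : Prop where
  pos : 0 < d
  zero : t.1 0 = 1
  swap : ∀ i : Fin r, ((t.1 i.castSucc)⁻¹ * t.1 i.succ).IsSwap
  transitive : ∀ K : Set (Fin d), (∀ j k, t.1 j k ∈ K ↔ k ∈ K) → K = ∅ ∨ K = univ
  label : ∀ k l, t.2 k = t.2 l ↔ (t.1 (Fin.last r)).SameCycle k l
  card : ∀ s, {k | t.2 k = s}.ncard = s.1

lemma IsMonodromy.sum_eq {d r : ℕ} {m : ℕ+ →₀ ℕ}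
    {t : (Fin (r + 1) → Perm (Fin d)) × (Fin d → Σ a : ℕ+, Fin (m a))} (ht : IsMonodromy d m t) :
    (m.sum fun a k => k • (a : ℕ)) = d := by
  classical
  rw [← sum_labels m fun a => (a : ℕ)]
  have h := Finset.card_eq_sum_card_fiberwise (f := t.2) (s := Finset.univ) (t := Finset.univ)
    (fun _ _ => Finset.mem_coe.2 (Finset.mem_univ _))
  rw [Finset.card_univ, Fintype.card_fin] at h
  rw [h]
  refine Finset.sum_congr rfl fun s _ => ?_
  rw [← ht.card s, Set.ncard_eq_toFinset_card']
  congr 1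
  ext; simp

variable {d r γ : ℕ} {b : Fin r → ℝ} {m : ℕ+ →₀ ℕ}

/-- The covers with branch points `b i` on the real line and `∞`. -/
abbrev RealCover (b : Fin r → ℝ) (d γ : ℕ) (m : ℕ+ →₀ ℕ) : Type 1 :=
  HurwitzCover OnePoint.infty (fun i => ((b i : ℂ) : Sphere)) d γ m

/-- The numberings of the sheets of a cover. -/
abbrev Numbering (X : RealCover b d γ m) : Type := Fin d ≃ X.f ⁻¹' {basePt true}

/-- `t` is the monodromy of `X` for the numbering `ν` of the sheets. -/
def IsMonodromyOf (X : RealCover b d γ m) (ν : Numbering X)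
    (t : (Fin (r + 1) → Perm (Fin d)) × (Fin d → Σ a : ℕ+, Fin (m a))) : Prop :=
  ∃ S : Sheets b d X.toBranchedCover, (∀ k, S.s true k (basePt true) = ν k) ∧ S.g = t.1 ∧
    ∀ k, (X.label (t.2 k) : X.C) = S.s true k OnePoint.infty

namespace RealCover

lemma card_numbering (hX : RealCover b d γ m) : Nat.card (Numbering hX) = d.factorial := by
  have : Finite (hX.f ⁻¹' {basePt true}) := hX.toBranchedCover.finite_fiber _
  have h1 : Nat.card (hX.f ⁻¹' {basePt true}) = d := by
    obtain ⟨h2, h3⟩ := notMem_vertices_iff.1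
      (notMem_vertices_of_mem_openHalf b (basePt_mem true))
    exact hX.degree _ h2 h3
  let e := Finite.equivFinOfCardEq h1
  rw [Nat.card_congr (Equiv.equivCongr (Equiv.refl (Fin d)) e)]
  simp [Fintype.card_perm]

variable (X Y : RealCover b d γ m)

lemma exists_monodromy (hb : StrictMono b) (ν : Numbering X) : ∃ t, IsMonodromyOf X ν t := by
  obtain ⟨S, hS⟩ := X.toBranchedCover.exists_sheets hb
    (fun x hx => X.unramified x (notMem_vertices_iff.1 hx).1 (notMem_vertices_iff.1 hx).2)
    (fun q hq => X.degree q (notMem_vertices_iff.1 hq).1 (notMem_vertices_iff.1 hq).2) ν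
  refine ⟨(S.g, fun k => X.label.symm ⟨S.s true k OnePoint.infty, S.f_s k (Sheets.inftyMem _)⟩),
    S, hS, rfl, fun k => ?_⟩
  simp

variable {X Y}

lemma pos_of_monodromy {ν : Numbering X}
    {t : (Fin (r + 1) → Perm (Fin d)) × (Fin d → Σ a : ℕ+, Fin (m a))}
    (h : IsMonodromyOf X ν t) : 0 < d := by
  obtain ⟨S, -⟩ := h
  obtain ⟨x⟩ := (inferInstance : Nonempty X.C)
  obtain ⟨ε, hε⟩ := exists_mem_closedHalf (X.f x)
  obtain ⟨k, -⟩ := S.surj hε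
  exact k.pos

lemma isMonodromy (hb : StrictMono b) {ν : Numbering X}
    {t : (Fin (r + 1) → Perm (Fin d)) × (Fin d → Σ a : ℕ+, Fin (m a))}
    (h : IsMonodromyOf X ν t) : IsMonodromy d m t := by
  have hd := pos_of_monodromy h
  obtain ⟨S, hS, hg, hL⟩ := h
  have hlab : ∀ k s, t.2 k = s ↔ S.s true k OnePoint.infty = X.label s := fun k s => by
    rw [← hL, ← X.label.injective.eq_iff, Subtype.ext_iff]
  refine ⟨hd, hg ▸ S.g_zero, fun i => ?_, fun K hK => S.transitive (by rwa [hg]), fun k l => ?_,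
    fun s => ?_⟩
  · obtain ⟨x, hx, h2, h1⟩ := X.simple i
    rw [← hg]
    exact S.isSwap_of_simple hb hx h2 h1
  · rw [hlab, hL, S.s_infty_eq_iff, hg]
  · have h1 := X.label_index s
    have h2 : X.f (X.label s : X.C) = OnePoint.infty := (X.label s).2
    rw [S.hasRamificationIndex_iff (ε := true) (by rw [h2]; exact Sheets.inftyMem _), h2] at h1
    rw [← h1]
    congr 1
    ext k
    exact hlab k s

/-- Equal gluing permutations give a homeomorphism over the sphere that matches the sheets. Since
every point over `∞` lies on some sheet and the sheets carry equal labels, it also respects the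
numbering over `∞`. -/
lemma exists_iso {ν : Numbering X} {ν' : Numbering Y}
    {t : (Fin (r + 1) → Perm (Fin d)) × (Fin d → Σ a : ℕ+, Fin (m a))}
    (h : IsMonodromyOf X ν t) (h' : IsMonodromyOf Y ν' t) :
    ∃ φ : HurwitzCover.Iso X Y, ∀ k, φ.1 (ν k) = (ν' k : Y.C) := by
  obtain ⟨S, hS, hg, hL⟩ := h
  obtain ⟨S', hS', hg', hL'⟩ := h'
  obtain ⟨φ, h1, h2⟩ := S.exists_homeomorph S' (hg.trans hg'.symm)
  refine ⟨⟨φ, h1, fun s => ?_⟩, fun k => ?_⟩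
  · have h3 : X.f (X.label s : X.C) = OnePoint.infty := (X.label s).2
    obtain ⟨k, hk⟩ := S.surj (ε := true) (x := (X.label s : X.C)) (by rw [h3]; exact Sheets.inftyMem _)
    rw [h3, ← hL] at hk
    rw [← X.label.injective (Subtype.ext hk), hL, h2 _ _ _ (Sheets.inftyMem _), ← hL']
  · rw [← hS, ← hS', h2 _ _ _ (openHalf_subset _ (basePt_mem _))]

/-- The action of isomorphisms on numberings. -/
def mapNumbering (φ : HurwitzCover.Iso X Y) (ν : Numbering X) : Numbering Y :=
  ν.trans (φ.1.toEquiv.subtypeEquiv fun x => by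
    change X.f x = _ ↔ Y.f (φ.1 x) = _
    rw [φ.2.1])

lemma mapNumbering_apply (φ : HurwitzCover.Iso X Y) (ν : Numbering X) (k : Fin d) :
    (mapNumbering φ ν k : Y.C) = φ.1 (ν k) := rfl

lemma isMonodromyOf_map (φ : HurwitzCover.Iso X Y) {ν : Numbering X}
    {t : (Fin (r + 1) → Perm (Fin d)) × (Fin d → Σ a : ℕ+, Fin (m a))}
    (h : IsMonodromyOf X ν t) : IsMonodromyOf Y (mapNumbering φ ν) t := by
  obtain ⟨S, hS, hg, hL⟩ := h
  refine ⟨S.map φ.1 φ.2.1, fun k => ?_, hg, fun k => ?_⟩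
  · rw [mapNumbering_apply, ← hS]; rfl
  · rw [← φ.2.2, hL]; rfl

lemma monodromy_unique (hb : StrictMono b) {ν : Numbering X}
    {t t' : (Fin (r + 1) → Perm (Fin d)) × (Fin d → Σ a : ℕ+, Fin (m a))}
    (h : IsMonodromyOf X ν t) (h' : IsMonodromyOf X ν t') : t = t' := by
  obtain ⟨S, hS, hg, hL⟩ := h
  obtain ⟨S', hS', hg', hL'⟩ := h'
  have h1 : ∀ k, S.s true k (basePt true) = S'.s true k (basePt true) := fun k => by rw [hS, hS']
  refine Prod.ext (by rw [← hg, ← hg', S.g_eq_of_eq_basePt hb S' h1]) (funext fun k => ?_)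
  apply X.label.injective
  apply Subtype.ext
  rw [hL, hL', S.eqOn_of_eq_basePt S' (h1 k) (Sheets.inftyMem _)]

lemma iso_ext (hb : StrictMono b) {φ χ : HurwitzCover.Iso X Y} {ν : Numbering X}
    (h : mapNumbering φ ν = mapNumbering χ ν) : φ = χ := by
  obtain ⟨t, S, hS, -⟩ := exists_monodromy X hb ν
  refine Subtype.ext (S.eq_of_eq_basePt hb φ.2.1 χ.2.1 fun k => ?_)
  rw [hS, ← mapNumbering_apply, h, mapNumbering_apply]

/-- The glued cover realises the data, and its genus is forced: there is one point over `∞` for each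
label and `d - 1` points over each `b i`, so `hr` is exactly the Euler characteristic relation of
the cell decomposition. -/
lemma exists_realCover (hb : StrictMono b)
    (hr : (r : ℤ) = 2 * d + 2 * γ - 2 - m.sum fun a k => ((a : ℤ) - 1) * k)
    {t : (Fin (r + 1) → Perm (Fin d)) × (Fin d → Σ a : ℕ+, Fin (m a))} (ht : IsMonodromy d m t) :
    ∃ (X : RealCover b d γ m) (ν : Numbering X), IsMonodromyOf X ν t := by
  obtain ⟨X, S, hS⟩ := exists_branchedCover hb ht.pos ht.zero ht.transitive
  have hlab : ∀ k l, S.s true k OnePoint.infty = S.s true l OnePoint.infty ↔ t.2 k = t.2 l :=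
    fun k l => by rw [S.s_infty_eq_iff, hS, ht.label]
  have hne : ∀ s, ∃ k, t.2 k = s := fun s =>
    Set.nonempty_of_ncard_ne_zero ((ht.card s).trans_ne s.1.pos.ne')
  choose κ hκ using hne
  let label : (Σ a : ℕ+, Fin (m a)) ≃ X.f ⁻¹' {OnePoint.infty} :=
    Equiv.ofBijective (fun s => ⟨S.s true (κ s) OnePoint.infty, S.f_s _ (Sheets.inftyMem _)⟩) <| by
      constructor
      · intro s s' h
        rw [← hκ s, ← hκ s', ← hlab]
        exact congrArg Subtype.val h
      · rintro ⟨x, hx⟩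
        have hx' : X.f x = OnePoint.infty := hx
        obtain ⟨k, hk⟩ := S.surj (ε := true) (x := x) (hx' ▸ Sheets.inftyMem _)
        rw [hx'] at hk
        exact ⟨t.2 k, Subtype.ext (((hlab _ _).2 (hκ _)).trans hk)⟩
  have hlabel : ∀ k, (label (t.2 k) : X.C) = S.s true k OnePoint.infty := fun k =>
    (hlab _ _).2 (hκ _)
  have hsw : ∀ i : Fin r, ((S.g i.castSucc)⁻¹ * S.g i.succ).IsSwap := by rw [hS]; exact ht.swap
  have hcard : Nat.card (X.f ⁻¹' vertices b) = (m.sum fun _ k => k) + r * (d - 1) := by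
    have h1 : Function.Bijective (fun s : (X.f ⁻¹' {OnePoint.infty}) ⊕
        (Σ i : Fin r, X.f ⁻¹' {((b i : ℂ) : Sphere)}) => (Sum.elim
          (fun x => ⟨x.1, by rw [mem_preimage, show X.f x.1 = _ from x.2]; exact mem_insert _ _⟩)
          (fun x => ⟨x.2.1, by
            rw [mem_preimage, show X.f x.2.1 = _ from x.2.2]
            exact mem_insert_of_mem _ (mem_range_self _)⟩) s : X.f ⁻¹' vertices b)) := by
      constructor
      · rintro (⟨x, hx⟩ | ⟨i, x, hx⟩) (⟨y, hy⟩ | ⟨j, y, hy⟩) h <;>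
          have h' := congrArg Subtype.val h <;> simp only [Sum.elim_inl, Sum.elim_inr] at h' <;>
          subst h' <;> rw [mem_preimage, mem_singleton_iff] at hx hy
        · exact absurd (hy.symm.trans hx) (OnePoint.coe_ne_infty _)
        · exact absurd (hx.symm.trans hy) (OnePoint.coe_ne_infty _)
        · obtain rfl : i = j := hb.injective (by
            have := OnePoint.coe_injective (hx.symm.trans hy)
            exact_mod_cast this)
          rfl
      · rintro ⟨x, hx | ⟨i, hi⟩⟩
        · exact ⟨Sum.inl ⟨x, hx⟩, rfl⟩
        · exact ⟨Sum.inr ⟨i, x, hi.symm⟩, rfl⟩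
    have : ∀ i : Fin r, Finite (X.f ⁻¹' {((b i : ℂ) : Sphere)}) := fun i => X.finite_fiber _
    have : Finite (X.f ⁻¹' {OnePoint.infty}) := X.finite_fiber _
    rw [← Nat.card_eq_of_bijective _ h1, Nat.card_sum, Nat.card_sigma, ← Nat.card_congr label]
    congr 1
    · rw [Nat.card_eq_fintype_card, ← Finset.card_univ, Finset.card_eq_sum_ones,
        sum_labels m fun _ => 1]
      simp
    · simp [fun i => S.card_fiber_branch hb (hsw i)]
  have hgenus : HasGenus X.C γ := by
    refine S.hasGenus hb ?_
    have h1 := ht.sum_eq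
    -- The sum of `a - 1` over all parts is the degree minus the number of points over `∞`.
    have h2 : (m.sum fun a k => ((a : ℤ) - 1) * k) = (m.sum fun a k => k • (a : ℕ) : ℕ) -
        (m.sum fun _ k => k : ℕ) := by
      simp only [Finsupp.sum]
      push_cast
      rw [← Finset.sum_sub_distrib]
      refine Finset.sum_congr rfl fun a _ => ?_
      simp; ring
    rw [h2, h1] at hr
    rw [hcard]
    have hd : ((d - 1 : ℕ) : ℤ) = d - 1 := by have := ht.pos; omega
    push_cast [hd]
    push_cast at hr
    linarith
  refine ⟨⟨X, fun q h1 h2 => S.card_fiber (notMem_vertices_iff.2 ⟨h1, h2⟩), hgenus, label,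
    fun s => ?_, fun i => S.simple_of_isSwap hb (hsw i), fun x h1 h2 =>
      S.hasRamificationIndex_one (notMem_vertices_iff.2 ⟨h1, h2⟩)⟩, S.basePtEquiv, S,
      fun k => rfl, hS, hlabel⟩
  have hs : X.f (label s : X.C) = OnePoint.infty := (label s).2
  rw [S.hasRamificationIndex_iff (ε := true) (by rw [hs]; exact Sheets.inftyMem _), hs, ← ht.card s]
  congr 1
  ext k
  rw [mem_ofPred_eq, mem_ofPred_eq, ← hlabel, ← Subtype.ext_iff, label.injective.eq_iff]

lemma finite_iso (hb : StrictMono b) (X : RealCover b d γ m) : Finite (HurwitzCover.Iso X X) := by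
  have h1 : Nat.card (Numbering X) ≠ 0 := by
    rw [card_numbering]; exact d.factorial_ne_zero
  have := Nat.finite_of_card_ne_zero h1
  have := (Nat.card_ne_zero.1 h1).1
  obtain ⟨ν⟩ := this
  exact Finite.of_injective (fun φ => mapNumbering φ ν) fun φ χ h => iso_ext hb h

lemma exists_monodromy_choice (hb : StrictMono b) :
    ∃ mon : ∀ X : RealCover b d γ m, Numbering X → {t : (Fin (r + 1) → Perm (Fin d)) ×
      (Fin d → Σ a : ℕ+, Fin (m a)) // IsMonodromy d m t}, ∀ X ν, IsMonodromyOf X ν (mon X ν).1 := by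
  choose mon hmon using fun X : RealCover b d γ m => X.exists_monodromy hb
  exact ⟨fun X ν => ⟨mon X ν, isMonodromy hb (hmon X ν)⟩, hmon⟩

/-- The monodromy data of any one numbering determine the class, and there are only finitely many
data. -/
lemma finite_class (hb : StrictMono b) (d γ : ℕ) (m : ℕ+ →₀ ℕ) :
    Finite (CoverClass OnePoint.infty (fun i => ((b i : ℂ) : Sphere)) d γ m) := by
  obtain ⟨mon, hmon⟩ := exists_monodromy_choice (d := d) (γ := γ) (m := m) hb
  have hN : ∀ X : RealCover b d γ m, Nonempty (Numbering X) := fun X => by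
    have h1 : Nat.card (Numbering X) ≠ 0 := by rw [card_numbering]; exact d.factorial_ne_zero
    exact (Nat.card_ne_zero.1 h1).1
  refine Finite.of_injective (fun c : CoverClass OnePoint.infty (fun i => ((b i : ℂ) : Sphere)) d γ m =>
    mon c.out (hN c.out).some) fun c c' h => ?_
  have h1 := hmon c.out (hN c.out).some
  have h2 := hmon c'.out (hN c'.out).some
  beta_reduce at h
  rw [← h] at h2
  obtain ⟨φ, -⟩ := exists_iso h1 h2
  rw [← c.out_eq, ← c'.out_eq]
  exact Quotient.sound ⟨φ⟩

/-- This is orbit counting: automorphisms act freely on the `d!` numberings, and two numberings lie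
in one orbit exactly when they have the same monodromy. -/
lemma card_iso_mul (hb : StrictMono b) {mon : ∀ X : RealCover b d γ m, Numbering X →
      {t : (Fin (r + 1) → Perm (Fin d)) × (Fin d → Σ a : ℕ+, Fin (m a)) // IsMonodromy d m t}}
    (hmon : ∀ X ν, IsMonodromyOf X ν (mon X ν).1) (X : RealCover b d γ m) :
    Nat.card (HurwitzCover.Iso X X) * Nat.card (range (mon X)) = d.factorial := by
  rw [← card_numbering X, ← Nat.card_prod]
  choose ν hν using fun t : range (mon X) => t.2
  have hmap : ∀ φ ν, mon X (mapNumbering φ ν) = mon X ν := fun φ ν => Subtype.ext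
    (monodromy_unique hb (hmon _ _) (isMonodromyOf_map φ (hmon X ν)))
  refine Nat.card_eq_of_bijective (fun a => mapNumbering a.1 (ν a.2)) ⟨?_, fun ν' => ?_⟩
  · rintro ⟨φ, t⟩ ⟨χ, t'⟩ h
    beta_reduce at h
    obtain rfl : t = t' := by
      have := congrArg (mon X) h
      rw [hmap, hmap, hν, hν] at this
      exact Subtype.ext this
    exact Prod.ext (iso_ext hb h) rfl
  · have h1 := hmon X (ν ⟨mon X ν', mem_range_self _⟩)
    rw [hν ⟨mon X ν', mem_range_self _⟩] at h1
    obtain ⟨φ, hφ⟩ := exists_iso h1 (hmon X ν')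
    exact ⟨(φ, ⟨mon X ν', mem_range_self _⟩), Equiv.ext fun k => Subtype.ext (hφ k)⟩

end RealCover

open RealCover in
/-- Hurwitz numbers count monodromies. -/
lemma hurwitzNumber_real (hb : StrictMono b)
    (hr : (r : ℤ) = 2 * d + 2 * γ - 2 - m.sum fun a k => ((a : ℤ) - 1) * k) :
    hurwitzNumber OnePoint.infty (fun i => ((b i : ℂ) : Sphere)) d γ m =
      (Nat.card {t : (Fin (r + 1) → Perm (Fin d)) × (Fin d → Σ a : ℕ+, Fin (m a)) //
        IsMonodromy d m t} : ℚ) / d.factorial := by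
  obtain ⟨mon, hmon⟩ := exists_monodromy_choice (d := d) (γ := γ) (m := m) hb
  have := finite_class hb d γ m
  let _ := Fintype.ofFinite (CoverClass OnePoint.infty (fun i => ((b i : ℂ) : Sphere)) d γ m)
  -- Each datum is attained by exactly one isomorphism class.
  have h1 : Function.Bijective (fun a : Σ c : CoverClass OnePoint.infty
      (fun i => ((b i : ℂ) : Sphere)) d γ m, range (mon c.out) => a.2.1) := by
    constructor
    · rintro ⟨c, t, ν, hν⟩ ⟨c', t', ν', hν'⟩ h
      beta_reduce at h
      obtain rfl : t = t' := h
      obtain rfl : c = c' := by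
        have h1 := hmon c.out ν
        have h2 := hmon c'.out ν'
        rw [hν] at h1
        rw [hν'] at h2
        obtain ⟨φ, -⟩ := exists_iso h1 h2
        rw [← c.out_eq, ← c'.out_eq]
        exact Quotient.sound ⟨φ⟩
      rfl
    · intro t
      obtain ⟨X, ν, h⟩ := exists_realCover hb hr t.2
      obtain ⟨φ⟩ : Nonempty (HurwitzCover.Iso X (Quotient.mk (HurwitzCover.isoSetoid _ _ _ _ _) X :
          CoverClass OnePoint.infty (fun i => ((b i : ℂ) : Sphere)) d γ m).out) :=
        Setoid.symm (Quotient.mk_out (s := HurwitzCover.isoSetoid _ _ _ _ _) X)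
      exact ⟨⟨_, _, mapNumbering φ ν, rfl⟩, Subtype.ext
        (monodromy_unique hb (hmon _ _) (isMonodromyOf_map φ h))⟩
  rw [hurwitzNumber, finsum_eq_sum_of_fintype, ← Nat.card_eq_of_bijective _ h1, Nat.card_sigma,
    Nat.cast_sum, Finset.sum_div]
  refine Finset.sum_congr rfl fun c _ => ?_
  have h2 := card_iso_mul hb hmon c.out
  have h3 : (d.factorial : ℚ) ≠ 0 := by exact_mod_cast d.factorial_ne_zero
  have h4 : (Nat.card (HurwitzCover.Iso c.out c.out) : ℚ) ≠ 0 := fun h => h3 (by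
    rw [← h2]; push_cast; rw [h, zero_mul])
  rw [div_eq_div_iff h4 h3, one_mul, ← h2]
  push_cast
  ring

end Hurwitz

end

noncomputable section

namespace Hurwitz

open Set Filter Topology

open Equiv (Perm)

/-! ### Moving the branch points -/

lemma HasRamificationIndex.homeomorph_comp {C : Type} [TopologicalSpace C] {f : C → Sphere} {x : C}
    {e : ℕ} (h : HasRamificationIndex f x e) (Φ : Sphere ≃ₜ Sphere) :
    HasRamificationIndex (fun y => Φ (f y)) x e := by
  obtain ⟨he, φ, ψ, h1, h2, h3, h4, h5⟩ := h
  refine ⟨he, φ, Φ.symm.toOpenPartialHomeomorph.trans ψ, h1, h2, ?_, ?_, fun y hy => ?_⟩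
  · simpa using h3
  · simpa using h4
  · simpa using h5 y hy

namespace HurwitzCover

variable {p p' : Sphere} {r : ℕ} {b b' : Fin r → Sphere} {d g : ℕ} {m : ℕ+ →₀ ℕ}

/-- A homeomorphism of the sphere transports covers. -/
def transport (Φ : Sphere ≃ₜ Sphere) (hp : Φ p = p') (σ : Perm (Fin r))
    (hb : ∀ i, Φ (b i) = b' (σ i)) (X : HurwitzCover p b d g m) : HurwitzCover p' b' d g m where
  C := X.C
  f x := Φ (X.f x)
  continuous_f := Φ.continuous.comp X.continuous_f
  locally_power x := by
    obtain ⟨e, he⟩ := X.locally_power x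
    exact ⟨e, he.homeomorph_comp Φ⟩
  degree q h1 h2 := by
    have : (fun x => Φ (X.f x)) ⁻¹' {q} = X.f ⁻¹' {Φ.symm q} := by
      ext x
      exact (Φ.toEquiv.eq_symm_apply).symm
    rw [this]
    refine X.degree _ (fun h => h1 ?_) fun i h => h2 (σ i) ?_
    · rw [← hp, ← h, Φ.apply_symm_apply]
    · rw [← hb, ← h, Φ.apply_symm_apply]
  genus := X.genus
  label := X.label.trans (Equiv.setCongr (by
    ext x
    rw [mem_preimage, mem_preimage, mem_singleton_iff, mem_singleton_iff, ← hp, Φ.injective.eq_iff]))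
  label_index s := (X.label_index s).homeomorph_comp Φ
  simple i := by
    obtain ⟨x, hx, h2, h1⟩ := X.simple (σ.symm i)
    have hbi : Φ (b (σ.symm i)) = b' i := by rw [hb, Equiv.apply_symm_apply]
    refine ⟨x, by rw [hx, hbi], h2.homeomorph_comp Φ, fun y hy hyx => ?_⟩
    exact (h1 y (Φ.injective (hy.trans hbi.symm)) hyx).homeomorph_comp Φ
  unramified x h1 h2 := by
    refine (X.unramified x (fun h => h1 (by rw [h, hp])) fun i h => h2 (σ i) ?_).homeomorph_comp Φ
    rw [h, hb]

/-- Transport on isomorphisms. -/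
def transportIso (Φ : Sphere ≃ₜ Sphere) (hp : Φ p = p') (σ : Perm (Fin r))
    (hb : ∀ i, Φ (b i) = b' (σ i)) (X Y : HurwitzCover p b d g m) :
    Iso X Y ≃ Iso (X.transport Φ hp σ hb) (Y.transport Φ hp σ hb) where
  toFun φ := ⟨φ.1, fun x => congrArg Φ (φ.2.1 x), φ.2.2⟩
  invFun φ := ⟨φ.1, fun x => Φ.injective (φ.2.1 x), φ.2.2⟩
  left_inv _ := rfl
  right_inv _ := rfl

lemma transport_transport (Φ : Sphere ≃ₜ Sphere) (hp : Φ p = p') (σ : Perm (Fin r))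
    (hb : ∀ i, Φ (b i) = b' (σ i)) (hp' : Φ.symm p' = p) (hb' : ∀ i, Φ.symm (b' i) = b (σ.symm i))
    (X : HurwitzCover p b d g m) :
    Nonempty (Iso ((X.transport Φ hp σ hb).transport Φ.symm hp' σ.symm hb') X) :=
  ⟨⟨Homeomorph.refl X.C, fun x => (Φ.symm_apply_apply (X.f x)).symm, fun _ => rfl⟩⟩

/-- Isomorphic covers have conjugate automorphisms. -/
def isoConj {X Y : HurwitzCover p b d g m} (χ : Iso X Y) : Iso X X ≃ Iso Y Y where
  toFun φ := ⟨χ.1.symm.trans (φ.1.trans χ.1), fun y => by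
    simp only [Homeomorph.trans_apply, χ.2.1, φ.2.1]
    rw [← χ.2.1, χ.1.apply_symm_apply], fun s => by
    simp only [Homeomorph.trans_apply]
    rw [← χ.2.2, χ.1.symm_apply_apply, φ.2.2]⟩
  invFun φ := ⟨χ.1.trans (φ.1.trans χ.1.symm), fun x => by
    simp only [Homeomorph.trans_apply]
    rw [← χ.2.1, χ.1.apply_symm_apply, φ.2.1, χ.2.1], fun s => by
    simp only [Homeomorph.trans_apply]
    rw [χ.2.2, φ.2.2, ← χ.2.2, χ.1.symm_apply_apply]⟩
  left_inv φ := Subtype.ext (Homeomorph.ext fun x => by simp)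
  right_inv φ := Subtype.ext (Homeomorph.ext fun x => by simp)

section

variable (Φ : Sphere ≃ₜ Sphere) (hp : Φ p = p') (σ : Perm (Fin r)) (hb : ∀ i, Φ (b i) = b' (σ i))

/-- Transport on isomorphism classes. -/
def transportClass : CoverClass p b d g m → CoverClass p' b' d g m :=
  Quotient.map (transport Φ hp σ hb) fun X Y ⟨φ⟩ => ⟨transportIso Φ hp σ hb X Y φ⟩

lemma transportClass_bijective :
    Function.Bijective (transportClass (d := d) (g := g) (m := m) Φ hp σ hb) := by
  have hp' : Φ.symm p' = p := by rw [← hp, Φ.symm_apply_apply]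
  have hb' : ∀ i, Φ.symm (b' i) = b (σ.symm i) := fun i => by
    rw [← Φ.injective.eq_iff, Φ.apply_symm_apply, hb, Equiv.apply_symm_apply]
  refine Function.bijective_iff_has_inverse.2 ⟨transportClass Φ.symm hp' σ.symm hb', ?_, ?_⟩
  · intro c
    induction c using Quotient.inductionOn with
    | h X => exact Quotient.sound (transport_transport Φ hp σ hb hp' hb' X)
  · intro c
    induction c using Quotient.inductionOn with
    | h X => exact Quotient.sound (transport_transport Φ.symm hp' σ.symm hb' hp hb X)

include hp hb in
lemma hurwitzNumber_transport : hurwitzNumber p b d g m = hurwitzNumber p' b' d g m := by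
  refine finsum_eq_of_bijective _ (transportClass_bijective Φ hp σ hb) fun c => ?_
  have h1 : Nonempty (Iso (c.out.transport Φ hp σ hb) (transportClass Φ hp σ hb c).out) := by
    have h2 : transportClass Φ hp σ hb c = Quotient.mk _ (c.out.transport Φ hp σ hb) := by
      conv_lhs => rw [← c.out_eq]
      rfl
    rw [h2]
    exact Setoid.symm (Quotient.mk_out (s := isoSetoid _ _ _ _ _) _)
  obtain ⟨χ⟩ := h1
  rw [Nat.card_congr ((transportIso Φ hp σ hb _ _).trans (isoConj χ))]

end

end HurwitzCover

/-- Finitely many points of the plane are moved to the real line by a homeomorphism. -/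
lemma exists_homeomorph_real {r : ℕ} {c : Fin r → ℂ} (hc : Function.Injective c) :
    ∃ (h : ℂ ≃ₜ ℂ) (u : Fin r → ℝ), Function.Injective u ∧ ∀ i, h (c i) = u i := by
  -- For a generic slope `s` the sheared real parts are distinct, because each pair of points
  -- excludes at most one slope.
  obtain ⟨s, hs⟩ : ∃ s : ℝ, Function.Injective fun i => (c i).re + s * (c i).im := by
    have h1 : (⋃ a : Fin r × Fin r, {s : ℝ | c a.1 ≠ c a.2 ∧
        (c a.1).re + s * (c a.1).im = (c a.2).re + s * (c a.2).im}).Finite := by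
      refine finite_iUnion fun a => Set.Subsingleton.finite ?_
      rintro s ⟨hne, hs⟩ t ⟨-, ht⟩
      by_contra hst
      have h2 : (s - t) * ((c a.1).im - (c a.2).im) = 0 := by linear_combination hs - ht
      have h3 := (mul_eq_zero.1 h2).resolve_left (sub_ne_zero.2 hst)
      have h4 : (c a.1).im = (c a.2).im := by linarith
      rw [h4] at hs
      exact hne (Complex.ext (by linarith) h4)
    obtain ⟨s, hs⟩ := h1.infinite_compl.nonempty
    refine ⟨s, fun i j hij => ?_⟩
    by_contra hne
    exact hs (mem_iUnion.2 ⟨(i, j), fun h => hne (hc h), hij⟩)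
  set u := fun i => (c i).re + s * (c i).im with hu
  -- The graph of the interpolating polynomial passes through the sheared points, and subtracting it
  -- from the imaginary part pushes them onto the real line.
  set P := Lagrange.interpolate Finset.univ u fun i => (c i).im with hP
  have hPu : ∀ i, P.eval (u i) = (c i).im := fun i =>
    Lagrange.eval_interpolate_at_node _ hs.injOn (Finset.mem_univ i)
  have hPc : Continuous fun x => P.eval x := P.continuous
  refine ⟨⟨⟨fun z => ((z.re + s * z.im : ℝ) : ℂ) + ((z.im - P.eval (z.re + s * z.im) : ℝ) : ℂ) * Complex.I,
    fun z => ((z.re - s * (z.im + P.eval z.re) : ℝ) : ℂ) + ((z.im + P.eval z.re : ℝ) : ℂ) * Complex.I,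
    fun z => ?_, fun z => ?_⟩, ?_, ?_⟩, u, hs, fun i => ?_⟩
  · apply Complex.ext
    · simp only [Complex.add_re, Complex.ofReal_re, Complex.re_ofReal_mul, Complex.I_re, Complex.add_im,
        Complex.ofReal_im, Complex.im_ofReal_mul, Complex.I_im]
      ring_nf
    · simp only [Complex.add_re, Complex.ofReal_re, Complex.re_ofReal_mul, Complex.I_re, Complex.add_im,
        Complex.ofReal_im, Complex.im_ofReal_mul, Complex.I_im]
      ring_nf
  · apply Complex.ext
    · simp only [Complex.add_re, Complex.ofReal_re, Complex.re_ofReal_mul, Complex.I_re, Complex.add_im,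
        Complex.ofReal_im, Complex.im_ofReal_mul, Complex.I_im]
      ring_nf
    · simp only [Complex.add_re, Complex.ofReal_re, Complex.re_ofReal_mul, Complex.I_re, Complex.add_im,
        Complex.ofReal_im, Complex.im_ofReal_mul, Complex.I_im]
      ring_nf
  · change Continuous fun z : ℂ => ((z.re + s * z.im : ℝ) : ℂ) +
      ((z.im - P.eval (z.re + s * z.im) : ℝ) : ℂ) * Complex.I
    have : Continuous fun z : ℂ => P.eval (z.re + s * z.im) := hPc.comp (by fun_prop)
    fun_prop
  · change Continuous fun z : ℂ => ((z.re - s * (z.im + P.eval z.re) : ℝ) : ℂ) +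
      ((z.im + P.eval z.re : ℝ) : ℂ) * Complex.I
    have : Continuous fun z : ℂ => P.eval z.re := hPc.comp (by fun_prop)
    fun_prop
  · change ((u i : ℝ) : ℂ) + (((c i).im - P.eval (u i) : ℝ) : ℂ) * Complex.I = _
    rw [hPu]; simp

/-- Branch points are moved to `∞` and an increasing sequence of real numbers. -/
lemma exists_homeomorph_strictMono {p : Sphere} {r : ℕ} {b : Fin r → Sphere}
    (hb : Function.Injective b) (hp : ∀ i, b i ≠ p) :
    ∃ (Φ : Sphere ≃ₜ Sphere) (σ : Perm (Fin r)) (b' : Fin r → ℝ), StrictMono b' ∧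
      Φ p = OnePoint.infty ∧ ∀ i, Φ (b i) = ((b' (σ i) : ℂ) : Sphere) := by
  obtain ⟨Φ, hΦ⟩ : ∃ Φ : Sphere ≃ₜ Sphere, Φ p = OnePoint.infty := by
    induction p using OnePoint.rec with
    | infty => exact ⟨Homeomorph.refl _, rfl⟩
    | coe z =>
      refine ⟨((Homeomorph.addRight (-z)).onePointCongr).trans negInvHomeomorph, ?_⟩
      change negInv (((z + -z : ℂ)) : Sphere) = _
      rw [add_neg_cancel]
      simp [negInv]
  have h1 : ∀ i, ∃ c : ℂ, ((c : ℂ) : Sphere) = Φ (b i) := fun i =>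
    OnePoint.ne_infty_iff_exists.1 fun h => hp i (Φ.injective (h.trans hΦ.symm))
  choose c hc using h1
  have hcinj : Function.Injective c := fun i j hij => hb (Φ.injective (by rw [← hc, ← hc, hij]))
  obtain ⟨h, u, hu, hcu⟩ := exists_homeomorph_real hcinj
  -- The real points are sorted; the resulting permutation `σ` of the simple branch points does not
  -- affect the covers that are counted.
  refine ⟨Φ.trans h.onePointCongr, (Tuple.sort u).symm, u ∘ Tuple.sort u,
    (Tuple.monotone_sort u).strictMono_of_injective (hu.comp (Tuple.sort u).injective), ?_, ?_⟩
  · rw [Homeomorph.trans_apply, hΦ]; rfl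
  · intro i
    rw [Homeomorph.trans_apply, ← hc, Function.comp_apply, Equiv.apply_symm_apply, ← hcu]
    rfl

lemma finite_coverClass {p : Sphere} {r : ℕ} {b : Fin r → Sphere} (hb : Function.Injective b)
    (hp : ∀ i, b i ≠ p) (d g : ℕ) (m : ℕ+ →₀ ℕ) : Finite (CoverClass p b d g m) ∧
      ∀ X : HurwitzCover p b d g m, Finite (HurwitzCover.Iso X X) := by
  obtain ⟨Φ, σ, b', hb', hp', h⟩ := exists_homeomorph_strictMono hb hp
  have h1 := RealCover.finite_class hb' d g m
  refine ⟨Finite.of_injective _ (HurwitzCover.transportClass_bijective (d := d) (g := g) (m := m)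
    (b' := fun i => ((b' i : ℂ) : Sphere)) Φ hp' σ h).1, fun X => ?_⟩
  have := RealCover.finite_iso hb' (X.transport (b' := fun i => ((b' i : ℂ) : Sphere)) Φ hp' σ h)
  exact Finite.of_equiv _ (HurwitzCover.transportIso (b' := fun i => ((b' i : ℂ) : Sphere)) Φ hp' σ h X X).symm

lemma hurwitzNumber_eq {p : Sphere} {r : ℕ} {b : Fin r → Sphere} (hb : Function.Injective b)
    (hp : ∀ i, b i ≠ p) {d g : ℕ} {m : ℕ+ →₀ ℕ}
    (hr : (r : ℤ) = 2 * d + 2 * g - 2 - m.sum fun a k => ((a : ℤ) - 1) * k) :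
    hurwitzNumber p b d g m =
      (Nat.card {t : (Fin (r + 1) → Perm (Fin d)) × (Fin d → Σ a : ℕ+, Fin (m a)) //
        IsMonodromy d m t} : ℚ) / d.factorial := by
  obtain ⟨Φ, σ, b', hb', hp', h⟩ := exists_homeomorph_strictMono hb hp
  rw [HurwitzCover.hurwitzNumber_transport (b' := fun i => ((b' i : ℂ) : Sphere)) Φ hp' σ h, hurwitzNumber_real hb' hr]

end Hurwitz

end

noncomputable section

namespace Hurwitz

open Set Filter Topology

open Equiv (Perm)

/-! ### Cycles of permutations and transpositions -/

section

variable {α : Type} {σ : Perm α}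

lemma sameCycle_pow (x : α) (k : ℕ) : σ.SameCycle x ((σ ^ k) x) := ⟨k, by simp⟩

lemma pow_mem_iff {S : Finset α} (hS : ∀ x, σ x ∈ S ↔ x ∈ S) (k : ℕ) (x : α) :
    (σ ^ k) x ∈ S ↔ x ∈ S := by
  induction k with
  | zero => simp
  | succ k ih => rw [pow_succ', Perm.mul_apply, hS, ih]

lemma swap_mul_mem_iff [DecidableEq α] {S : Finset α} (hS : ∀ x, σ x ∈ S ↔ x ∈ S) {x y : α} (hx : x ∈ S)
    (hy : y ∈ S) (z : α) : (Equiv.swap x y * σ) z ∈ S ↔ z ∈ S := by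
  rw [Perm.mul_apply, ← hS z]
  by_cases h1 : σ z = x
  · rw [h1, Equiv.swap_apply_left]; simp [hx, hy]
  by_cases h2 : σ z = y
  · rw [h2, Equiv.swap_apply_right]; simp [hx, hy]
  rw [Equiv.swap_apply_of_ne_of_ne h1 h2]

end

section

variable {α β : Type} [Finite α] [Finite β] (σ : Perm α)

/-- The length of the cycle of `x`. -/
def cycleLen (x : α) : ℕ+ :=
  ⟨Function.minimalPeriod σ x, Function.IsPeriodicPt.minimalPeriod_pos (orderOf_pos σ) (by
    rw [Function.IsPeriodicPt, Function.IsFixedPt, Perm.iterate_eq_pow, pow_orderOf_eq_one,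
      Perm.one_apply])⟩

variable {σ}

lemma pow_apply_eq_self_iff {x : α} {n : ℕ} : (σ ^ n) x = x ↔ (cycleLen σ x : ℕ) ∣ n := by
  rw [← Perm.iterate_eq_pow]
  exact Function.isPeriodicPt_iff_minimalPeriod_dvd

lemma pow_cycleLen (x : α) : (σ ^ (cycleLen σ x : ℕ)) x = x := pow_apply_eq_self_iff.2 dvd_rfl

lemma cycleLen_congr {τ : Perm β} {x : α} {y : β} (h : ∀ n, (σ ^ n) x = x ↔ (τ ^ n) y = y) :
    cycleLen σ x = cycleLen τ y := by
  apply PNat.eq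
  apply Nat.dvd_antisymm
  · rw [← pow_apply_eq_self_iff, h, pow_cycleLen]
  · rw [← pow_apply_eq_self_iff, ← h, pow_cycleLen]

lemma cycleLen_eq {x : α} {n : ℕ} (hn : 0 < n) (h1 : (σ ^ n) x = x)
    (h2 : ∀ s, 0 < s → s < n → (σ ^ s) x ≠ x) : (cycleLen σ x : ℕ) = n := by
  have h3 := Nat.le_of_dvd hn (pow_apply_eq_self_iff.1 h1)
  by_contra h4
  exact h2 _ (cycleLen σ x).pos (by omega) (pow_cycleLen x)

lemma pow_apply_inj {x : α} {k l : ℕ} (hk : k < cycleLen σ x) (hl : l < cycleLen σ x)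
    (h : (σ ^ k) x = (σ ^ l) x) : k = l := by
  wlog hkl : k ≤ l generalizing k l
  · exact (this hl hk h.symm (by omega)).symm
  have h1 : (σ ^ (l - k)) x = x := by
    apply (σ ^ k).injective
    rw [← Perm.mul_apply, ← pow_add, Nat.add_sub_cancel' hkl, h]
  have h2 := pow_apply_eq_self_iff.1 h1
  have := Nat.eq_zero_of_dvd_of_lt h2 (by omega)
  omega

lemma sameCycle_iff {x y : α} : σ.SameCycle x y ↔ ∃ k < (cycleLen σ x : ℕ), (σ ^ k) x = y := by
  constructor
  · intro h
    obtain ⟨k, rfl⟩ := h.exists_nat_pow_eq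
    refine ⟨k % cycleLen σ x, Nat.mod_lt _ (cycleLen σ x).pos, ?_⟩
    conv_rhs => rw [← Nat.mod_add_div k (cycleLen σ x), pow_add, Perm.mul_apply]
    congr 1
    exact (pow_apply_eq_self_iff.2 (dvd_mul_right _ _)).symm
  · rintro ⟨k, -, rfl⟩
    exact ⟨k, by simp⟩

lemma cycleLen_eq_of_sameCycle {x y : α} (h : σ.SameCycle x y) : cycleLen σ x = cycleLen σ y := by
  obtain ⟨k, -, rfl⟩ := sameCycle_iff.1 h
  refine cycleLen_congr fun n => ?_
  rw [← Perm.mul_apply, ← pow_add, add_comm, pow_add, Perm.mul_apply, (σ ^ k).injective.eq_iff]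

lemma sum_cycle {M : Type} [AddCommMonoid M] [DecidableRel σ.SameCycle] {S : Finset α}
    (hS : ∀ x, σ x ∈ S ↔ x ∈ S) {x : α} (hx : x ∈ S) (F : α → M) :
    ∑ z ∈ S with σ.SameCycle x z, F z = ∑ t ∈ Finset.range (cycleLen σ x), F ((σ ^ t) x) := by
  symm
  refine Finset.sum_nbij (fun t => (σ ^ t) x) (fun t ht => ?_) (fun t ht s hs h => ?_)
    (fun z hz => ?_) fun _ _ => rfl
  · rw [Finset.mem_filter, pow_mem_iff hS]
    exact ⟨hx, sameCycle_pow x t⟩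
  · exact pow_apply_inj (Finset.mem_range.1 (Finset.mem_coe.1 ht))
      (Finset.mem_range.1 (Finset.mem_coe.1 hs)) h
  · rw [Finset.mem_coe, Finset.mem_filter] at hz
    obtain ⟨k, hk, rfl⟩ := sameCycle_iff.1 hz.2
    exact ⟨k, Finset.mem_coe.2 (Finset.mem_range.2 hk), rfl⟩

lemma card_cycle [DecidableRel σ.SameCycle] {S : Finset α} (hS : ∀ x, σ x ∈ S ↔ x ∈ S) {x : α}
    (hx : x ∈ S) : (S.filter (σ.SameCycle x)).card = cycleLen σ x := by
  rw [Finset.card_eq_sum_ones, sum_cycle hS hx]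
  simp

/-- The number of points of `S` on cycles of length `a`. -/
def cycleCard (S : Finset α) (σ : Perm α) (a : ℕ+) : ℕ := (S.filter fun x => cycleLen σ x = a).card

lemma cycleCard_eq_sum (S : Finset α) (a : ℕ+) :
    cycleCard S σ a = ∑ z ∈ S, if cycleLen σ z = a then 1 else 0 := Finset.card_filter _ _

open Classical in
/-- The cycle type on `S`: the number of cycles of each length. -/
def cycleTypeOn (S : Finset α) (σ : Perm α) : ℕ+ →₀ ℕ :=
  Finsupp.onFinset (S.image (cycleLen σ))
    (fun a => ((S.filter fun x => cycleLen σ x = a).image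
      (Quotient.mk (Perm.SameCycle.setoid σ))).card) fun a ha => by
    obtain ⟨o, ho⟩ := Finset.card_ne_zero.1 ha
    obtain ⟨x, hx, -⟩ := Finset.mem_image.1 ho
    rw [Finset.mem_filter] at hx
    exact Finset.mem_image.2 ⟨x, hx.1, hx.2⟩

/-- The points on cycles of length `a` fall into groups of `a`. Cycle types can therefore be
compared by counting points, which is additive and avoids quotients. -/
lemma mul_cycleTypeOn {S : Finset α} (hS : ∀ x, σ x ∈ S ↔ x ∈ S) (a : ℕ+) :
    a * cycleTypeOn S σ a = cycleCard S σ a := by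
  classical
  rw [cycleCard, Finset.card_eq_sum_card_image (Quotient.mk (Perm.SameCycle.setoid σ)),
    Finset.sum_const_nat (m := a), mul_comm]
  · rfl
  · intro o ho
    obtain ⟨x, hx, rfl⟩ := Finset.mem_image.1 ho
    rw [Finset.mem_filter] at hx
    rw [← hx.2, ← card_cycle hS hx.1]
    congr 1
    ext z
    simp only [Finset.mem_filter]
    constructor
    · rintro ⟨⟨h1, h2⟩, h3⟩
      exact ⟨h1, (Quotient.exact h3).symm⟩
    · rintro ⟨h1, h2⟩
      exact ⟨⟨h1, (cycleLen_eq_of_sameCycle h2).symm⟩, Quotient.sound (Perm.SameCycle.symm h2)⟩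

lemma eq_cycleTypeOn_iff {S : Finset α} (hS : ∀ x, σ x ∈ S ↔ x ∈ S) {m : ℕ+ →₀ ℕ} :
    cycleTypeOn S σ = m ↔ ∀ a : ℕ+, a * m a = cycleCard S σ a := by
  constructor
  · rintro rfl a; exact mul_cycleTypeOn hS a
  · intro h
    ext a
    exact Nat.eq_of_mul_eq_mul_left a.pos ((mul_cycleTypeOn hS a).trans (h a).symm)

lemma cycleLen_apply_of_semiconj {S : Finset α} (hS : ∀ x, σ x ∈ S ↔ x ∈ S) {τ : Perm β} {e : α ↪ β}
    (h : ∀ x ∈ S, τ (e x) = e (σ x)) {x : α} (hx : x ∈ S) : cycleLen τ (e x) = cycleLen σ x := by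
  have h1 : ∀ n, (τ ^ n) (e x) = e ((σ ^ n) x) := by
    intro n
    induction n with
    | zero => rfl
    | succ n ih =>
      rw [pow_succ', Perm.mul_apply, ih, h _ ((pow_mem_iff hS n x).2 hx), pow_succ', Perm.mul_apply]
  exact cycleLen_congr fun n => by rw [h1, e.injective.eq_iff]

lemma cycleTypeOn_map {S : Finset α} (hS : ∀ x, σ x ∈ S ↔ x ∈ S) {τ : Perm β}
    {e : α ↪ β} (hS' : ∀ x, τ x ∈ S.map e ↔ x ∈ S.map e) (h : ∀ x ∈ S, τ (e x) = e (σ x)) : cycleTypeOn (S.map e) τ = cycleTypeOn S σ := by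
  rw [eq_cycleTypeOn_iff hS']
  intro a
  rw [mul_cycleTypeOn hS, cycleCard_eq_sum, cycleCard_eq_sum, Finset.sum_map]
  exact Finset.sum_congr rfl fun x hx => by rw [cycleLen_apply_of_semiconj hS h hx]

lemma cycleTypeOn_congr {S : Finset α} (hS : ∀ x, σ x ∈ S ↔ x ∈ S) {τ : Perm α}
    (h : ∀ x ∈ S, τ x = σ x) (hS' : ∀ x, τ x ∈ S ↔ x ∈ S) : cycleTypeOn S τ = cycleTypeOn S σ := by
  have := cycleTypeOn_map (τ := τ) (e := Function.Embedding.refl α) hS (by simpa using hS') h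
  rwa [Finset.map_refl] at this

lemma cycleTypeOn_union {S T : Finset α} [DecidableEq α] (hS : ∀ x, σ x ∈ S ↔ x ∈ S)
    (hT : ∀ x, σ x ∈ T ↔ x ∈ T) (hd : Disjoint S T) :
    cycleTypeOn (S ∪ T) σ = cycleTypeOn S σ + cycleTypeOn T σ := by
  rw [eq_cycleTypeOn_iff fun x => by rw [Finset.mem_union, Finset.mem_union, hS, hT]]
  intro a
  rw [Finsupp.add_apply, mul_add, mul_cycleTypeOn hS, mul_cycleTypeOn hT, cycleCard_eq_sum,
    cycleCard_eq_sum, cycleCard_eq_sum, Finset.sum_union hd]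

lemma cycleTypeOn_pos {S : Finset α} (hS : ∀ x, σ x ∈ S ↔ x ∈ S) {x : α} (hx : x ∈ S) :
    1 ≤ cycleTypeOn S σ (cycleLen σ x) := by
  by_contra h
  have h1 := mul_cycleTypeOn hS (cycleLen σ x)
  rw [show cycleTypeOn S σ (cycleLen σ x) = 0 by omega, mul_zero] at h1
  have h2 : 0 < cycleCard S σ (cycleLen σ x) :=
    Finset.card_pos.2 ⟨x, Finset.mem_filter.2 ⟨hx, rfl⟩⟩
  omega

section swap

variable [DecidableEq α]

/-- Before step `k` the orbit meets neither `x` again nor `(σ ^ k) x`, so the transposition does not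
act. At step `k` it sends the orbit back to `x`. -/
lemma cut_pow {x : α} {k : ℕ} (hk' : k < cycleLen σ x) {t : ℕ} (ht : t < k) :
    ((Equiv.swap x ((σ ^ k) x) * σ) ^ t) x = (σ ^ t) x := by
  induction t with
  | zero => rfl
  | succ t ih =>
    rw [pow_succ', Perm.mul_apply, ih (by omega), Perm.mul_apply, ← Perm.mul_apply σ, ← pow_succ',
      Equiv.swap_apply_of_ne_of_ne]
    · intro h
      have := pow_apply_inj (l := 0) (by omega) (by omega) h
      omega
    · intro h
      have := pow_apply_inj (by omega) (by omega) h
      omega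

lemma cut_cycleLen {x : α} {k : ℕ} (hk : 0 < k) (hk' : k < cycleLen σ x) :
    (cycleLen (Equiv.swap x ((σ ^ k) x) * σ) x : ℕ) = k := by
  refine cycleLen_eq hk ?_ fun s h1 h2 h => ?_
  · obtain ⟨l, rfl⟩ := Nat.exists_eq_succ_of_ne_zero hk.ne'
    rw [Nat.succ_eq_add_one] at *
    rw [pow_succ', Perm.mul_apply, cut_pow hk' (by omega), Perm.mul_apply, ← Perm.mul_apply σ,
      ← pow_succ', Equiv.swap_apply_right]
  · rw [cut_pow hk' h2] at h
    have := pow_apply_inj (l := 0) (by omega) (by omega) h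
    omega

lemma cycleLen_swap_mul_of_not_sameCycle {x y z : α} (hx : ¬ σ.SameCycle x z)
    (hy : ¬ σ.SameCycle y z) : cycleLen (Equiv.swap x y * σ) z = cycleLen σ z := by
  have h1 : ∀ n, ((Equiv.swap x y * σ) ^ n) z = (σ ^ n) z := by
    intro n
    induction n with
    | zero => rfl
    | succ n ih =>
      rw [pow_succ', Perm.mul_apply, ih, Perm.mul_apply, ← Perm.mul_apply σ, ← pow_succ',
        Equiv.swap_apply_of_ne_of_ne]
      · intro h; exact hx (h ▸ sameCycle_pow z (n + 1)).symm
      · intro h; exact hy (h ▸ sameCycle_pow z (n + 1)).symm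
  exact cycleLen_congr fun n => by rw [h1]

lemma sum_single_mul (a n : ℕ+) : (a : ℕ) * Finsupp.single n 1 a = if n = a then (n : ℕ) else 0 := by
  rw [Finsupp.single_apply]
  split_ifs with h
  · rw [h, mul_one]
  · rw [mul_zero]

/-- Multiplication by a transposition of two points of one cycle cuts the cycle. -/
lemma cycleTypeOn_cut {S : Finset α} (hS : ∀ x, σ x ∈ S ↔ x ∈ S) {x : α} (hx : x ∈ S) {i j : ℕ+}
    (hij : cycleLen σ x = i + j) :
    cycleTypeOn S (Equiv.swap x ((σ ^ (i : ℕ)) x) * σ) + Finsupp.single (i + j) 1 =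
      cycleTypeOn S σ + Finsupp.single i 1 + Finsupp.single j 1 := by
  classical
  set y := (σ ^ (i : ℕ)) x with hy
  set τ := Equiv.swap x y * σ with hτ
  have hyS : y ∈ S := (pow_mem_iff hS _ _).2 hx
  have hτS : ∀ z, τ z ∈ S ↔ z ∈ S := swap_mul_mem_iff hS hx hyS
  have hxy : σ.SameCycle x y := sameCycle_pow x i
  have hn : (cycleLen σ x : ℕ) = i + j := by rw [hij]; rfl
  have hi : (i : ℕ) < cycleLen σ x := by have := j.pos; omega
  have hleny : cycleLen σ y = i + j := by rw [← hij, cycleLen_eq_of_sameCycle hxy]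
  have hj : (j : ℕ) < cycleLen σ y := by rw [hleny, PNat.add_coe]; have := i.pos; omega
  have hyx : (σ ^ (j : ℕ)) y = x := by
    rw [hy, ← Perm.mul_apply, ← pow_add, add_comm, ← hn, pow_cycleLen]
  -- The situation is symmetric: seen from `y`, the point `x` lies `j` steps ahead, so the same
  -- argument gives the length of the cycle through `y`.
  have hτ' : τ = Equiv.swap y ((σ ^ (j : ℕ)) y) * σ := by rw [hyx, Equiv.swap_comm]
  have hlx : cycleLen τ x = i := PNat.eq (cut_cycleLen i.pos hi)
  have hly : cycleLen τ y = j := PNat.eq (by rw [hτ']; exact cut_cycleLen j.pos hj)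
  -- Points off the cycle keep their cycle length. Of the `i + j` points on it, the first `i` pass
  -- to a cycle of length `i` and the others to one of length `j`.
  have key : ∀ (a : ℕ+), cycleCard S τ a + (if i + j = a then ((i + j : ℕ+) : ℕ) else 0) =
      cycleCard S σ a + (if i = a then (i : ℕ) else 0) + if j = a then (j : ℕ) else 0 := by
    intro a
    rw [cycleCard_eq_sum, cycleCard_eq_sum, ← Finset.sum_filter_add_sum_filter_not S (σ.SameCycle x),
      ← Finset.sum_filter_add_sum_filter_not S (σ.SameCycle x) fun z => if cycleLen σ z = a then 1 else 0]
    have h1 : ∑ z ∈ S with ¬ σ.SameCycle x z, (if cycleLen τ z = a then 1 else 0) =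
        ∑ z ∈ S with ¬ σ.SameCycle x z, (if cycleLen σ z = a then 1 else 0) := by
      refine Finset.sum_congr rfl fun z hz => ?_
      have hz' := (Finset.mem_filter.1 hz).2
      rw [cycleLen_swap_mul_of_not_sameCycle hz' fun h => hz' (hxy.trans h)]
    rw [h1, sum_cycle hS hx, sum_cycle hS hx, hn, Finset.sum_range_add]
    have h2 : ∀ t, cycleLen σ ((σ ^ t) x) = i + j := fun t => by
      rw [← cycleLen_eq_of_sameCycle (sameCycle_pow x t), hij]
    have h3 : ∀ t ∈ Finset.range i, (if cycleLen τ ((σ ^ t) x) = a then 1 else 0) =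
        if i = a then 1 else 0 := by
      intro t ht
      rw [← cut_pow hi (Finset.mem_range.1 ht), ← cycleLen_eq_of_sameCycle (sameCycle_pow x t), hlx]
    have h4 : ∀ t ∈ Finset.range j, (if cycleLen τ ((σ ^ ((i : ℕ) + t)) x) = a then 1 else 0) =
        if j = a then 1 else 0 := by
      intro t ht
      have h5 := cut_pow hj (Finset.mem_range.1 ht)
      rw [← hτ'] at h5
      rw [add_comm, pow_add, Perm.mul_apply, ← hy, ← h5,
        ← cycleLen_eq_of_sameCycle (sameCycle_pow y t), hly]
    rw [Finset.sum_congr rfl h3, Finset.sum_congr rfl h4]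
    simp only [h2, Finset.sum_const, Finset.card_range, smul_eq_mul, PNat.add_coe]
    split_ifs <;> ring
  ext a
  apply Nat.eq_of_mul_eq_mul_left a.pos
  simp only [Finsupp.add_apply, mul_add, mul_cycleTypeOn hS, mul_cycleTypeOn hτS, sum_single_mul]
  exact key a

/-- Multiplication by a transposition of points on two cycles joins these cycles. -/
lemma cycleTypeOn_join {S : Finset α} (hS : ∀ x, σ x ∈ S ↔ x ∈ S) {x y : α} (hx : x ∈ S) (hy : y ∈ S)
    (hxy : ¬ σ.SameCycle x y) :
    cycleTypeOn S (Equiv.swap x y * σ) + Finsupp.single (cycleLen σ x) 1 +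
        Finsupp.single (cycleLen σ y) 1 =
      cycleTypeOn S σ + Finsupp.single (cycleLen σ x + cycleLen σ y) 1 := by
  have hpow : ∀ {x y : α}, ¬ σ.SameCycle x y → ∀ t < (cycleLen σ x : ℕ),
      ((Equiv.swap x y * σ) ^ t) x = (σ ^ t) x := by
    intro x y hxy t ht
    induction t with
    | zero => rfl
    | succ t ih =>
      rw [pow_succ', Perm.mul_apply, ih (by omega), Perm.mul_apply, ← Perm.mul_apply σ, ← pow_succ',
        Equiv.swap_apply_of_ne_of_ne]
      · intro h
        have := pow_apply_inj (l := 0) ht (by omega) h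
        omega
      · intro h; exact hxy (h ▸ sameCycle_pow x (t + 1))
  have hlast : ∀ {x y : α}, ¬ σ.SameCycle x y →
      ((Equiv.swap x y * σ) ^ (cycleLen σ x : ℕ)) x = y := by
    intro x y hxy
    obtain ⟨l, hl⟩ := Nat.exists_eq_succ_of_ne_zero (cycleLen σ x).pos.ne'
    rw [hl, Nat.succ_eq_add_one, pow_succ', Perm.mul_apply, hpow hxy l (by omega), Perm.mul_apply,
      ← Perm.mul_apply σ, ← pow_succ', ← Nat.succ_eq_add_one, ← hl, pow_cycleLen, Equiv.swap_apply_left]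
  have hyx : ¬ σ.SameCycle y x := fun h => hxy h.symm
  set τ := Equiv.swap x y * σ with hτ
  have hτ' : τ = Equiv.swap y x * σ := by rw [Equiv.swap_comm]
  have h1 : (τ ^ (cycleLen σ x : ℕ)) x = y := hlast hxy
  have h2 : ∀ t < (cycleLen σ y : ℕ), (τ ^ t) y = (σ ^ t) y := by rw [hτ']; exact hpow hyx
  have h3 : (τ ^ (cycleLen σ y : ℕ)) y = x := by rw [hτ']; exact hlast hyx
  have hlen : cycleLen τ x = cycleLen σ x + cycleLen σ y := by
    apply PNat.eq
    refine cycleLen_eq (PNat.pos _) ?_ fun s hs hs' h => ?_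
    · rw [PNat.add_coe, add_comm, pow_add, Perm.mul_apply, h1, h3]
    · rw [PNat.add_coe] at hs'
      by_cases hsx : s < (cycleLen σ x : ℕ)
      · rw [hpow hxy s hsx] at h
        have := pow_apply_inj (l := 0) hsx (by omega) h
        omega
      · obtain ⟨t, rfl⟩ := Nat.exists_eq_add_of_le (not_lt.1 hsx)
        rw [add_comm, pow_add, Perm.mul_apply, h1, h2 t (by omega)] at h
        exact hyx (h ▸ sameCycle_pow y t)
  -- The same transposition undoes the join by cutting the long cycle again, so the identity is the
  -- cutting formula for `τ`.
  have h5 := cycleTypeOn_cut (swap_mul_mem_iff hS hx hy) hx hlen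
  rw [h1, ← mul_assoc, Equiv.swap_mul_self, one_mul] at h5
  exact h5.symm

end swap

end

end Hurwitz

end

/-! ### Cycle types of the products with all transpositions -/

noncomputable section

namespace Hurwitz

open Equiv (Perm)

section

variable {α : Type} [Finite α] {σ : Perm α} {S : Finset α}

lemma cycleLen_le_card (hS : ∀ x, σ x ∈ S ↔ x ∈ S) {x : α} (hx : x ∈ S) :
    (cycleLen σ x : ℕ) ≤ S.card := by
  classical
  rw [← card_cycle hS hx]
  exact Finset.card_filter_le _ _

/-- A step `t` with `0 < t < n` around a cycle is the same as a decomposition `n = i + j` with `i =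
t`. The set `I` only has to contain all numbers up to `n`. -/
lemma sum_range_eq_sum_pairs {I : Finset ℕ+} {n : ℕ+} (hI : ∀ a : ℕ+, a ≤ n → a ∈ I) (G : ℕ → ℕ) :
    ∑ t ∈ Finset.range n, (if t = 0 then 0 else G t) =
      ∑ i ∈ I, ∑ j ∈ I, if n = i + j then G i else 0 := by
  have h1 : ∀ t, (if t = 0 then 0 else G t) = if t ≠ 0 then G t else 0 := fun t => by
    split_ifs <;> simp_all
  rw [← Finset.sum_product', ← Finset.sum_filter, Finset.sum_congr rfl fun t _ => h1 t,
    ← Finset.sum_filter]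
  symm
  refine Finset.sum_nbij (fun p => (p.1 : ℕ)) ?_ ?_ ?_ fun _ _ => rfl
  · rintro ⟨i, j⟩ h
    simp only [Finset.mem_filter, Finset.mem_product] at h
    simp only [Finset.mem_filter, Finset.mem_range]
    refine ⟨?_, i.pos.ne'⟩
    rw [h.2, PNat.add_coe]
    exact Nat.lt_add_of_pos_right j.pos
  · rintro ⟨i, j⟩ h ⟨i', j'⟩ h' hii
    simp only [Finset.coe_filter, Finset.mem_product, Set.mem_ofPred_eq] at h h'
    obtain rfl : i = i' := PNat.eq hii
    have := h.2.symm.trans h'.2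
    rw [add_right_inj] at this
    rw [this]
  · intro t ht
    simp only [Finset.coe_filter, Finset.mem_range, Set.mem_ofPred_eq] at ht
    obtain ⟨i, rfl⟩ : ∃ i : ℕ+, (i : ℕ) = t := ⟨⟨t, Nat.pos_of_ne_zero ht.2⟩, rfl⟩
    obtain ⟨j, hj⟩ : ∃ j : ℕ+, (j : ℕ) = n - i := ⟨⟨n - i, by omega⟩, rfl⟩
    refine ⟨(i, j), ?_, rfl⟩
    simp only [Finset.coe_filter, Finset.mem_product, Set.mem_ofPred_eq]
    refine ⟨⟨hI _ ((PNat.coe_le_coe _ _).1 (by omega)), hI _ ((PNat.coe_le_coe _ _).1 (by omega))⟩,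
      PNat.eq ?_⟩
    rw [PNat.add_coe]
    omega

/-- The cycle types of the products of a permutation with all transpositions. -/
lemma sum_swap_mul [DecidableEq α] (hS : ∀ x, σ x ∈ S ↔ x ∈ S) {I : Finset ℕ+}
    (hI : ∀ a : ℕ+, (a : ℕ) ≤ S.card → a ∈ I) (m : ℕ+ →₀ ℕ) :
    (∑ p ∈ S.offDiag, if cycleTypeOn S (Equiv.swap p.1 p.2 * σ) = m then 1 else 0) =
      ∑ i ∈ I, ∑ j ∈ I,
        ((if m + Finsupp.single i 1 + Finsupp.single j 1 =
            cycleTypeOn S σ + Finsupp.single (i + j) 1 then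
          (i * cycleTypeOn S σ i) * (j * cycleTypeOn S σ j - if i = j then (i : ℕ) else 0) else 0) +
        if m + Finsupp.single (i + j) 1 =
            cycleTypeOn S σ + Finsupp.single i 1 + Finsupp.single j 1 then
          ((i : ℕ) + j) * cycleTypeOn S σ (i + j) else 0) := by
  classical
  have hmem : ∀ x ∈ S, cycleLen σ x ∈ I := fun x hx => hI _ (cycleLen_le_card hS hx)
  -- The points on cycles of length `j` other than the cycle of `x` are all points on such cycles,
  -- less the cycle of `x` itself if it has length `j`.
  have hcount : ∀ x ∈ S, ∀ j, (∑ y ∈ S, if ¬ σ.SameCycle x y then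
      (if cycleLen σ y = j then 1 else 0) else 0) =
      cycleCard S σ j - if cycleLen σ x = j then (cycleLen σ x : ℕ) else 0 := by
    intro x hx j
    rw [cycleCard_eq_sum, ← Finset.sum_filter,
      ← Finset.sum_filter_add_sum_filter_not S (σ.SameCycle x) fun z => if cycleLen σ z = j then 1 else 0,
      sum_cycle hS hx]
    simp_rw [← cycleLen_eq_of_sameCycle (sameCycle_pow (σ := σ) x _)]
    split_ifs <;> simp
  rw [← Finset.sum_filter_add_sum_filter_not _ fun p : α × α => ¬ σ.SameCycle p.1 p.2]
  -- Pairs on different cycles join them.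
  have hd : ∑ p ∈ S.offDiag with ¬ σ.SameCycle p.1 p.2,
      (if cycleTypeOn S (Equiv.swap p.1 p.2 * σ) = m then 1 else 0) =
      ∑ i ∈ I, ∑ j ∈ I, (if m + Finsupp.single i 1 + Finsupp.single j 1 =
            cycleTypeOn S σ + Finsupp.single (i + j) 1 then
          (i * cycleTypeOn S σ i) * (j * cycleTypeOn S σ j - if i = j then (i : ℕ) else 0) else 0) := by
    have e1 : S.offDiag.filter (fun p => ¬ σ.SameCycle p.1 p.2) =
        (S ×ˢ S).filter fun p => ¬ σ.SameCycle p.1 p.2 := by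
      ext ⟨x, y⟩
      simp only [Finset.mem_filter, Finset.mem_offDiag, Finset.mem_product]
      constructor
      · rintro ⟨⟨h1, h2, h3⟩, h4⟩; exact ⟨⟨h1, h2⟩, h4⟩
      · rintro ⟨⟨h1, h2⟩, h4⟩
        exact ⟨⟨h1, h2, fun h => h4 (h ▸ Perm.SameCycle.refl _ _)⟩, h4⟩
    rw [e1, Finset.sum_filter, Finset.sum_product]
    have e2 : ∀ x ∈ S, ∀ y ∈ S, (if ¬ σ.SameCycle x y then
        (if cycleTypeOn S (Equiv.swap x y * σ) = m then 1 else 0) else 0) =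
        ∑ i ∈ I, ∑ j ∈ I, if m + Finsupp.single i 1 + Finsupp.single j 1 =
            cycleTypeOn S σ + Finsupp.single (i + j) 1 then
          ((if cycleLen σ x = i then 1 else 0) *
            if ¬ σ.SameCycle x y then (if cycleLen σ y = j then 1 else 0) else 0) else 0 := by
      intro x hx y hy
      by_cases hxy : σ.SameCycle x y
      · simp [hxy]
      · simp only [hxy, not_false_eq_true, if_true]
        have h1 := cycleTypeOn_join hS hx hy hxy
        rw [Finset.sum_eq_single (cycleLen σ x), Finset.sum_eq_single (cycleLen σ y)]
        · simp only [if_true, mul_one]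
          refine if_congr ?_ rfl rfl
          rw [← h1, add_assoc, add_assoc, add_left_inj]
          exact eq_comm
        · intro j _ hj; simp [hj.symm]
        · exact fun h => absurd (hmem y hy) h
        · intro i _ hi; simp [hi.symm]
        · exact fun h => absurd (hmem x hx) h
    rw [Finset.sum_congr rfl fun x hx => Finset.sum_congr rfl fun y hy => e2 x hx y hy]
    simp_rw [Finset.sum_comm (s := S) (t := I)]
    refine Finset.sum_congr rfl fun i _ => Finset.sum_congr rfl fun j _ => ?_
    by_cases hc : m + Finsupp.single i 1 + Finsupp.single j 1 =
        cycleTypeOn S σ + Finsupp.single (i + j) 1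
    swap
    · simp only [if_neg hc, Finset.sum_const_zero]
    · simp only [if_pos hc]
      simp_rw [← Finset.mul_sum]
      rw [mul_cycleTypeOn hS, mul_cycleTypeOn hS, cycleCard_eq_sum, Finset.sum_mul]
      refine Finset.sum_congr rfl fun x hx => ?_
      rw [hcount x hx]
      by_cases hi : cycleLen σ x = i
      · subst hi
        simp
      · simp [hi]
  -- Pairs on one cycle cut it: each point of a cycle of length `i + j` has exactly one partner `i`
  -- steps ahead.
  have hs : ∑ p ∈ S.offDiag with ¬¬ σ.SameCycle p.1 p.2,
      (if cycleTypeOn S (Equiv.swap p.1 p.2 * σ) = m then 1 else 0) =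
      ∑ i ∈ I, ∑ j ∈ I, if m + Finsupp.single (i + j) 1 =
            cycleTypeOn S σ + Finsupp.single i 1 + Finsupp.single j 1 then
          ((i : ℕ) + j) * cycleTypeOn S σ (i + j) else 0 := by
    have e1 : S.offDiag.filter (fun p => ¬¬ σ.SameCycle p.1 p.2) =
        (S ×ˢ S).filter fun p => σ.SameCycle p.1 p.2 ∧ p.2 ≠ p.1 := by
      ext ⟨x, y⟩
      simp only [Finset.mem_filter, Finset.mem_offDiag, Finset.mem_product, not_not]
      constructor
      · rintro ⟨⟨h1, h2, h3⟩, h4⟩; exact ⟨⟨h1, h2⟩, h4, Ne.symm h3⟩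
      · rintro ⟨⟨h1, h2⟩, h4, h5⟩; exact ⟨⟨h1, h2, Ne.symm h5⟩, h4⟩
    rw [e1, Finset.sum_filter, Finset.sum_product]
    have e2 : ∀ x ∈ S, ∑ y ∈ S, (if σ.SameCycle x y ∧ y ≠ x then
        (if cycleTypeOn S (Equiv.swap x y * σ) = m then 1 else 0) else 0) =
        ∑ i ∈ I, ∑ j ∈ I, if cycleLen σ x = i + j then (if m + Finsupp.single (i + j) 1 =
            cycleTypeOn S σ + Finsupp.single i 1 + Finsupp.single j 1 then 1 else 0) else 0 := by
      intro x hx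
      simp_rw [ite_and]
      rw [← Finset.sum_filter, sum_cycle hS hx]
      have h1 : ∀ t ∈ Finset.range (cycleLen σ x), (if (σ ^ t) x ≠ x then
          (if cycleTypeOn S (Equiv.swap x ((σ ^ t) x) * σ) = m then 1 else 0) else 0) =
          if t = 0 then 0 else
            (if cycleTypeOn S (Equiv.swap x ((σ ^ t) x) * σ) = m then 1 else 0) := by
        intro t ht
        by_cases h0 : t = 0
        · simp [h0]
        · rw [if_neg h0, if_pos]
          intro h
          have := Nat.le_of_dvd (Nat.pos_of_ne_zero h0) (pow_apply_eq_self_iff.1 h)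
          have := Finset.mem_range.1 ht
          omega
      rw [Finset.sum_congr rfl h1, sum_range_eq_sum_pairs
        (fun a ha => hI a ((PNat.coe_le_coe _ _ |>.2 ha).trans (cycleLen_le_card hS hx)))
        fun t => if cycleTypeOn S (Equiv.swap x ((σ ^ t) x) * σ) = m then 1 else 0]
      refine Finset.sum_congr rfl fun i _ => Finset.sum_congr rfl fun j _ => ?_
      split_ifs with h1 h2 h3 h3 <;> try rfl
      · exact absurd (h2 ▸ cycleTypeOn_cut hS hx h1) h3
      · have := cycleTypeOn_cut hS hx h1
        rw [← h3, add_left_inj] at this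
        exact absurd this h2
    rw [Finset.sum_congr rfl e2]
    simp_rw [Finset.sum_comm (s := S) (t := I)]
    refine Finset.sum_congr rfl fun i _ => Finset.sum_congr rfl fun j _ => ?_
    split_ifs with hc
    · rw [← PNat.add_coe, mul_cycleTypeOn hS, cycleCard_eq_sum]
    · simp
  rw [hd, hs]
  simp_rw [Finset.sum_add_distrib]

end

/-! ### Words -/

section words

variable {A B : Type}

/-- The words of given length in a finite alphabet. -/
def words (P : Finset A) : ℕ → Finset (List A)
  | 0 => {[]}
  | r + 1 => (P ×ˢ words P r).map ⟨fun a => a.1 :: a.2, fun a b h => by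
      rw [List.cons.injEq] at h
      exact Prod.ext h.1 h.2⟩

lemma sum_words_succ {M : Type} [AddCommMonoid M] (P : Finset A) (r : ℕ) (F : List A → M) :
    ∑ w ∈ words P (r + 1), F w = ∑ a ∈ P, ∑ w ∈ words P r, F (a :: w) := by
  rw [words, Finset.sum_map, Finset.sum_product]
  rfl

lemma mem_words {P : Finset A} {r : ℕ} {w : List A} :
    w ∈ words P r ↔ w.length = r ∧ ∀ a ∈ w, a ∈ P := by
  induction r generalizing w with
  | zero =>
    simp only [words, Finset.mem_singleton, List.length_eq_zero_iff]
    constructor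
    · rintro rfl; simp
    · exact fun h => h.1
  | succ r ih =>
    simp only [words, Finset.mem_map, Finset.mem_product, Prod.exists]
    constructor
    · rintro ⟨a, w, ⟨ha, hw⟩, rfl⟩
      rw [ih] at hw
      change (a :: w).length = r + 1 ∧ ∀ c ∈ a :: w, c ∈ P
      simpa [hw.1, ha] using hw.2
    · intro h
      match w, h with
      | a :: w, h =>
        rw [List.length_cons, add_left_inj] at h
        exact ⟨a, w, ⟨h.2 a (by simp), ih.2 ⟨h.1, fun b hb => h.2 b (by simp [hb])⟩⟩, rfl⟩

lemma sum_words_map {M : Type} [AddCommMonoid M] (P : Finset A) (f : A ↪ B) (r : ℕ)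
    (F : List B → M) : ∑ w ∈ words (P.map f) r, F w = ∑ w ∈ words P r, F (w.map f) := by
  induction r generalizing F with
  | zero => simp [words]
  | succ r ih => rw [sum_words_succ, sum_words_succ, Finset.sum_map]; simp_rw [ih]; rfl

/-- Words over the union of two disjoint alphabets are shuffles. -/
lemma sum_words_shuffle [DecidableEq A] {P P₁ P₂ : Finset A} (h1 : P₁ ⊆ P) (h2 : P₂ ⊆ P)
    (hd : Disjoint P₁ P₂) (r : ℕ) (F₁ F₂ : List A → ℕ) :
    (∑ w ∈ words P r, if ∀ a ∈ w, a ∈ P₁ ∪ P₂ then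
      F₁ (w.filter (· ∈ P₁)) * F₂ (w.filter (· ∈ P₂)) else 0) =
    ∑ q ∈ Finset.HasAntidiagonal.antidiagonal r, r.choose q.1 *
      ((∑ w ∈ words P₁ q.1, F₁ w) * ∑ w ∈ words P₂ q.2, F₂ w) := by
  induction r generalizing F₁ F₂ with
  | zero => simp [words]
  | succ r ih =>
    have e1 : ∀ a ∈ P₁, (∑ w ∈ words P r, if ∀ c ∈ a :: w, c ∈ P₁ ∪ P₂ then
        F₁ ((a :: w).filter (· ∈ P₁)) * F₂ ((a :: w).filter (· ∈ P₂)) else 0) =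
        ∑ q ∈ Finset.HasAntidiagonal.antidiagonal r, r.choose q.1 *
          ((∑ w ∈ words P₁ q.1, F₁ (a :: w)) * ∑ w ∈ words P₂ q.2, F₂ w) := by
      intro a ha
      rw [← ih (fun w => F₁ (a :: w)) F₂]
      have ha2 : a ∉ P₂ := Finset.disjoint_left.1 hd ha
      refine Finset.sum_congr rfl fun w _ => ?_
      simp [ha, ha2]
    have e2 : ∀ a ∈ P₂, (∑ w ∈ words P r, if ∀ c ∈ a :: w, c ∈ P₁ ∪ P₂ then
        F₁ ((a :: w).filter (· ∈ P₁)) * F₂ ((a :: w).filter (· ∈ P₂)) else 0) =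
        ∑ q ∈ Finset.HasAntidiagonal.antidiagonal r, r.choose q.1 *
          ((∑ w ∈ words P₁ q.1, F₁ w) * ∑ w ∈ words P₂ q.2, F₂ (a :: w)) := by
      intro a ha
      rw [← ih F₁ fun w => F₂ (a :: w)]
      have ha2 : a ∉ P₁ := Finset.disjoint_right.1 hd ha
      refine Finset.sum_congr rfl fun w _ => ?_
      simp [ha, ha2]
    rw [sum_words_succ, ← Finset.sum_subset (Finset.union_subset h1 h2), Finset.sum_union hd,
      Finset.sum_congr rfl e1, Finset.sum_congr rfl e2, Finset.sum_comm,
      Finset.sum_comm (s := P₂)]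
    -- Pascal's rule corresponds to the choice of the alphabet from which the first letter is taken.
    · have h3 := Finset.sum_antidiagonal_choose_succ_mul
        (fun k l => (∑ w ∈ words P₁ k, F₁ w) * ∑ w ∈ words P₂ l, F₂ w) r
      simp only [Nat.cast_id] at h3
      rw [h3, add_comm]
      congr 1
      · refine Finset.sum_congr rfl fun q _ => ?_
        rw [sum_words_succ, Finset.mul_sum, Finset.mul_sum]
      · refine Finset.sum_congr rfl fun q hq => ?_
        rw [sum_words_succ, Finset.sum_mul, Finset.mul_sum, ← Finset.HasAntidiagonal.mem_antidiagonal.1 hq,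
          Nat.choose_symm_add]
    · intro a _ ha
      refine Finset.sum_eq_zero fun w _ => if_neg fun h => ha (h a (by simp))

end words

end Hurwitz

end

noncomputable section

namespace Hurwitz

open Equiv (Perm)

/-! ### Transitive words of transpositions -/

section

variable {α β : Type}

/-- `K` is a union of connected components of the graph whose edges are the letters of `w`. -/
def IsClosedUnder (w : List (α × α)) (K : Finset α) : Prop := ∀ p ∈ w, p.1 ∈ K ↔ p.2 ∈ K

/-- The letters of `w` are the edges of a graph which connects `S`. -/
def IsTransOn (S : Finset α) (w : List (α × α)) : Prop :=
  S.Nonempty ∧ ∀ K ⊆ S, IsClosedUnder w K → K = ∅ ∨ K = S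

lemma isClosedUnder_cons {p : α × α} {w : List (α × α)} {K : Finset α} :
    IsClosedUnder (p :: w) K ↔ (p.1 ∈ K ↔ p.2 ∈ K) ∧ IsClosedUnder w K := by
  simp [IsClosedUnder]

lemma IsClosedUnder.of_mem_words [DecidableEq α] {S : Finset α} {r : ℕ} {w : List (α × α)}
    (hw : w ∈ words S.offDiag r) : IsClosedUnder w S := fun p hp => by
  have := Finset.mem_offDiag.1 ((mem_words.1 hw).2 p hp)
  simp [this.1, this.2.1]

variable [DecidableEq α] [DecidableEq β]

/-- The product of the transpositions `(x y)` for the letters `(x, y)` of a word. -/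
def wordPerm (w : List (α × α)) : Perm α := (w.map fun p => Equiv.swap p.1 p.2).prod

@[simp] lemma wordPerm_cons (p : α × α) (w : List (α × α)) :
    wordPerm (p :: w) = Equiv.swap p.1 p.2 * wordPerm w := by simp [wordPerm]

lemma swap_apply_mem_iff {K : Finset α} {x y : α} (h : x ∈ K ↔ y ∈ K) (z : α) :
    Equiv.swap x y z ∈ K ↔ z ∈ K := by
  rw [Equiv.swap_apply_def]
  split_ifs with h1 h2
  · rw [h1, h]
  · rw [h2, h]
  · rfl

lemma wordPerm_mem_iff {w : List (α × α)} {K : Finset α} (h : IsClosedUnder w K) (z : α) :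
    wordPerm w z ∈ K ↔ z ∈ K := by
  induction w with
  | nil => rfl
  | cons p w ih =>
    rw [isClosedUnder_cons] at h
    rw [wordPerm_cons, Perm.mul_apply, swap_apply_mem_iff h.1, ih h.2]

lemma IsClosedUnder.sdiff {U K : Finset α} {w : List (α × α)} (hU : IsClosedUnder w U)
    (hK : IsClosedUnder w K) : IsClosedUnder w (U \ K) := fun p hp => by
  rw [Finset.mem_sdiff, Finset.mem_sdiff, hU p hp, hK p hp]

lemma IsClosedUnder.inter {U K : Finset α} {w : List (α × α)} (hU : IsClosedUnder w U)
    (hK : IsClosedUnder w K) : IsClosedUnder w (U ∩ K) := fun p hp => by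
  rw [Finset.mem_inter, Finset.mem_inter, hU p hp, hK p hp]

lemma IsTransOn.cons {S : Finset α} {w : List (α × α)} (h : IsTransOn S w) (p : α × α) :
    IsTransOn S (p :: w) := ⟨h.1, fun K hK hc => h.2 K hK (isClosedUnder_cons.1 hc).2⟩

/-- `S` and its complement in `U` are connected by `w`, and `p` leads from `S` to the complement. -/
def IsSplit (U : Finset α) (p : α × α) (w : List (α × α)) (S : Finset α) : Prop :=
  (p.1 ∈ S ∧ p.2 ∈ U \ S) ∧ IsClosedUnder w S ∧ IsTransOn S w ∧ IsTransOn (U \ S) w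

variable {U : Finset α} {p : α × α} {w : List (α × α)}

/-- The intersection `S ∩ S'` is closed under `w` and contains `p.1`, so connectedness of `S` makes
it all of `S`. -/
lemma IsSplit.unique {S S' : Finset α} (h : IsSplit U p w S) (h' : IsSplit U p w S') : S ⊆ S' := by
  rcases h.2.2.1.2 (S ∩ S') Finset.inter_subset_left (h.2.1.inter h'.2.1) with h1 | h1
  · exact absurd (h1 ▸ Finset.mem_inter.2 ⟨h.1.1, h'.1.1⟩) (Finset.notMem_empty _)
  · exact Finset.inter_eq_left.1 h1

/-- A closed set contains all or nothing of each of the two blocks, and the letter `p` forces the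
same choice for both. -/
lemma IsSplit.isTransOn_cons {S : Finset α} (hS : S ⊆ U) (h : IsSplit U p w S) :
    IsTransOn U (p :: w) := by
  obtain ⟨⟨hx, hy⟩, hc, h1, h2⟩ := h
  refine ⟨h1.1.mono hS, fun K hK hKc => ?_⟩
  obtain ⟨hp, hKc⟩ := isClosedUnder_cons.1 hKc
  have e1 := h1.2 (S ∩ K) Finset.inter_subset_left (hc.inter hKc)
  have e2 := h2.2 (K \ S) (Finset.sdiff_subset_sdiff hK le_rfl) (hKc.sdiff hc)
  have hKe : K = S ∩ K ∪ K \ S := by rw [Finset.inter_comm, Finset.union_comm, Finset.sdiff_union_inter]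
  rcases e1 with e1 | e1 <;> rcases e2 with e2 | e2
  · left; rw [hKe, e1, e2]; rfl
  · have h3 : p.2 ∈ K := (Finset.mem_sdiff.1 (e2.symm ▸ hy)).1
    exact absurd (e1 ▸ Finset.mem_inter.2 ⟨hx, hp.2 h3⟩) (Finset.notMem_empty _)
  · have h3 : p.1 ∈ K := (Finset.mem_inter.1 (e1.symm ▸ hx)).2
    exact absurd (e2 ▸ Finset.mem_sdiff.2 ⟨hp.1 h3, (Finset.mem_sdiff.1 hy).2⟩) (Finset.notMem_empty _)
  · right; rw [hKe, e1, e2, Finset.union_sdiff_of_subset hS]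

/-- A subset closed under `w` that avoids both ends of `p` is closed under `p :: w`, hence empty.
This is applied to a closed subset of a block, or to its complement in the block if the subset
contains the end of `p`. -/
lemma isSplit_of_isTransOn_cons {S : Finset α} (hS : S ⊆ U) (hU : IsClosedUnder w U)
    (ht : IsTransOn U (p :: w)) (hx : p.1 ∈ S) (hy : p.2 ∈ U \ S) (hc : IsClosedUnder w S) :
    IsSplit U p w S := by
  have hy' := Finset.mem_sdiff.1 hy
  have key : ∀ K ⊆ U, IsClosedUnder w K → p.1 ∉ K → p.2 ∉ K → K = ∅ := by
    intro K hK hKc h1 h2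
    refine (ht.2 K hK (isClosedUnder_cons.2 ⟨by simp [h1, h2], hKc⟩)).resolve_right ?_
    rintro rfl
    exact h2 hy'.1
  refine ⟨⟨hx, hy⟩, hc, ⟨⟨_, hx⟩, fun K hK hKc => ?_⟩, ⟨_, hy⟩, fun K hK hKc => ?_⟩
  · by_cases h1 : p.1 ∈ K
    · right
      have := key (S \ K) (Finset.sdiff_subset.trans hS) (hc.sdiff hKc) (by simp [h1])
        (by simp [hy'.2])
      exact hK.antisymm (Finset.sdiff_eq_empty_iff_subset.1 this)
    · exact Or.inl (key K (hK.trans hS) hKc h1 fun h => hy'.2 (hK h))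
  · by_cases h1 : p.2 ∈ K
    · right
      have := key ((U \ S) \ K) (Finset.sdiff_subset.trans Finset.sdiff_subset)
        ((hU.sdiff hc).sdiff hKc) (by simp [hx]) (by simp [h1])
      exact hK.antisymm (Finset.sdiff_eq_empty_iff_subset.1 this)
    · exact Or.inl (key K (hK.trans Finset.sdiff_subset) hKc
        (fun h => (Finset.mem_sdiff.1 (hK h)).2 hx) h1)

-- If `p :: w` is transitive and `w` is not, then `w` has two components, joined by `p`, and the one
-- containing `p.1` is the only split. If `w` is transitive there is no split. The two summands lead
-- to the terms linear and quadratic in the generating function.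
open Classical in
lemma ite_isTransOn_cons (hU : IsClosedUnder w U) (hp : p ∈ U.offDiag) :
    (if IsTransOn U (p :: w) then 1 else 0) = (if IsTransOn U w then 1 else 0) +
      ∑ S ∈ U.powerset, if IsSplit U p w S then 1 else 0 := by
  obtain ⟨hx, hy, -⟩ := Finset.mem_offDiag.1 hp
  by_cases h : IsTransOn U w
  · rw [if_pos h, if_pos (h.cons p), left_eq_add]
    refine Finset.sum_eq_zero ?_
    intro S hS
    refine if_neg ?_
    rintro ⟨⟨h1, h2⟩, h3, -⟩
    rcases h.2 S (Finset.mem_powerset.1 hS) h3 with rfl | rfl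
    · exact Finset.notMem_empty _ h1
    · simp at h2
  rw [if_neg h, zero_add]
  split_ifs with h'
  · obtain ⟨S, hS, hs⟩ : ∃ S ⊆ U, IsSplit U p w S := by
      have h1 : ∃ K ⊆ U, IsClosedUnder w K ∧ K ≠ ∅ ∧ K ≠ U := by
        by_contra hcon
        push Not at hcon
        refine h ⟨⟨_, hx⟩, fun K hK hKc => ?_⟩
        by_cases h0 : K = ∅
        · exact Or.inl h0
        · exact Or.inr (hcon K hK hKc (Finset.nonempty_iff_ne_empty.2 h0))
      obtain ⟨K, hK, hKc, hne, hne'⟩ := h1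
      by_cases h1 : p.1 ∈ K <;> by_cases h2 : p.2 ∈ K
      · rcases h'.2 K hK (isClosedUnder_cons.2 ⟨by simp [h1, h2], hKc⟩) with h3 | h3 <;> contradiction
      · exact ⟨K, hK, isSplit_of_isTransOn_cons hK hU h' h1 (by simp [h2, hy]) hKc⟩
      · exact ⟨U \ K, Finset.sdiff_subset, isSplit_of_isTransOn_cons Finset.sdiff_subset hU h'
          (by simp [h1, hx]) (by simp [h2, hy]) (hU.sdiff hKc)⟩
      · rcases h'.2 K hK (isClosedUnder_cons.2 ⟨by simp [h1, h2], hKc⟩) with h3 | h3 <;> contradiction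
    rw [Finset.sum_eq_single S, if_pos hs]
    · intro S' _ hne
      exact if_neg fun hs' => hne ((hs'.unique hs).antisymm (hs.unique hs'))
    · exact fun hn => absurd (Finset.mem_powerset.2 hS) hn
  · symm
    refine Finset.sum_eq_zero fun S hS => if_neg fun hs => h' ?_
    exact hs.isTransOn_cons (Finset.mem_powerset.1 hS)

lemma isTransOn_filter {S T : Finset α} (hd : Disjoint S T) {w : List (α × α)}
    (hw : ∀ q ∈ w, q ∈ S.offDiag ∪ T.offDiag) :
    IsTransOn S (w.filter (· ∈ S.offDiag)) ↔ IsTransOn S w := by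
  refine and_congr_right fun _ => forall₂_congr fun K hK => imp_congr_left ⟨fun h q hq => ?_,
    fun h q hq => h q (List.mem_of_mem_filter hq)⟩
  rcases Finset.mem_union.1 (hw q hq) with h1 | h1
  · exact h q (List.mem_filter.2 ⟨hq, by simpa using h1⟩)
  · rw [Finset.mem_offDiag] at h1
    exact ⟨fun h2 => absurd h1.1 (Finset.disjoint_left.1 hd (hK h2)),
      fun h2 => absurd h1.2.1 (Finset.disjoint_left.1 hd (hK h2))⟩

/-- Letters from `T` do not move points of `S`, and letters from `S` keep them in `S`, so dropping
the former changes nothing on `S`. -/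
lemma wordPerm_filter_apply {S T : Finset α} (hd : Disjoint S T) {w : List (α × α)}
    (hw : ∀ q ∈ w, q ∈ S.offDiag ∪ T.offDiag) {x : α} (hx : x ∈ S) :
    wordPerm (w.filter (· ∈ S.offDiag)) x = wordPerm w x ∧ wordPerm w x ∈ S := by
  induction w with
  | nil => exact ⟨rfl, hx⟩
  | cons q w ih =>
    obtain ⟨h1, h2⟩ := ih fun q' hq' => hw q' (by simp [hq'])
    rw [wordPerm_cons, Perm.mul_apply]
    rcases Finset.mem_union.1 (hw q (by simp)) with h3 | h3
    · rw [List.filter_cons_of_pos (by simpa using h3), wordPerm_cons, Perm.mul_apply, h1]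
      have h4 := Finset.mem_offDiag.1 h3
      exact ⟨rfl, (swap_apply_mem_iff (by simp [h4.1, h4.2.1]) _).2 h2⟩
    · have h4 := Finset.mem_offDiag.1 h3
      have h5 : q.1 ∉ S := Finset.disjoint_right.1 hd h4.1
      rw [List.filter_cons_of_neg (by simp [Finset.mem_offDiag, h5]), h1,
        Equiv.swap_apply_of_ne_of_ne]
      · exact ⟨rfl, h2⟩
      · rintro h; exact h5 (h ▸ h2)
      · rintro h; exact Finset.disjoint_right.1 hd h4.2.1 (h ▸ h2)

/-! ### The number of transitive words -/

variable [Finite α] [Finite β]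

open Classical in
/-- The number of transitive words of length `r` on `S` whose product has cycle type `m`. -/
def wordCount (S : Finset α) (r : ℕ) (m : ℕ+ →₀ ℕ) : ℕ :=
  ∑ w ∈ words S.offDiag r, if IsTransOn S w ∧ cycleTypeOn S (wordPerm w) = m then 1 else 0

lemma isClosedUnder_map (e : α ↪ β) {w : List (α × α)} {K : Finset α} :
    IsClosedUnder (w.map (e.prodMap e)) (K.map e) ↔ IsClosedUnder w K := by
  simp only [IsClosedUnder, List.forall_mem_map, Function.Embedding.coe_prodMap, Prod.map_fst,
    Prod.map_snd, Finset.mem_map']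

lemma isTransOn_map (e : α ↪ β) {w : List (α × α)} {S : Finset α} :
    IsTransOn (S.map e) (w.map (e.prodMap e)) ↔ IsTransOn S w := by
  rw [IsTransOn, IsTransOn, Finset.map_nonempty]
  refine and_congr_right fun _ => ⟨fun h K hK hc => ?_, fun h K hK hc => ?_⟩
  · have := h (K.map e) (Finset.map_subset_map.2 hK) ((isClosedUnder_map e).2 hc)
    rwa [Finset.map_eq_empty, Finset.map_inj] at this
  · obtain ⟨K, hK', rfl⟩ := Finset.subset_map_iff.1 hK
    rw [Finset.map_eq_empty, Finset.map_inj]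
    exact h K hK' ((isClosedUnder_map e).1 hc)

lemma wordPerm_map (e : α ↪ β) (w : List (α × α)) (x : α) :
    wordPerm (w.map (e.prodMap e)) (e x) = e (wordPerm w x) := by
  induction w with
  | nil => rfl
  | cons p w ih =>
    rw [List.map_cons, wordPerm_cons, wordPerm_cons, Perm.mul_apply, ih, Perm.mul_apply]
    exact e.injective.swap_apply p.1 p.2 _

lemma wordCount_map (e : α ↪ β) (S : Finset α) (r : ℕ) (m : ℕ+ →₀ ℕ) :
    wordCount (S.map e) r m = wordCount S r m := by
  classical
  have h1 : (S.map e).offDiag = S.offDiag.map (e.prodMap e) := by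
    ext ⟨x, y⟩
    simp only [Finset.mem_offDiag, Finset.mem_map, Prod.exists, Function.Embedding.coe_prodMap,
      Prod.map_apply, Prod.mk.injEq]
    constructor
    · rintro ⟨⟨a, ha, rfl⟩, ⟨b, hb, rfl⟩, hab⟩
      exact ⟨a, b, ⟨ha, hb, fun h => hab (h ▸ rfl)⟩, rfl, rfl⟩
    · rintro ⟨a, b, ⟨ha, hb, hab⟩, rfl, rfl⟩
      exact ⟨⟨a, ha, rfl⟩, ⟨b, hb, rfl⟩, fun h => hab (e.injective h)⟩
  rw [wordCount, wordCount, h1, sum_words_map]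
  refine Finset.sum_congr rfl fun w hw => if_congr ?_ rfl rfl
  have hc := IsClosedUnder.of_mem_words hw
  rw [isTransOn_map, cycleTypeOn_map (wordPerm_mem_iff hc)
    (wordPerm_mem_iff ((isClosedUnder_map e).2 hc)) fun x _ => wordPerm_map e w x]

lemma wordCount_eq (S : Finset α) (r : ℕ) (m : ℕ+ →₀ ℕ) :
    wordCount S r m = wordCount (Finset.univ : Finset (Fin S.card)) r m := by
  rw [← wordCount_map (S.equivFin.symm.toEmbedding.trans (Function.Embedding.subtype _))]
  congr 1
  ext x
  simp only [Finset.mem_map, Finset.mem_univ, true_and]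
  constructor
  · intro hx
    exact ⟨S.equivFin ⟨x, hx⟩, by simp⟩
  · rintro ⟨a, rfl⟩
    simp

lemma cycleTypeOn_filter {S T : Finset α} (hd : Disjoint S T) {w : List (α × α)}
    (hw : ∀ q ∈ w, q ∈ S.offDiag ∪ T.offDiag) (hc : IsClosedUnder w S) :
    cycleTypeOn S (wordPerm (w.filter (· ∈ S.offDiag))) = cycleTypeOn S (wordPerm w) := by
  refine cycleTypeOn_congr (wordPerm_mem_iff hc) (fun x hx => (wordPerm_filter_apply hd hw hx).1) ?_
  refine wordPerm_mem_iff fun q hq => hc q (List.mem_of_mem_filter hq)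

end

end Hurwitz

end

noncomputable section

namespace Hurwitz

open Equiv (Perm)

open Finset.HasAntidiagonal (antidiagonal mem_antidiagonal)

/-! ### The cut-join recursion -/

lemma ne_add_pnat (i j : ℕ+) : i ≠ i + j := fun h => by
  have h1 : (i : ℕ) = (i + j : ℕ+) := congrArg _ h
  have := j.pos
  rw [PNat.add_coe] at h1
  omega

lemma ne_add_pnat' (i j : ℕ+) : j ≠ i + j := add_comm j i ▸ ne_add_pnat j i

/-- The equation of types is solved for `t`, so that the count is expressed by the type `m` of the
product. The factors become those of a second derivative; the correction for `i = j` is the drop of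
the exponent caused by the first derivative. -/
lemma ite_join (i j : ℕ+) (t m : ℕ+ →₀ ℕ) :
    (if m + Finsupp.single i 1 + Finsupp.single j 1 = t + Finsupp.single (i + j) 1 then
      (i * t i) * (j * t j - if i = j then (i : ℕ) else 0) else 0) =
    if Finsupp.single (i + j) 1 ≤ m then
      ((i * ((m - Finsupp.single (i + j) 1 : ℕ+ →₀ ℕ) i + 1)) *
          (j * ((m - Finsupp.single (i + j) 1 + Finsupp.single i 1 : ℕ+ →₀ ℕ) j + 1))) *
        (if t = m - Finsupp.single (i + j) 1 + Finsupp.single i 1 + Finsupp.single j 1 then 1 else 0)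
      else 0 := by
  have hi := ne_add_pnat i j
  have hj := ne_add_pnat' i j
  by_cases hle : Finsupp.single (i + j) 1 ≤ m
  · obtain ⟨μ, rfl⟩ := exists_add_of_le hle
    have hiff : Finsupp.single (i + j) 1 + μ + Finsupp.single i 1 + Finsupp.single j 1 =
        t + Finsupp.single (i + j) 1 ↔ t = μ + Finsupp.single i 1 + Finsupp.single j 1 := by
      rw [add_assoc, add_assoc, add_comm, add_left_inj, ← add_assoc, eq_comm]
    rw [if_pos hle, add_tsub_cancel_left]
    by_cases ht : t = μ + Finsupp.single i 1 + Finsupp.single j 1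
    · rw [if_pos (hiff.2 ht), if_pos ht, mul_one, ht]
      by_cases hij : i = j
      · subst hij
        simp only [Finsupp.add_apply, Finsupp.single_eq_same, if_true]
        rw [mul_add (i : ℕ) (μ i + 1) 1, mul_one, Nat.add_sub_cancel]
        ring
      · simp [hij, Ne.symm hij]
    · rw [if_neg (mt hiff.1 ht), if_neg ht, mul_zero]
  · rw [if_neg hle, if_neg]
    intro h
    apply hle
    rw [Finsupp.single_le_iff]
    have := DFunLike.congr_fun h (i + j)
    simp only [Finsupp.add_apply, Finsupp.single_eq_same, Finsupp.single_eq_of_ne hi.symm,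
      Finsupp.single_eq_of_ne hj.symm] at this
    omega

/-- The equation is again solved for `t`, and the remaining factor is that of the derivative with
respect to `z_{i+j}`. -/
lemma ite_cut (i j : ℕ+) (t m : ℕ+ →₀ ℕ) :
    (if m + Finsupp.single (i + j) 1 = t + Finsupp.single i 1 + Finsupp.single j 1 then
      ((i : ℕ) + j) * t (i + j) else 0) =
    if Finsupp.single i 1 + Finsupp.single j 1 ≤ m then
      (((i : ℕ) + j) * ((m - (Finsupp.single i 1 + Finsupp.single j 1) : ℕ+ →₀ ℕ) (i + j) + 1)) *
        (if t = m - (Finsupp.single i 1 + Finsupp.single j 1) + Finsupp.single (i + j) 1 then 1 else 0)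
      else 0 := by
  have hi := ne_add_pnat i j
  have hj := ne_add_pnat' i j
  by_cases hle : Finsupp.single i 1 + Finsupp.single j 1 ≤ m
  · obtain ⟨μ, rfl⟩ := exists_add_of_le hle
    have hiff : Finsupp.single i 1 + Finsupp.single j 1 + μ + Finsupp.single (i + j) 1 =
        t + Finsupp.single i 1 + Finsupp.single j 1 ↔ t = μ + Finsupp.single (i + j) 1 := by
      rw [add_assoc, add_assoc t, add_comm, add_left_inj, eq_comm]
    rw [if_pos hle, add_tsub_cancel_left]
    by_cases ht : t = μ + Finsupp.single (i + j) 1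
    · rw [if_pos (hiff.2 ht), if_pos ht, mul_one, ht]
      simp
    · rw [if_neg (mt hiff.1 ht), if_neg ht, mul_zero]
  · rw [if_neg hle, if_neg]
    intro h
    apply hle
    intro a
    have h1 := DFunLike.congr_fun h a
    by_cases ha : a = i + j
    · subst ha
      simp only [Finsupp.add_apply, Finsupp.single_eq_of_ne hi.symm, Finsupp.single_eq_of_ne hj.symm]
      omega
    · simp only [Finsupp.add_apply, Finsupp.single_eq_of_ne ha]
        at h1 ⊢
      omega

section

variable {α : Type} [Finite α] [DecidableEq α] {U : Finset α} {I : Finset ℕ+}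

/-- Joining cycles of complementary invariant sets. -/
lemma sum_swap_split {σ : Perm α} {S T : Finset α} (hS : ∀ x, σ x ∈ S ↔ x ∈ S)
    (hT : ∀ x, σ x ∈ T ↔ x ∈ T) (hd : Disjoint S T) (hI : ∀ a : ℕ+, (a : ℕ) ≤ S.card → a ∈ I)
    (hI' : ∀ a : ℕ+, (a : ℕ) ≤ T.card → a ∈ I) (m : ℕ+ →₀ ℕ) :
    (∑ x ∈ S, ∑ y ∈ T, if cycleTypeOn (S ∪ T) (Equiv.swap x y * σ) = m then 1 else 0) =
      ∑ i ∈ I, ∑ j ∈ I, if Finsupp.single (i + j) 1 ≤ m then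
        ∑ q ∈ antidiagonal (m - Finsupp.single (i + j) 1 : ℕ+ →₀ ℕ), (((i : ℕ) * (q.1 i + 1)) * ((j : ℕ) * (q.2 j + 1))) *
          (if cycleTypeOn S σ = q.1 + Finsupp.single i 1 ∧ cycleTypeOn T σ = q.2 + Finsupp.single j 1
            then 1 else 0) else 0 := by
  have hU : ∀ x, σ x ∈ S ∪ T ↔ x ∈ S ∪ T := fun x => by
    rw [Finset.mem_union, Finset.mem_union, hS, hT]
  have e1 : ∀ x ∈ S, ∀ y ∈ T, (if cycleTypeOn (S ∪ T) (Equiv.swap x y * σ) = m then 1 else 0) =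
      ∑ i ∈ I, ∑ j ∈ I, if Finsupp.single (i + j) 1 ≤ m then
        ∑ q ∈ antidiagonal (m - Finsupp.single (i + j) 1 : ℕ+ →₀ ℕ),
          ((if cycleLen σ x = i then 1 else 0) * (if cycleLen σ y = j then 1 else 0)) *
          (if cycleTypeOn S σ = q.1 + Finsupp.single i 1 ∧ cycleTypeOn T σ = q.2 + Finsupp.single j 1
            then 1 else 0) else 0 := by
    intro x hx y hy
    have hxy : ¬ σ.SameCycle x y := fun h => by
      obtain ⟨k, -, rfl⟩ := sameCycle_iff.1 h
      exact Finset.disjoint_left.1 hd ((pow_mem_iff hS k x).2 hx) hy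
    have h1 := cycleTypeOn_join hU (Finset.mem_union_left T hx) (Finset.mem_union_right S hy) hxy
    rw [cycleTypeOn_union hS hT hd] at h1
    rw [Finset.sum_eq_single (cycleLen σ x), Finset.sum_eq_single (cycleLen σ y)]
    · simp only [if_true, mul_one, one_mul]
      -- `A` and `B` are the types left on `S` and `T` after removal of the two cycles being joined;
      -- no other pair `q` contributes.
      obtain ⟨A, hA⟩ := exists_add_of_le (Finsupp.single_le_iff.2 (cycleTypeOn_pos hS hx))
      obtain ⟨B, hB⟩ := exists_add_of_le (Finsupp.single_le_iff.2 (cycleTypeOn_pos hT hy))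
      set i := cycleLen σ x
      set j := cycleLen σ y
      have h2 : cycleTypeOn (S ∪ T) (Equiv.swap x y * σ) = A + B + Finsupp.single (i + j) 1 := by
        rw [hA, hB] at h1
        rw [← add_left_inj (Finsupp.single i 1 + Finsupp.single j 1), ← add_assoc, h1]
        abel
      rw [h2]
      have h3 : ∀ q : (ℕ+ →₀ ℕ) × (ℕ+ →₀ ℕ), (cycleTypeOn S σ = q.1 + Finsupp.single i 1 ∧
          cycleTypeOn T σ = q.2 + Finsupp.single j 1) ↔ q = (A, B) := fun q => by
        rw [hA, hB, add_comm, add_left_inj, add_comm _ B, add_left_inj, Prod.ext_iff, eq_comm,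
          @eq_comm _ B]
      simp only [h3, Finset.sum_ite_eq', mem_antidiagonal]
      by_cases hle : Finsupp.single (i + j) 1 ≤ m
      · obtain ⟨μ, rfl⟩ := exists_add_of_le hle
        rw [if_pos hle, add_tsub_cancel_left, add_comm _ μ]
        simp only [add_left_inj]
      · rw [if_neg hle, if_neg]
        rintro rfl
        exact hle le_add_self
    · intro j _ hj; simp [hj.symm]
    · exact fun h => absurd (hI' _ (cycleLen_le_card hT hy)) h
    · intro i _ hi; simp [hi.symm]
    · exact fun h => absurd (hI _ (cycleLen_le_card hS hx)) h
  rw [Finset.sum_congr rfl fun x hx => Finset.sum_congr rfl fun y hy => e1 x hx y hy]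
  simp_rw [Finset.sum_comm (s := T) (t := I), Finset.sum_comm (s := S) (t := I)]
  refine Finset.sum_congr rfl fun i _ => Finset.sum_congr rfl fun j _ => ?_
  by_cases hle : Finsupp.single (i + j) 1 ≤ m
  · simp only [if_pos hle]
    simp_rw [Finset.sum_comm (s := T)
      (t := antidiagonal (m - Finsupp.single (i + j) 1 : ℕ+ →₀ ℕ)),
      Finset.sum_comm (s := S) (t := antidiagonal (m - Finsupp.single (i + j) 1 : ℕ+ →₀ ℕ))]
    refine Finset.sum_congr rfl fun q _ => ?_
    simp_rw [← Finset.sum_mul, ← Finset.sum_mul_sum, ← cycleCard_eq_sum, ← mul_cycleTypeOn hS,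
      ← mul_cycleTypeOn hT]
    by_cases hq : cycleTypeOn S σ = q.1 + Finsupp.single i 1 ∧
        cycleTypeOn T σ = q.2 + Finsupp.single j 1
    · rw [if_pos hq, hq.1, hq.2]; simp
    · rw [if_neg hq, mul_zero, mul_zero]
  · simp only [if_neg hle, Finset.sum_const_zero]

open Classical in
/-- Pairs of transitive words on complementary sets. -/
lemma sum_words_split {S : Finset α} (hSU : S ⊆ U) (r : ℕ) (m₁ m₂ : ℕ+ →₀ ℕ) :
    (∑ w ∈ words U.offDiag r, if IsClosedUnder w S ∧
      (IsTransOn S w ∧ cycleTypeOn S (wordPerm w) = m₁) ∧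
      (IsTransOn (U \ S) w ∧ cycleTypeOn (U \ S) (wordPerm w) = m₂) then 1 else 0) =
    ∑ q ∈ antidiagonal r, r.choose q.1 * (wordCount S q.1 m₁ * wordCount (U \ S) q.2 m₂) := by
  have hd : Disjoint S (U \ S) := Finset.disjoint_sdiff
  have hdd : Disjoint S.offDiag (U \ S).offDiag := by
    rw [Finset.disjoint_left]
    intro q h1 h2
    exact Finset.disjoint_left.1 hd (Finset.mem_offDiag.1 h1).1 (Finset.mem_offDiag.1 h2).1
  unfold wordCount
  rw [← sum_words_shuffle (Finset.offDiag_mono hSU) (Finset.offDiag_mono Finset.sdiff_subset) hdd]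
  refine Finset.sum_congr rfl fun w hw => ?_
  have hU := IsClosedUnder.of_mem_words hw
  have hw' := (mem_words.1 hw).2
  by_cases hc : IsClosedUnder w S
  · have hlet : ∀ q ∈ w, q ∈ S.offDiag ∪ (U \ S).offDiag := by
      intro q hq
      have h1 := Finset.mem_offDiag.1 (hw' q hq)
      have h2 := hc q hq
      simp only [Finset.mem_union, Finset.mem_offDiag, Finset.mem_sdiff]
      by_cases h3 : q.1 ∈ S
      · exact Or.inl ⟨h3, h2.1 h3, h1.2.2⟩
      · exact Or.inr ⟨⟨h1.1, h3⟩, ⟨h1.2.1, fun h => h3 (h2.2 h)⟩, h1.2.2⟩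
    have hlet' : ∀ q ∈ w, q ∈ (U \ S).offDiag ∪ S.offDiag := fun q hq => by
      rw [Finset.union_comm]; exact hlet q hq
    have h1 := isTransOn_filter hd hlet
    have h2 := isTransOn_filter hd.symm hlet'
    have h3 := cycleTypeOn_filter hd hlet hc
    have h4 := cycleTypeOn_filter hd.symm hlet' (hU.sdiff hc)
    rw [if_pos hlet, ite_zero_mul_ite_zero]
    simp only [hc, true_and, h1, h2, h3, h4, mul_one]
  · rw [if_neg fun h => hc h.1, if_neg]
    intro hlet
    apply hc
    intro q hq
    rcases Finset.mem_union.1 (hlet q hq) with h | h <;> have h1 := Finset.mem_offDiag.1 h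
    · simp [h1.1, h1.2.1]
    · simp [(Finset.mem_sdiff.1 h1.1).2, (Finset.mem_sdiff.1 h1.2.1).2]

/-- The first letter is split off. If the remaining word is transitive, all letters are summed and
give the joins and cuts. If it splits into blocks `S` and `U \ S`, the letter runs over `S × (U \
S)` and joins a cycle of one block to a cycle of the other. -/
lemma wordCount_succ (hI : ∀ a : ℕ+, (a : ℕ) ≤ U.card → a ∈ I) (r : ℕ) (m : ℕ+ →₀ ℕ) :
    wordCount U (r + 1) m = ∑ i ∈ I, ∑ j ∈ I,
      ((if Finsupp.single (i + j) 1 ≤ m then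
        ((i * ((m - Finsupp.single (i + j) 1 : ℕ+ →₀ ℕ) i + 1)) *
          (j * ((m - Finsupp.single (i + j) 1 + Finsupp.single i 1 : ℕ+ →₀ ℕ) j + 1))) *
        wordCount U r (m - Finsupp.single (i + j) 1 + Finsupp.single i 1 + Finsupp.single j 1)
        else 0) +
      (if Finsupp.single i 1 + Finsupp.single j 1 ≤ m then
        (((i : ℕ) + j) * ((m - (Finsupp.single i 1 + Finsupp.single j 1) : ℕ+ →₀ ℕ) (i + j) + 1)) *
        wordCount U r (m - (Finsupp.single i 1 + Finsupp.single j 1) + Finsupp.single (i + j) 1)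
        else 0) +
      if Finsupp.single (i + j) 1 ≤ m then
        ∑ q ∈ antidiagonal (m - Finsupp.single (i + j) 1 : ℕ+ →₀ ℕ),
          (((i : ℕ) * (q.1 i + 1)) * ((j : ℕ) * (q.2 j + 1))) * ∑ S ∈ U.powerset, ∑ k ∈ antidiagonal r,
            r.choose k.1 * (wordCount S k.1 (q.1 + Finsupp.single i 1) *
              wordCount (U \ S) k.2 (q.2 + Finsupp.single j 1)) else 0) := by
  classical
  have hA : ∀ w ∈ words U.offDiag r, (∑ p ∈ U.offDiag,
      if cycleTypeOn U (Equiv.swap p.1 p.2 * wordPerm w) = m then 1 else 0) = _ := fun w hw =>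
    sum_swap_mul (wordPerm_mem_iff (IsClosedUnder.of_mem_words hw)) hI m
  have hB : ∀ w ∈ words U.offDiag r, ∀ S ∈ U.powerset, (∑ p ∈ U.offDiag, if IsSplit U p w S then
      (if cycleTypeOn U (Equiv.swap p.1 p.2 * wordPerm w) = m then 1 else 0) else 0) =
      if IsClosedUnder w S ∧ IsTransOn S w ∧ IsTransOn (U \ S) w then
        ∑ i ∈ I, ∑ j ∈ I, if Finsupp.single (i + j) 1 ≤ m then
        ∑ q ∈ antidiagonal (m - Finsupp.single (i + j) 1 : ℕ+ →₀ ℕ), (((i : ℕ) * (q.1 i + 1)) * ((j : ℕ) * (q.2 j + 1))) *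
          (if cycleTypeOn S (wordPerm w) = q.1 + Finsupp.single i 1 ∧
            cycleTypeOn (U \ S) (wordPerm w) = q.2 + Finsupp.single j 1
            then 1 else 0) else 0 else 0 := by
    intro w hw S hS
    rw [Finset.mem_powerset] at hS
    by_cases hc : IsClosedUnder w S ∧ IsTransOn S w ∧ IsTransOn (U \ S) w
    · have hU := IsClosedUnder.of_mem_words hw
      rw [if_pos hc, ← sum_swap_split (wordPerm_mem_iff hc.1) (wordPerm_mem_iff (hU.sdiff hc.1))
        Finset.disjoint_sdiff (fun a ha => hI a (ha.trans (Finset.card_le_card hS)))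
        (fun a ha => hI a (ha.trans (Finset.card_le_card Finset.sdiff_subset))),
        Finset.union_sdiff_of_subset hS, ← Finset.sum_product', ← Finset.sum_filter]
      refine Finset.sum_congr ?_ fun _ _ => rfl
      ext p
      simp only [Finset.mem_filter, IsSplit, hc, and_true, Finset.mem_product, Finset.mem_offDiag]
      refine ⟨fun h => h.2, fun h => ⟨⟨hS h.1, (Finset.mem_sdiff.1 h.2).1, fun he => ?_⟩, h⟩⟩
      exact (Finset.mem_sdiff.1 h.2).2 (he ▸ h.1)
    · rw [if_neg hc]
      exact Finset.sum_eq_zero fun p _ => if_neg fun h => hc h.2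
  have h0 : wordCount U (r + 1) m = ∑ w ∈ words U.offDiag r, ((if IsTransOn U w then
      ∑ p ∈ U.offDiag, (if cycleTypeOn U (Equiv.swap p.1 p.2 * wordPerm w) = m then 1 else 0) else 0) +
      ∑ S ∈ U.powerset, ∑ p ∈ U.offDiag, if IsSplit U p w S then
      (if cycleTypeOn U (Equiv.swap p.1 p.2 * wordPerm w) = m then 1 else 0) else 0) := by
    rw [wordCount, sum_words_succ, Finset.sum_comm]
    refine Finset.sum_congr rfl fun w hw => ?_
    have h1 : (if IsTransOn U w then ∑ p ∈ U.offDiag,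
        (if cycleTypeOn U (Equiv.swap p.1 p.2 * wordPerm w) = m then 1 else 0) else 0) =
        ∑ p ∈ U.offDiag, (if IsTransOn U w then 1 else 0) *
        (if cycleTypeOn U (Equiv.swap p.1 p.2 * wordPerm w) = m then 1 else 0) := by
      split_ifs <;> simp
    rw [h1, Finset.sum_comm (s := U.powerset), ← Finset.sum_add_distrib]
    refine Finset.sum_congr rfl fun p hp => ?_
    have h2 := ite_isTransOn_cons (IsClosedUnder.of_mem_words hw) hp
    rw [wordPerm_cons]
    by_cases h3 : cycleTypeOn U (Equiv.swap p.1 p.2 * wordPerm w) = m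
    · simp only [h3, and_true, if_true, mul_one]
      exact h2
    · simp [h3]
  rw [h0, Finset.sum_add_distrib]
  simp_rw [Finset.sum_add_distrib (s := I)]
  congr 1
  · rw [← Finset.sum_add_distrib]
    simp_rw [← Finset.sum_add_distrib]
    have h1 : ∀ w ∈ words U.offDiag r, (if IsTransOn U w then ∑ p ∈ U.offDiag,
        (if cycleTypeOn U (Equiv.swap p.1 p.2 * wordPerm w) = m then 1 else 0) else 0) =
        ∑ i ∈ I, ∑ j ∈ I, ((if Finsupp.single (i + j) 1 ≤ m then
          ((i * ((m - Finsupp.single (i + j) 1 : ℕ+ →₀ ℕ) i + 1)) *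
          (j * ((m - Finsupp.single (i + j) 1 + Finsupp.single i 1 : ℕ+ →₀ ℕ) j + 1))) *
          (if IsTransOn U w ∧ cycleTypeOn U (wordPerm w) =
            m - Finsupp.single (i + j) 1 + Finsupp.single i 1 + Finsupp.single j 1 then 1 else 0)
          else 0) +
        (if Finsupp.single i 1 + Finsupp.single j 1 ≤ m then
          (((i : ℕ) + j) * ((m - (Finsupp.single i 1 + Finsupp.single j 1) : ℕ+ →₀ ℕ) (i + j) + 1)) *
          (if IsTransOn U w ∧ cycleTypeOn U (wordPerm w) =
            m - (Finsupp.single i 1 + Finsupp.single j 1) + Finsupp.single (i + j) 1 then 1 else 0)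
          else 0)) := by
      intro w hw
      split_ifs with ht
      · rw [hA w hw]
        refine Finset.sum_congr rfl fun i _ => Finset.sum_congr rfl fun j _ => ?_
        rw [ite_join, ite_cut]
        simp [ht]
      · simp [ht]
    rw [Finset.sum_congr rfl h1, Finset.sum_comm]
    refine Finset.sum_congr rfl fun i _ => ?_
    rw [Finset.sum_comm]
    refine Finset.sum_congr rfl fun j _ => ?_
    rw [Finset.sum_add_distrib]
    congr 1
    · split_ifs
      · rw [wordCount, Finset.mul_sum]
      · simp
    · split_ifs
      · rw [wordCount, Finset.mul_sum]
      · simp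
  · rw [Finset.sum_congr rfl fun w hw => Finset.sum_congr rfl fun S hS => hB w hw S hS]
    have h1 : ∀ (w : List (α × α)) (S : Finset α),
        (if IsClosedUnder w S ∧ IsTransOn S w ∧ IsTransOn (U \ S) w then
        ∑ i ∈ I, ∑ j ∈ I, if Finsupp.single (i + j) 1 ≤ m then
        ∑ q ∈ antidiagonal (m - Finsupp.single (i + j) 1 : ℕ+ →₀ ℕ), (((i : ℕ) * (q.1 i + 1)) * ((j : ℕ) * (q.2 j + 1))) *
          (if cycleTypeOn S (wordPerm w) = q.1 + Finsupp.single i 1 ∧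
            cycleTypeOn (U \ S) (wordPerm w) = q.2 + Finsupp.single j 1
            then 1 else 0) else 0 else 0) =
        ∑ i ∈ I, ∑ j ∈ I, if Finsupp.single (i + j) 1 ≤ m then
        ∑ q ∈ antidiagonal (m - Finsupp.single (i + j) 1 : ℕ+ →₀ ℕ), (((i : ℕ) * (q.1 i + 1)) * ((j : ℕ) * (q.2 j + 1))) *
          (if IsClosedUnder w S ∧
      (IsTransOn S w ∧ cycleTypeOn S (wordPerm w) = q.1 + Finsupp.single i 1) ∧
      (IsTransOn (U \ S) w ∧ cycleTypeOn (U \ S) (wordPerm w) = q.2 + Finsupp.single j 1)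
            then 1 else 0) else 0 := by
      intro w S
      split_ifs with h
      · simp only [h, true_and]
      · have h2 : ∀ P Q : Prop, ¬ (IsClosedUnder w S ∧ (IsTransOn S w ∧ P) ∧ (IsTransOn (U \ S) w ∧ Q)) :=
          fun P Q h' => h ⟨h'.1, h'.2.1.1, h'.2.2.1⟩
        simp [h2]
    simp_rw [h1]
    simp_rw [Finset.sum_comm (s := U.powerset) (t := I)]
    rw [Finset.sum_comm]
    refine Finset.sum_congr rfl fun i _ => ?_
    rw [Finset.sum_comm]
    refine Finset.sum_congr rfl fun j _ => ?_
    by_cases hle : Finsupp.single (i + j) 1 ≤ m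
    · simp only [if_pos hle]
      simp_rw [Finset.sum_comm (s := U.powerset)
        (t := antidiagonal (m - Finsupp.single (i + j) 1 : ℕ+ →₀ ℕ))]
      rw [Finset.sum_comm]
      refine Finset.sum_congr rfl fun q _ => ?_
      rw [Finset.sum_comm, Finset.mul_sum]
      refine Finset.sum_congr rfl fun S hS => ?_
      rw [← Finset.mul_sum, sum_words_split (Finset.mem_powerset.1 hS)]
    · simp only [if_neg hle, Finset.sum_const_zero]

/-- The number of transitive words on a set of `d` elements. -/
def transCount (d r : ℕ) (m : ℕ+ →₀ ℕ) : ℕ := wordCount (Finset.univ : Finset (Fin d)) r m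

end

/-- The cut-join recursion for the number of transitive words. -/
lemma transCount_succ {I : Finset ℕ+} {d : ℕ} (hI : ∀ a : ℕ+, (a : ℕ) ≤ d → a ∈ I) (r : ℕ)
    (m : ℕ+ →₀ ℕ) :
    transCount d (r + 1) m = ∑ i ∈ I, ∑ j ∈ I,
      ((if Finsupp.single (i + j) 1 ≤ m then
        ((i * ((m - Finsupp.single (i + j) 1 : ℕ+ →₀ ℕ) i + 1)) *
          (j * ((m - Finsupp.single (i + j) 1 + Finsupp.single i 1 : ℕ+ →₀ ℕ) j + 1))) *
        transCount d r (m - Finsupp.single (i + j) 1 + Finsupp.single i 1 + Finsupp.single j 1)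
        else 0) +
      (if Finsupp.single i 1 + Finsupp.single j 1 ≤ m then
        (((i : ℕ) + j) * ((m - (Finsupp.single i 1 + Finsupp.single j 1) : ℕ+ →₀ ℕ) (i + j) + 1)) *
        transCount d r (m - (Finsupp.single i 1 + Finsupp.single j 1) + Finsupp.single (i + j) 1)
        else 0) +
      if Finsupp.single (i + j) 1 ≤ m then
        ∑ q ∈ antidiagonal (m - Finsupp.single (i + j) 1 : ℕ+ →₀ ℕ),
          (((i : ℕ) * (q.1 i + 1)) * ((j : ℕ) * (q.2 j + 1))) * ∑ e ∈ antidiagonal d, d.choose e.1 *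
            ∑ k ∈ antidiagonal r,
            r.choose k.1 * (transCount e.1 k.1 (q.1 + Finsupp.single i 1) *
              transCount e.2 k.2 (q.2 + Finsupp.single j 1)) else 0) := by
  have h := wordCount_succ (U := (Finset.univ : Finset (Fin d))) (I := I) (by simpa using hI) r m
  unfold transCount
  rw [h]
  refine Finset.sum_congr rfl fun i _ => Finset.sum_congr rfl fun j _ => ?_
  congr 1
  refine if_congr Iff.rfl (Finset.sum_congr rfl fun q _ => ?_) rfl
  congr 1
  obtain ⟨F, hF⟩ : ∃ F : ℕ → ℕ → ℕ, ∀ c c', F c c' = ∑ k ∈ antidiagonal r, r.choose k.1 *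
        (wordCount (Finset.univ : Finset (Fin c)) k.1 (q.1 + Finsupp.single i 1) *
        wordCount (Finset.univ : Finset (Fin c')) k.2 (q.2 + Finsupp.single j 1)) :=
    ⟨_, fun _ _ => rfl⟩
  have h1 : ∀ S ∈ (Finset.univ : Finset (Fin d)).powerset, (∑ k ∈ antidiagonal r,
      r.choose k.1 * (wordCount S k.1 (q.1 + Finsupp.single i 1) *
        wordCount (Finset.univ \ S) k.2 (q.2 + Finsupp.single j 1))) = F S.card (d - S.card) := by
    intro S _
    rw [hF]
    refine Finset.sum_congr rfl fun k _ => ?_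
    have h2 : (Finset.univ \ S).card = d - S.card := by
      rw [Finset.card_sdiff_of_subset (Finset.subset_univ S), Finset.card_univ, Fintype.card_fin]
    rw [wordCount_eq S, wordCount_eq (Finset.univ \ S), h2]
  -- The contribution of a block depends only on its size, so the sum over blocks becomes a sum with
  -- binomial coefficients.
  rw [Finset.sum_congr rfl h1, Finset.sum_powerset_apply_card fun c => F c (d - c), Finset.card_univ,
    Fintype.card_fin]
  simp_rw [← hF]
  exact (Finset.Nat.sum_antidiagonal_eq_sum_range_succ (fun c c' => d.choose c * F c c') d).symm

end Hurwitz

end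

noncomputable section

namespace Hurwitz

open Equiv (Perm)

/-! ### Monodromies and words -/

section labels

variable {d : ℕ} (m : ℕ+ →₀ ℕ) (σ : Perm (Fin d))

/-- `L` labels the cycles of `σ`. -/
def IsLabelling (L : Fin d → Σ a : ℕ+, Fin (m a)) : Prop :=
  (∀ k l, L k = L l ↔ σ.SameCycle k l) ∧ ∀ s, {k | L k = s}.ncard = s.1

variable {m σ} {L L' : Fin d → Σ a : ℕ+, Fin (m a)}

lemma IsLabelling.fst_eq (h : IsLabelling m σ L) (k : Fin d) : (L k).1 = cycleLen σ k := by
  classical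
  apply PNat.eq
  rw [← h.2, ← card_cycle (S := Finset.univ) (by simp) (Finset.mem_univ k), ← Set.ncard_coe_finset]
  congr 1
  ext l
  simp only [Set.mem_ofPred_eq, Finset.coe_filter, Finset.mem_univ, true_and, h.1]
  exact Perm.sameCycle_comm

lemma IsLabelling.surjective (h : IsLabelling m σ L) : Function.Surjective L := fun s =>
  Set.nonempty_of_ncard_ne_zero ((h.2 s).trans_ne s.1.pos.ne')

lemma card_labels_fst (m : ℕ+ →₀ ℕ) (a : ℕ+) :
    Fintype.card {s : Σ a : ℕ+, Fin (m a) // s.1 = a} = m a := by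
  rw [← Fintype.card_fin (m a)]
  refine (Fintype.card_of_bijective (f := fun i : Fin (m a) => (⟨⟨a, i⟩, rfl⟩ :
    {s : Σ a : ℕ+, Fin (m a) // s.1 = a})) ⟨fun i j h => ?_, ?_⟩).symm
  · simpa using h
  · rintro ⟨⟨_, i⟩, rfl⟩
    exact ⟨i, rfl⟩

lemma IsLabelling.cycleTypeOn_eq (h : IsLabelling m σ L) : cycleTypeOn Finset.univ σ = m := by
  classical
  rw [eq_cycleTypeOn_iff (by simp)]
  intro a
  rw [cycleCard]
  simp_rw [← h.fst_eq]
  rw [Finset.card_eq_sum_card_fiberwise (f := L)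
    (t := Finset.univ.filter fun s : Σ a : ℕ+, Fin (m a) => s.1 = a)]
  · rw [Finset.sum_const_nat (m := a), ← Fintype.card_subtype, card_labels_fst, mul_comm]
    intro s hs
    have hs' := (Finset.mem_filter.1 hs).2
    rw [← hs', ← h.2 s, ← Set.ncard_coe_finset]
    congr 1
    ext k
    simp only [Finset.coe_filter, Finset.mem_filter, Finset.mem_univ, true_and, Set.mem_ofPred_eq]
    exact ⟨fun h => h.2, fun h => ⟨h ▸ rfl, h⟩⟩
  · intro k hk
    simpa using hk

lemma exists_isLabelling (h : cycleTypeOn Finset.univ σ = m) : ∃ L, IsLabelling m σ L := by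
  classical
  let ℓ : Quotient (Perm.SameCycle.setoid σ) → ℕ+ :=
    Quotient.lift (cycleLen σ) fun _ _ h => cycleLen_eq_of_sameCycle h
  have h1 : ∀ a, Nat.card {o // ℓ o = a} = m a := by
    intro a
    rw [← h, Nat.card_eq_fintype_card, Fintype.card_subtype]
    simp only [cycleTypeOn, Finsupp.onFinset_apply]
    convert rfl using 2
    symm
    ext o
    induction o using Quotient.inductionOn with
    | h k =>
      simp only [Finset.mem_filter, Finset.mem_univ, true_and, Finset.mem_image]
      constructor
      · intro hk; exact ⟨k, hk, rfl⟩
      · rintro ⟨l, rfl, hl⟩; rw [← hl]; rfl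
  let e : Quotient (Perm.SameCycle.setoid σ) ≃ Σ a : ℕ+, Fin (m a) :=
    (Equiv.sigmaFiberEquiv ℓ).symm.trans
      (Equiv.sigmaCongrRight fun a => Finite.equivFinOfCardEq (h1 a))
  have he : ∀ o, (e o).1 = ℓ o := fun _ => rfl
  have key : ∀ k l, e (Quotient.mk _ k) = e (Quotient.mk _ l) ↔ σ.SameCycle k l := fun k l => by
    rw [e.injective.eq_iff, Quotient.eq]; rfl
  refine ⟨fun k => e (Quotient.mk _ k), key, fun s => ?_⟩
  obtain ⟨o, rfl⟩ := e.surjective s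
  induction o using Quotient.inductionOn with
  | h k =>
    rw [he]
    change _ = (cycleLen σ k : ℕ)
    rw [← card_cycle (S := Finset.univ) (by simp) (Finset.mem_univ k), ← Set.ncard_coe_finset]
    congr 1
    ext l
    simp only [Set.mem_ofPred_eq, Finset.coe_filter, Finset.mem_univ, true_and, key]
    exact Perm.sameCycle_comm

-- A labelling exists as soon as the cycle type is `m`, and any two differ by a unique permutation
-- of the labels that preserves the parts. There are `∏ m_a!` such permutations.
open Classical in
lemma card_isLabelling : Fintype.card {L // IsLabelling m σ L} =
    if cycleTypeOn Finset.univ σ = m then m.prod fun _ k => k.factorial else 0 := by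
  split_ifs with h
  · obtain ⟨L, hL⟩ := exists_isLabelling h
    have h1 : Function.Bijective (fun π : {π : Perm (Σ a : ℕ+, Fin (m a)) // Sigma.fst ∘ π = Sigma.fst} =>
        (⟨π.1 ∘ L, fun k l => by simp [hL.1], fun s => by
          rw [← π.1.apply_symm_apply s]
          have h2 : (π.1 (π.1.symm s)).1 = (π.1.symm s).1 := congrFun π.2 _
          rw [h2, ← hL.2]
          congr 1
          ext k
          exact π.1.injective.eq_iff⟩ : {L // IsLabelling m σ L})) := by
      constructor
      · rintro π π' h
        apply Subtype.ext
        ext1 s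
        obtain ⟨k, rfl⟩ := hL.surjective s
        exact congrFun (congrArg Subtype.val h) k
      · rintro ⟨L', hL'⟩
        choose κ hκ using hL.surjective
        have hinj : Function.Injective fun s => L' (κ s) := fun s s' hs => by
          rw [← hκ s, ← hκ s', hL.1, ← hL'.1]; exact hs
        refine ⟨⟨Equiv.ofBijective _ (Finite.injective_iff_bijective.1 hinj), ?_⟩, ?_⟩
        · funext s
          change (L' (κ s)).1 = s.1
          rw [hL'.fst_eq, ← hL.fst_eq, hκ]
        · apply Subtype.ext
          funext k
          change L' (κ (L k)) = L' k
          rw [hL'.1, ← hL.1, hκ]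
    rw [← Fintype.card_of_bijective h1, DomMulAct.stabilizer_card', Finsupp.prod]
    have h2 : Finset.univ.image (Sigma.fst : (Σ a : ℕ+, Fin (m a)) → ℕ+) = m.support := by
      ext a
      simp only [Finset.mem_image, Finset.mem_univ, true_and, Finsupp.mem_support_iff]
      constructor
      · rintro ⟨⟨a, i⟩, rfl⟩; exact i.pos.ne'
      · intro ha; exact ⟨⟨a, ⟨0, Nat.pos_of_ne_zero ha⟩⟩, rfl⟩
    rw [h2]
    exact Finset.prod_congr rfl fun a _ => by rw [card_labels_fst]
  · rw [Fintype.card_eq_zero_iff]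
    exact ⟨fun L => h L.2.cycleTypeOn_eq⟩

end labels

section

variable {d : ℕ}

open Classical in
/-- The transpositions. -/
def swaps (d : ℕ) : Finset (Perm (Fin d)) := Finset.univ.filter Perm.IsSwap

/-- A transposition arises from exactly two ordered pairs. -/
lemma sum_offDiag_swap (H : Perm (Fin d) → ℕ) :
    ∑ p ∈ (Finset.univ : Finset (Fin d)).offDiag, H (Equiv.swap p.1 p.2) = 2 * ∑ τ ∈ swaps d, H τ := by
  classical
  rw [← Finset.sum_fiberwise_of_maps_to (t := swaps d) (g := fun p => Equiv.swap p.1 p.2), Finset.mul_sum]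
  · refine Finset.sum_congr rfl fun τ hτ => ?_
    rw [Finset.sum_congr rfl fun p hp => by rw [(Finset.mem_filter.1 hp).2], Finset.sum_const,
      smul_eq_mul]
    congr 1
    obtain ⟨x, y, hxy, rfl⟩ := (Finset.mem_filter.1 hτ).2
    rw [Finset.card_eq_two]
    refine ⟨(x, y), (y, x), fun h => hxy (congrArg Prod.fst h), ?_⟩
    ext ⟨a, b⟩
    simp only [Finset.mem_filter, Finset.mem_offDiag, Finset.mem_univ, true_and, Finset.mem_insert,
      Finset.mem_singleton, Prod.mk.injEq]
    constructor
    · rintro ⟨hab, h⟩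
      have h1 := Equiv.congr_fun h a
      rw [Equiv.swap_apply_left] at h1
      by_cases hax : a = x
      · subst hax
        rw [Equiv.swap_apply_left] at h1
        exact Or.inl ⟨rfl, h1⟩
      · by_cases hay : a = y
        · subst hay
          rw [Equiv.swap_apply_right] at h1
          exact Or.inr ⟨rfl, h1⟩
        · rw [Equiv.swap_apply_of_ne_of_ne hax hay] at h1
          exact absurd h1.symm hab
    · rintro (⟨rfl, rfl⟩ | ⟨rfl, rfl⟩)
      · exact ⟨hxy, rfl⟩
      · exact ⟨hxy.symm, Equiv.swap_comm _ _⟩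
  · intro p hp
    exact Finset.mem_filter.2 ⟨Finset.mem_univ _, _, _, (Finset.mem_offDiag.1 hp).2.2, rfl⟩

lemma sum_words_swap (r : ℕ) (F : List (Perm (Fin d)) → ℕ) :
    ∑ w ∈ words (Finset.univ : Finset (Fin d)).offDiag r, F (w.map fun p => Equiv.swap p.1 p.2) =
      2 ^ r * ∑ v ∈ words (swaps d) r, F v := by
  induction r generalizing F with
  | zero => simp [words]
  | succ r ih =>
    rw [sum_words_succ, sum_words_succ]
    simp_rw [List.map_cons, fun p : Fin d × Fin d => ih fun v => F (Equiv.swap p.1 p.2 :: v)]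
    rw [sum_offDiag_swap fun τ => 2 ^ r * ∑ v ∈ words (swaps d) r, F (τ :: v), ← Finset.mul_sum,
      pow_succ]
    ring

/-- The permutations of the list act transitively. -/
def IsTransList (v : List (Perm (Fin d))) : Prop :=
  0 < d ∧ ∀ K : Set (Fin d), (∀ τ ∈ v, ∀ k, τ k ∈ K ↔ k ∈ K) → K = ∅ ∨ K = Set.univ

lemma isTransList_map (w : List (Fin d × Fin d)) :
    IsTransList (w.map fun p => Equiv.swap p.1 p.2) ↔ IsTransOn Finset.univ w := by
  classical
  have h0 : 0 < d ↔ (Finset.univ : Finset (Fin d)).Nonempty := by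
    rw [Finset.univ_nonempty_iff, Fin.pos_iff_nonempty]
  have h1 : ∀ K : Finset (Fin d), (∀ τ ∈ w.map fun p => Equiv.swap p.1 p.2, ∀ k,
      τ k ∈ (K : Set (Fin d)) ↔ k ∈ (K : Set (Fin d))) ↔ IsClosedUnder w K := by
    intro K
    simp only [List.forall_mem_map, Finset.mem_coe, IsClosedUnder]
    refine forall₂_congr fun p _ => ⟨fun h => ?_, fun h => swap_apply_mem_iff h⟩
    have := h p.2
    rwa [Equiv.swap_apply_right] at this
  rw [IsTransList, IsTransOn, h0]
  refine and_congr_right fun _ => ⟨fun h K _ hK => ?_, fun h K hK => ?_⟩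
  · have := h K ((h1 K).2 hK)
    simpa using this
  · have := h K.toFinset (Finset.subset_univ _) ((h1 _).1 (by simpa using hK))
    simpa using this

/-- The gluing permutations are the partial products of the local monodromies: consecutive quotients
return the letters, and the last permutation is the whole product. -/
lemma isMonodromy_iff {r : ℕ} {m : ℕ+ →₀ ℕ} {v : List (Perm (Fin d))} (hv : v ∈ words (swaps d) r)
    (L : Fin d → Σ a : ℕ+, Fin (m a)) :
    IsMonodromy d m ((fun i : Fin (r + 1) => (v.take i).prod), L) ↔
      IsTransList v ∧ IsLabelling m v.prod L := by
  classical
  obtain ⟨hlen, hsw⟩ := mem_words.1 hv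
  have hlast : (v.take (Fin.last r)).prod = v.prod := by rw [Fin.val_last, ← hlen, List.take_length]
  have hstep : ∀ i : Fin r, ((v.take i.castSucc).prod)⁻¹ * (v.take i.succ).prod =
      v[i]'(hlen ▸ i.2) := fun i => by
    rw [Fin.val_succ, List.prod_take_succ _ _ (hlen ▸ i.2), Fin.val_castSucc, inv_mul_cancel_left]
    rfl
  have htr : ∀ K : Set (Fin d), (∀ (j : Fin (r + 1)) k, (v.take j).prod k ∈ K ↔ k ∈ K) ↔
      ∀ τ ∈ v, ∀ k, τ k ∈ K ↔ k ∈ K := by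
    intro K
    constructor
    · intro h τ hτ k
      obtain ⟨i, hi, rfl⟩ := List.mem_iff_getElem.1 hτ
      have h1 := hstep ⟨i, hlen ▸ hi⟩
      change _ = v[i] at h1
      rw [← h1, Perm.mul_apply, ← h (Fin.castSucc ⟨i, hlen ▸ hi⟩), ← Perm.mul_apply,
        ← Perm.mul_apply, mul_assoc, mul_inv_cancel_left, h]
    · intro h j
      have : ∀ u : List (Perm (Fin d)), (∀ τ ∈ u, ∀ k, τ k ∈ K ↔ k ∈ K) →
          ∀ k, u.prod k ∈ K ↔ k ∈ K := by
        intro u hu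
        induction u with
        | nil => simp
        | cons τ u ih =>
          intro k
          rw [List.prod_cons, Perm.mul_apply, hu τ (by simp), ih fun τ' h' => hu τ' (by simp [h'])]
      exact this _ fun τ hτ => h τ (List.mem_of_mem_take hτ)
  constructor
  · intro h
    refine ⟨⟨h.pos, fun K hK => h.transitive K ((htr K).2 hK)⟩, fun k l => ?_, h.card⟩
    rw [← hlast]
    exact h.label k l
  · rintro ⟨⟨h1, h2⟩, h3, h4⟩
    refine ⟨h1, by simp, fun i => ?_, fun K hK => h2 K ((htr K).1 hK), fun k l => ?_, h4⟩
    · change (((v.take i.castSucc).prod)⁻¹ * (v.take i.succ).prod).IsSwap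
      rw [hstep]
      exact (Finset.mem_filter.1 (hsw _ (List.getElem_mem _))).2
    · rw [h3]
      change _ ↔ ((v.take (Fin.last r)).prod).SameCycle k l
      rw [hlast]

/-- Partial products and consecutive quotients translate between monodromy data and transitive words
of transpositions with labelled cycles. The factor `2 ^ r` pays for the ordered pairs, the
factorials for the labels. -/
lemma card_isMonodromy (r : ℕ) (m : ℕ+ →₀ ℕ) :
    Nat.card {t : (Fin (r + 1) → Perm (Fin d)) × (Fin d → Σ a : ℕ+, Fin (m a)) // IsMonodromy d m t} *
      2 ^ r = transCount d r m * m.prod fun _ k => k.factorial := by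
  classical
  let f : {x : List (Perm (Fin d)) × (Fin d → Σ a : ℕ+, Fin (m a)) //
      x ∈ (words (swaps d) r ×ˢ Finset.univ).filter fun x => IsTransList x.1 ∧ IsLabelling m x.1.prod x.2} →
      {t : (Fin (r + 1) → Perm (Fin d)) × (Fin d → Σ a : ℕ+, Fin (m a)) // IsMonodromy d m t} :=
    fun x => ⟨((fun i : Fin (r + 1) => (x.1.1.take i).prod), x.1.2), by
      have hx := Finset.mem_filter.1 x.2
      exact (isMonodromy_iff (Finset.mem_product.1 hx.1).1 _).2 hx.2⟩
  have hf : Function.Bijective f := by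
    constructor
    · rintro ⟨⟨v, L⟩, hx⟩ ⟨⟨v', L'⟩, hx'⟩ h
      have hv := (mem_words.1 (Finset.mem_product.1 (Finset.mem_filter.1 hx).1).1).1
      have hv' := (mem_words.1 (Finset.mem_product.1 (Finset.mem_filter.1 hx').1).1).1
      have h1 := congrArg Subtype.val h
      have h2 : L = L' := congrArg Prod.snd h1
      have h3 : ∀ i : Fin (r + 1), (v.take i).prod = (v'.take i).prod := congrFun (congrArg Prod.fst h1)
      have h4 : v = v' := by
        refine List.ext_getElem (hv.trans hv'.symm) fun i hi hi' => ?_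
        have e1 := h3 ⟨i, by simp only at hv; omega⟩
        have e2 := h3 ⟨i + 1, by simp only at hv; omega⟩
        simp only at e1 e2
        rw [List.prod_take_succ _ _ hi, List.prod_take_succ _ _ hi', e1] at e2
        exact mul_left_cancel e2
      subst h2 h4
      rfl
    · rintro ⟨⟨g, L⟩, ht⟩
      have hlen : (List.ofFn fun i : Fin r => (g i.castSucc)⁻¹ * g i.succ).length = r := List.length_ofFn
      set v := List.ofFn fun i : Fin r => (g i.castSucc)⁻¹ * g i.succ with hv
      have hg : ∀ i (hi : i < r + 1), (v.take i).prod = g ⟨i, hi⟩ := by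
        intro i
        induction i with
        | zero => intro _; rw [List.take_zero, List.prod_nil]; exact ht.zero.symm
        | succ i ih =>
          intro hi
          rw [List.prod_take_succ _ _ (by omega), ih (by omega)]
          simp only [hv, List.getElem_ofFn]
          exact mul_inv_cancel_left _ _
      have hvw : v ∈ words (swaps d) r := mem_words.2 ⟨hlen, fun τ hτ => by
        obtain ⟨i, rfl⟩ := List.mem_ofFn.1 hτ
        exact Finset.mem_filter.2 ⟨Finset.mem_univ _, ht.swap i⟩⟩
      have hg' : (fun i : Fin (r + 1) => (v.take i).prod) = g := funext fun i => hg i i.2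
      refine ⟨⟨(v, L), Finset.mem_filter.2 ⟨Finset.mem_product.2 ⟨hvw, Finset.mem_univ _⟩, ?_⟩⟩, ?_⟩
      · rw [← isMonodromy_iff hvw, hg']
        exact ht
      · exact Subtype.ext (Prod.ext hg' rfl)
  have h1 : ∀ v : List (Perm (Fin d)), (∑ L : Fin d → Σ a : ℕ+, Fin (m a),
      if IsTransList v ∧ IsLabelling m v.prod L then 1 else 0) =
      (if IsTransList v ∧ cycleTypeOn Finset.univ v.prod = m then 1 else 0) *
        m.prod fun _ k => k.factorial := by
    intro v
    by_cases hv : IsTransList v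
    · simp only [hv, true_and]
      rw [← Finset.card_filter, ← Fintype.card_subtype, card_isLabelling, ite_mul, one_mul, zero_mul]
    · simp [hv]
  rw [← Nat.card_eq_of_bijective f hf, Nat.card_eq_fintype_card, Fintype.card_coe, Finset.card_filter,
    Finset.sum_product]
  simp_rw [h1]
  rw [← Finset.sum_mul, mul_right_comm, mul_comm _ (2 ^ r), ← sum_words_swap, transCount, wordCount]
  congr 1
  refine Finset.sum_congr rfl fun w _ => if_congr ?_ rfl rfl
  rw [isTransList_map]
  rfl

end

end Hurwitz

end

noncomputable section

namespace Hurwitz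

open Finset.HasAntidiagonal (antidiagonal mem_antidiagonal)

/-! ### The recursion for the weighted numbers of factorizations -/

/-- The number of words, weighted by the orders of the symmetries. -/
def weight (d r : ℕ) (m : ℕ+ →₀ ℕ) : ℚ := transCount d r m / (2 ^ r * r.factorial * d.factorial)

/-- The binomials for distributing points and letters over two blocks are exactly absorbed by the
factorials in `weight`, as for products of exponential generating functions. -/
lemma choose_mul_weight_mul_weight {d r : ℕ} {e k : ℕ × ℕ} (he : e ∈ antidiagonal d)
    (hk : k ∈ antidiagonal r) (m m' : ℕ+ →₀ ℕ) :
    ((d.choose e.1 * (r.choose k.1 * (transCount e.1 k.1 m * transCount e.2 k.2 m')) : ℕ) : ℚ) /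
      (2 ^ r * r.factorial * d.factorial) = weight e.1 k.1 m * weight e.2 k.2 m' := by
  rw [mem_antidiagonal] at he hk
  subst he hk
  have h : ∀ a b : ℕ, (((a + b).choose a : ℕ) : ℚ) = (a + b).factorial / (a.factorial * b.factorial) :=
    fun a b => by
      rw [eq_div_iff (by positivity), ← mul_assoc, Nat.choose_symm_add]
      exact_mod_cast Nat.add_choose_mul_factorial_mul_factorial a b
  rw [weight, weight]
  push_cast
  rw [h, h, pow_add]
  field_simp

/-- Dividing the recursion for `transCount` by the normalisation leaves `1/2` from the extra power
of two, since the removed transposition was counted as two ordered pairs. -/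
lemma weight_succ {I : Finset ℕ+} {d : ℕ} (hI : ∀ a : ℕ+, (a : ℕ) ≤ d → a ∈ I) (r : ℕ) (m : ℕ+ →₀ ℕ) :
    weight d (r + 1) m * (r + 1) = 1 / 2 * ∑ i ∈ I, ∑ j ∈ I,
      ((if Finsupp.single (i + j) 1 ≤ m then (i : ℚ) * j *
          (weight d r (m - Finsupp.single (i + j) 1 + Finsupp.single i 1 + Finsupp.single j 1) *
              ((m - Finsupp.single (i + j) 1 + Finsupp.single i 1 : ℕ+ →₀ ℕ) j + 1) *
              ((m - Finsupp.single (i + j) 1 : ℕ+ →₀ ℕ) i + 1) +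
            ∑ q ∈ antidiagonal (m - Finsupp.single (i + j) 1 : ℕ+ →₀ ℕ), ∑ e ∈ antidiagonal d, ∑ k ∈ antidiagonal r,
              weight e.1 k.1 (q.1 + Finsupp.single i 1) * (q.1 i + 1) *
                (weight e.2 k.2 (q.2 + Finsupp.single j 1) * (q.2 j + 1))) else 0) +
        if Finsupp.single i 1 + Finsupp.single j 1 ≤ m then ((i : ℚ) + j) *
          (weight d r (m - (Finsupp.single i 1 + Finsupp.single j 1) + Finsupp.single (i + j) 1) *
            ((m - (Finsupp.single i 1 + Finsupp.single j 1) : ℕ+ →₀ ℕ) (i + j) + 1)) else 0) := by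
  have h0 : weight d (r + 1) m * (r + 1) =
      1 / 2 * ((transCount d (r + 1) m : ℚ) / (2 ^ r * r.factorial * d.factorial)) := by
    rw [weight, Nat.factorial_succ, pow_succ]
    push_cast
    have : (r : ℚ) + 1 ≠ 0 := by positivity
    field_simp
  rw [h0, transCount_succ hI]
  congr 1
  rw [Nat.cast_sum, Finset.sum_div]
  refine Finset.sum_congr rfl fun i _ => ?_
  rw [Nat.cast_sum, Finset.sum_div]
  refine Finset.sum_congr rfl fun j _ => ?_
  have hprod : ∀ q : (ℕ+ →₀ ℕ) × (ℕ+ →₀ ℕ),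
      ((((i : ℕ) * (q.1 i + 1)) * ((j : ℕ) * (q.2 j + 1)) * ∑ e ∈ antidiagonal d, d.choose e.1 *
        ∑ k ∈ antidiagonal r, r.choose k.1 * (transCount e.1 k.1 (q.1 + Finsupp.single i 1) *
          transCount e.2 k.2 (q.2 + Finsupp.single j 1)) : ℕ) : ℚ) / (2 ^ r * r.factorial * d.factorial) =
      (i : ℚ) * j * ∑ e ∈ antidiagonal d, ∑ k ∈ antidiagonal r,
              weight e.1 k.1 (q.1 + Finsupp.single i 1) * (q.1 i + 1) *
                (weight e.2 k.2 (q.2 + Finsupp.single j 1) * (q.2 j + 1)) := by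
    intro q
    rw [Nat.cast_mul, mul_div_assoc, Nat.cast_sum, Finset.sum_div, Finset.mul_sum, Finset.mul_sum]
    refine Finset.sum_congr rfl fun e he => ?_
    rw [Finset.mul_sum, Nat.cast_sum, Finset.sum_div, Finset.mul_sum, Finset.mul_sum]
    refine Finset.sum_congr rfl fun k hk => ?_
    rw [choose_mul_weight_mul_weight he hk]
    push_cast
    ring
  rw [add_right_comm, Nat.cast_add, Nat.cast_add, add_div, add_div]
  congr 1
  · split_ifs
    · rw [mul_add ((i : ℚ) * j), Finset.mul_sum, Nat.cast_sum, Finset.sum_div]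
      congr 1
      · rw [weight]
        push_cast
        ring
      · exact Finset.sum_congr rfl fun q _ => hprod q
    · simp
  · split_ifs
    · rw [weight]
      push_cast
      ring
    · simp

/-- Twice the genus, minus two. -/
def eulerDefect (d r : ℕ) (m : ℕ+ →₀ ℕ) : ℤ := r - 2 * d + m.sum fun a k => ((a : ℤ) - 1) * k

lemma sum_sub_one_add (m m' : ℕ+ →₀ ℕ) : (m + m').sum (fun a k => ((a : ℤ) - 1) * k) =
    m.sum (fun a k => ((a : ℤ) - 1) * k) + m'.sum fun a k => ((a : ℤ) - 1) * k :=
  Finsupp.sum_add_index' (by simp) fun a k l => by push_cast; ring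

lemma sum_sub_one_single (a : ℕ+) : (Finsupp.single a 1).sum (fun (a : ℕ+) (k : ℕ) => ((a : ℤ) - 1) * k) =
    (a : ℤ) - 1 := by
  rw [Finsupp.sum_single_index] <;> simp

lemma eulerDefect_add (d d' r r' : ℕ) (m m' : ℕ+ →₀ ℕ) :
    eulerDefect (d + d') (r + r') (m + m') = eulerDefect d r m + eulerDefect d' r' m' := by
  simp only [eulerDefect, sum_sub_one_add]
  push_cast
  ring

lemma eulerDefect_add_single (d r : ℕ) (m : ℕ+ →₀ ℕ) (a : ℕ+) :
    eulerDefect d r (m + Finsupp.single a 1) = eulerDefect d r m + a - 1 := by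
  simp only [eulerDefect, sum_sub_one_add, sum_sub_one_single]
  ring

lemma eulerDefect_succ (d r : ℕ) (m : ℕ+ →₀ ℕ) : eulerDefect d (r + 1) m = eulerDefect d r m + 1 := by
  simp only [eulerDefect]
  push_cast
  ring

/-- The empty word connects only a one-element set, where the permutation is a single fixed point:
the trivial cover of genus `0`. -/
lemma eulerDefect_of_transCount_zero {d : ℕ} {m : ℕ+ →₀ ℕ} (h : transCount d 0 m ≠ 0) :
    eulerDefect d 0 m = -2 := by
  classical
  rw [transCount, wordCount] at h
  obtain ⟨w, hw, hne⟩ := Finset.exists_ne_zero_of_sum_ne_zero h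
  obtain ⟨⟨h1, h2⟩, h3⟩ := (ite_ne_right_iff.1 hne).1
  obtain rfl : w = [] := List.length_eq_zero_iff.1 (mem_words.1 hw).1
  obtain ⟨x, -⟩ := h1
  have hd : d = 1 := by
    have := h2 {x} (Finset.subset_univ _) (by simp [IsClosedUnder])
    rcases this with h | h
    · simp at h
    · simpa using (congrArg Finset.card h).symm
  subst hd
  have hm : (m.sum fun a k => ((a : ℤ) - 1) * k) = 0 := by
    refine Finset.sum_eq_zero fun a ha => ?_
    have h4 := mul_cycleTypeOn (σ := wordPerm ([] : List (Fin 1 × Fin 1))) (S := Finset.univ)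
      (fun _ => by simp only [Finset.mem_univ]) a
    rw [h3] at h4
    have h5 : cycleCard Finset.univ (wordPerm ([] : List (Fin 1 × Fin 1))) a ≤ 1 :=
      (Finset.card_filter_le _ _).trans (by simp)
    rw [← h4] at h5
    have h6 : (a : ℕ) ≤ 1 := le_trans (Nat.le_mul_of_pos_right _
      (Nat.pos_of_ne_zero (Finsupp.mem_support_iff.1 ha))) h5
    have h7 : (a : ℕ) = 1 := le_antisymm h6 a.pos
    simp [h7]
  simp [eulerDefect, hm]

/-- Along the recursion a join within a transitive word raises the genus by one, a cut preserves it,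
and a join of two blocks adds the genera. Without this, nonzero counts could fail to appear in the
generating function, whose sum runs over natural numbers `g`. -/
lemma exists_genus {d r : ℕ} {m : ℕ+ →₀ ℕ} (h : transCount d r m ≠ 0) :
    ∃ g : ℕ, eulerDefect d r m = 2 * g - 2 := by
  induction r using Nat.strong_induction_on generalizing d m with
  | _ r ih =>
  cases r with
  | zero => exact ⟨0, by simpa using eulerDefect_of_transCount_zero h⟩
  | succ r =>
    have hI : ∀ a : ℕ+, (a : ℕ) ≤ d → a ∈ Finset.Icc 1 (Nat.succPNat d) := fun a ha =>
      Finset.mem_Icc.2 ⟨one_le, by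
        rw [← PNat.coe_le_coe, Nat.succPNat_coe]; omega⟩
    rw [transCount_succ hI] at h
    obtain ⟨i, -, h⟩ := Finset.exists_ne_zero_of_sum_ne_zero h
    obtain ⟨j, -, h⟩ := Finset.exists_ne_zero_of_sum_ne_zero h
    have hcases : ∀ a b c : ℕ, a + b + c ≠ 0 → a ≠ 0 ∨ b ≠ 0 ∨ c ≠ 0 := by omega
    rcases hcases _ _ _ h with h | h | h
    · obtain ⟨hle, h⟩ := ite_ne_right_iff.1 h
      obtain ⟨g, hg⟩ := ih r r.lt_succ_self (right_ne_zero_of_mul h)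
      refine ⟨g + 1, ?_⟩
      have := eulerDefect_add_single d r (m - Finsupp.single (i + j) 1) (i + j)
      rw [tsub_add_cancel_of_le hle] at this
      rw [eulerDefect_add_single, eulerDefect_add_single] at hg
      rw [eulerDefect_succ, this]
      push_cast
      linarith
    · obtain ⟨hle, h⟩ := ite_ne_right_iff.1 h
      obtain ⟨g, hg⟩ := ih r r.lt_succ_self (right_ne_zero_of_mul h)
      refine ⟨g, ?_⟩
      have := eulerDefect_add_single d r (m - (Finsupp.single i 1 + Finsupp.single j 1) + Finsupp.single i 1) j
      rw [add_assoc, tsub_add_cancel_of_le hle, eulerDefect_add_single] at this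
      rw [eulerDefect_add_single] at hg
      rw [eulerDefect_succ, this]
      push_cast at hg
      linarith
    · obtain ⟨hle, h⟩ := ite_ne_right_iff.1 h
      obtain ⟨q, hq, h⟩ := Finset.exists_ne_zero_of_sum_ne_zero h
      obtain ⟨e, he, h⟩ := Finset.exists_ne_zero_of_sum_ne_zero (right_ne_zero_of_mul h)
      obtain ⟨k, hk, h⟩ := Finset.exists_ne_zero_of_sum_ne_zero (right_ne_zero_of_mul h)
      have h := right_ne_zero_of_mul h
      rw [mem_antidiagonal] at hq he hk
      obtain ⟨g₁, h₁⟩ := ih k.1 (by omega) (left_ne_zero_of_mul h)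
      obtain ⟨g₂, h₂⟩ := ih k.2 (by omega) (right_ne_zero_of_mul h)
      refine ⟨g₁ + g₂, ?_⟩
      have := eulerDefect_add_single d r (m - Finsupp.single (i + j) 1) (i + j)
      rw [tsub_add_cancel_of_le hle, ← hq, ← he, ← hk, eulerDefect_add] at this
      rw [eulerDefect_add_single] at h₁ h₂
      rw [eulerDefect_succ, ← he, ← hk, this]
      push_cast
      linarith

end Hurwitz

end

noncomputable section

namespace Hurwitz

open Finset.HasAntidiagonal (antidiagonal mem_antidiagonal)

/-! ### Coefficients of the generating function -/

lemma eulerDefect_eq_iff (d r g : ℕ) (m : ℕ+ →₀ ℕ) : eulerDefect d r m = 2 * g - 2 ↔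
    (r : ℤ) = 2 * d + 2 * g - 2 - m.sum fun a k => ((a : ℤ) - 1) * k := by
  rw [eulerDefect]
  constructor <;> intro h <;> linarith

/-- The coefficient of the generating function, up to the power of `λ`. -/
def expWeight (n : Var →₀ ℕ) : ℚ := weight (n Var.t) (n Var.u) (zExponents n)

/-- The power of `λ` in the coefficient of the generating function. -/
def expDefect (n : Var →₀ ℕ) : ℤ := eulerDefect (n Var.t) (n Var.u) (zExponents n)

/-- At most one `g` satisfies the relation with `r`. If one does, `card_isMonodromy` cancels the
factorials of the labels; if none does, the count vanishes by `exists_genus`, so the formula holds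
for every exponent vector. -/
lemma coeff_generatingFunction {p : Sphere} {b : (r : ℕ) → Fin r → Sphere}
    (hb : ∀ r, Function.Injective (b r)) (hp : ∀ r i, b r i ≠ p) (n : Var →₀ ℕ) :
    MvPowerSeries.coeff n (generatingFunction p b) =
      LaurentPolynomial.C (expWeight n) * LaurentPolynomial.T (expDefect n) := by
  have h1 : ∀ g : ℕ, expDefect n = 2 * g - 2 → LaurentPolynomial.C
        (hurwitzNumber p (b (n Var.u)) (n Var.t) g (zExponents n) /
          (((zExponents n).prod fun _ k => (k.factorial : ℚ)) * (n Var.u).factorial)) *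
      LaurentPolynomial.T (2 * (g : ℤ) - 2) =
      LaurentPolynomial.C (expWeight n) * LaurentPolynomial.T (expDefect n) := by
    intro g hg
    rw [hg, hurwitzNumber_eq (hb _) (hp _) ((eulerDefect_eq_iff _ _ _ _).1 hg), expWeight, weight]
    congr 2
    have h2 := congrArg (Nat.cast : ℕ → ℚ) (card_isMonodromy (d := n Var.t) (n Var.u) (zExponents n))
    have h3 : ((zExponents n).prod fun _ k => (k.factorial : ℚ)) ≠ 0 :=
      Finset.prod_ne_zero_iff.2 fun a _ => by positivity
    have h4 : (((zExponents n).prod fun _ k => k.factorial : ℕ) : ℚ) =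
        (zExponents n).prod fun _ k => (k.factorial : ℚ) := Nat.cast_prod _ _
    push_cast [h4] at h2
    field_simp
    linear_combination h2
  change (∑ᶠ (g : ℕ) (_ : _), _) = _
  rw [finsum_congr fun g => finsum_congr fun hg => h1 g ((eulerDefect_eq_iff _ _ _ _).2 hg)]
  by_cases h0 : transCount (n Var.t) (n Var.u) (zExponents n) = 0
  · simp [expWeight, weight, h0]
  · obtain ⟨g, hg⟩ := exists_genus h0
    rw [finsum_eq_single _ g fun g' hg' => ?_]
    · exact finsum_eq_if.trans (if_pos ((eulerDefect_eq_iff _ _ _ _).1 hg))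
    · refine finsum_eq_if.trans (if_neg fun h => hg' ?_)
      have := hg.symm.trans ((eulerDefect_eq_iff _ _ _ _).2 h)
      omega

/-! ### Exponent vectors -/

@[simp] lemma zExponents_apply (n : Var →₀ ℕ) (a : ℕ+) : zExponents n a = n (Var.z a) := rfl

lemma exponents_ext {n n' : Var →₀ ℕ} (hz : zExponents n = zExponents n') (hu : n Var.u = n' Var.u)
    (ht : n Var.t = n' Var.t) : n = n' := by
  ext v
  cases v with
  | z a => exact DFunLike.congr_fun hz a
  | u => exact hu
  | t => exact ht

lemma zExponents_add (n n' : Var →₀ ℕ) : zExponents (n + n') = zExponents n + zExponents n' := by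
  ext a; simp

lemma zExponents_sub (n n' : Var →₀ ℕ) : zExponents (n - n') = zExponents n - zExponents n' := by
  ext a; simp

lemma zExponents_single_z (a : ℕ+) : zExponents (Finsupp.single (Var.z a) 1) = Finsupp.single a 1 := by
  classical
  ext c
  simp [Finsupp.single_apply]

lemma zExponents_single_u : zExponents (Finsupp.single Var.u 1) = 0 := by
  ext c
  simp

lemma le_iff_zExponents_le {k n : Var →₀ ℕ} (hu : k Var.u = 0) (ht : k Var.t = 0) :
    k ≤ n ↔ zExponents k ≤ zExponents n := by
  refine ⟨fun h a => h (Var.z a), fun h v => ?_⟩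
  cases v with
  | z a => exact h a
  | u => exact hu.trans_le (Nat.zero_le _)
  | t => exact ht.trans_le (Nat.zero_le _)

/-- The exponent vector of `z ^ m u ^ r t ^ d`. -/
def exponents (m : ℕ+ →₀ ℕ) (r d : ℕ) : Var →₀ ℕ :=
  m.mapDomain Var.z + Finsupp.single Var.u r + Finsupp.single Var.t d

lemma exponents_z (m : ℕ+ →₀ ℕ) (r d : ℕ) : zExponents (exponents m r d) = m := by
  ext a
  simp [exponents, Finsupp.mapDomain_apply Var.z_injective]

lemma exponents_u (m : ℕ+ →₀ ℕ) (r d : ℕ) : exponents m r d Var.u = r := by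
  simp [exponents, Finsupp.mapDomain_of_notMem_range (f := Var.z) (x := m) (a := Var.u) (by rintro ⟨_, h⟩; cases h)]

lemma exponents_t (m : ℕ+ →₀ ℕ) (r d : ℕ) : exponents m r d Var.t = d := by
  simp [exponents, Finsupp.mapDomain_of_notMem_range (f := Var.z) (x := m) (a := Var.t) (by rintro ⟨_, h⟩; cases h)]

lemma exponents_self (n : Var →₀ ℕ) : exponents (zExponents n) (n Var.u) (n Var.t) = n :=
  exponents_ext (exponents_z _ _ _) (exponents_u _ _ _) (exponents_t _ _ _)

lemma sum_antidiagonal_exponents [DecidableEq Var] (n : Var →₀ ℕ) (f : (Var →₀ ℕ) → (Var →₀ ℕ) → ℚ) :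
    ∑ q ∈ antidiagonal n, f q.1 q.2 = ∑ q ∈ antidiagonal (zExponents n),
      ∑ e ∈ antidiagonal (n Var.t), ∑ k ∈ antidiagonal (n Var.u),
        f (exponents q.1 k.1 e.1) (exponents q.2 k.2 e.2) := by
  simp_rw [← Finset.sum_product']
  refine Finset.sum_nbij'
    (fun q => ((zExponents q.1, zExponents q.2), (q.1 Var.t, q.2 Var.t), (q.1 Var.u, q.2 Var.u)))
    (fun x => (exponents x.1.1 x.2.2.1 x.2.1.1, exponents x.1.2 x.2.2.2 x.2.1.2)) ?_ ?_ ?_ ?_ ?_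
  · intro q hq
    rw [mem_antidiagonal] at hq
    simp only [Finset.mem_product, mem_antidiagonal, ← hq, zExponents_add, Finsupp.add_apply, and_self]
  · rintro ⟨q, e, k⟩ hx
    simp only [Finset.mem_product, mem_antidiagonal] at hx ⊢
    refine exponents_ext ?_ ?_ ?_
    · simp [zExponents_add, exponents_z, hx.1]
    · simp [exponents_u, hx.2.2]
    · simp [exponents_t, hx.2.1]
  · intro q _
    simp [exponents_self]
  · rintro ⟨q, e, k⟩ _
    simp [exponents_z, exponents_u, exponents_t]
  · intro q _
    simp [exponents_self]

end Hurwitz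

end

noncomputable section

namespace Hurwitz

open Finset.HasAntidiagonal (antidiagonal mem_antidiagonal)

/-! ### The cut-join equation -/

open Classical in
/-- The coefficient of the cut-join term, up to the power of `λ`. -/
def cutJoinWeight (n : Var →₀ ℕ) (i j : ℕ+) : ℚ :=
  (if Finsupp.single (Var.z (i + j)) 1 ≤ n then (i : ℚ) * j *
    (expWeight (n - Finsupp.single (Var.z (i + j)) 1 + Finsupp.single (Var.z i) 1 +
        Finsupp.single (Var.z j) 1) *
        ((n - Finsupp.single (Var.z (i + j)) 1 + Finsupp.single (Var.z i) 1 : Var →₀ ℕ) (Var.z j) + 1) *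
        ((n - Finsupp.single (Var.z (i + j)) 1 : Var →₀ ℕ) (Var.z i) + 1) +
      ∑ q ∈ antidiagonal (n - Finsupp.single (Var.z (i + j)) 1 : Var →₀ ℕ),
        expWeight (q.1 + Finsupp.single (Var.z i) 1) * (q.1 (Var.z i) + 1) *
          (expWeight (q.2 + Finsupp.single (Var.z j) 1) * (q.2 (Var.z j) + 1))) else 0) +
  if Finsupp.single (Var.z i) 1 + Finsupp.single (Var.z j) 1 ≤ n then ((i : ℚ) + j) *
    (expWeight (n - (Finsupp.single (Var.z i) 1 + Finsupp.single (Var.z j) 1) +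
      Finsupp.single (Var.z (i + j)) 1) *
      ((n - (Finsupp.single (Var.z i) 1 + Finsupp.single (Var.z j) 1) : Var →₀ ℕ) (Var.z (i + j)) + 1))
    else 0

/-- This is `weight_succ` in terms of exponent vectors. Parts exceeding the degree do not occur, so
any finite `I` containing all numbers up to the degree will do. -/
lemma expWeight_succ {I : Finset ℕ+} (n : Var →₀ ℕ) (hI : ∀ a : ℕ+, (a : ℕ) ≤ n Var.t → a ∈ I) :
    expWeight (n + Finsupp.single Var.u 1) * (n Var.u + 1) =
      1 / 2 * ∑ i ∈ I, ∑ j ∈ I, cutJoinWeight n i j := by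
  classical
  have h1 : expWeight (n + Finsupp.single Var.u 1) = weight (n Var.t) (n Var.u + 1) (zExponents n) := by
    simp [expWeight, zExponents_add, zExponents_single_u]
  rw [h1, weight_succ hI]
  congr 1
  refine Finset.sum_congr rfl fun i _ => Finset.sum_congr rfl fun j _ => ?_
  rw [cutJoinWeight]
  congr 1
  · refine if_ctx_congr ?_ (fun _ => ?_) fun _ => rfl
    · rw [le_iff_zExponents_le (by simp) (by simp), zExponents_single_z]
    · congr 2
      · simp [expWeight, zExponents_add, zExponents_sub, zExponents_single_z,
          ← zExponents_apply]
      · rw [sum_antidiagonal_exponents _ fun q q' => expWeight (q + Finsupp.single (Var.z i) 1) *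
          (q (Var.z i) + 1) * (expWeight (q' + Finsupp.single (Var.z j) 1) * (q' (Var.z j) + 1))]
        simp [expWeight, zExponents_add, zExponents_sub, zExponents_single_z,
          ← zExponents_apply, exponents_z, exponents_u, exponents_t]
  · refine if_ctx_congr ?_ (fun _ => ?_) fun _ => rfl
    · rw [le_iff_zExponents_le (by simp) (by simp), zExponents_add, zExponents_single_z,
        zExponents_single_z]
    · simp [expWeight, zExponents_add, zExponents_sub, zExponents_single_z, ← zExponents_apply]

lemma expDefect_add (n n' : Var →₀ ℕ) : expDefect (n + n') = expDefect n + expDefect n' := by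
  rw [expDefect, zExponents_add]
  exact eulerDefect_add _ _ _ _ _ _

lemma expDefect_single_z (a : ℕ+) : expDefect (Finsupp.single (Var.z a) 1) = a - 1 := by
  simp [expDefect, zExponents_single_z, eulerDefect]

lemma expDefect_single_u : expDefect (Finsupp.single Var.u 1) = 1 := by
  simp [expDefect, zExponents_single_u, eulerDefect]

section coeff

variable {G : Series}

lemma coeff_partialDeriv (hG : ∀ n, MvPowerSeries.coeff n G =
      LaurentPolynomial.C (expWeight n) * LaurentPolynomial.T (expDefect n)) (n : Var →₀ ℕ) (v : Var) :
    MvPowerSeries.coeff n (partialDeriv v G) =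
      LaurentPolynomial.C (expWeight (n + Finsupp.single v 1) * (n v + 1)) *
        LaurentPolynomial.T (expDefect n + expDefect (Finsupp.single v 1)) := by
  rw [partialDeriv, MvPowerSeries.coeff_pderiv, hG, expDefect_add]
  simp only [map_mul, map_add, map_natCast, map_one]
  ring

lemma coeff_z_mul (a : ℕ+) (F : Series) (n : Var →₀ ℕ) [Decidable (Finsupp.single (Var.z a) 1 ≤ n)] :
    MvPowerSeries.coeff n (z a * F) = if Finsupp.single (Var.z a) 1 ≤ n then
      MvPowerSeries.coeff (n - Finsupp.single (Var.z a) 1) F else 0 := by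
  rw [z, MvPowerSeries.X_def, MvPowerSeries.coeff_monomial_mul]
  simp

lemma coeff_z_mul_z_mul (a c : ℕ+) (F : Series) (n : Var →₀ ℕ)
    [Decidable (Finsupp.single (Var.z a) 1 + Finsupp.single (Var.z c) 1 ≤ n)] :
    MvPowerSeries.coeff n (z a * z c * F) =
      if Finsupp.single (Var.z a) 1 + Finsupp.single (Var.z c) 1 ≤ n then
      MvPowerSeries.coeff (n - (Finsupp.single (Var.z a) 1 + Finsupp.single (Var.z c) 1)) F else 0 := by
  rw [z, z, MvPowerSeries.X_def, MvPowerSeries.X_def, MvPowerSeries.monomial_mul_monomial,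
    MvPowerSeries.coeff_monomial_mul]
  simp

lemma cutJoinTerm_eq (i j : ℕ+) : cutJoinTerm G i j =
    MvPowerSeries.C (LaurentPolynomial.C ((i : ℚ) * j) * LaurentPolynomial.T 2) *
      (z (i + j) * (partialDeriv (Var.z i) (partialDeriv (Var.z j) G) +
        partialDeriv (Var.z i) G * partialDeriv (Var.z j) G)) +
    MvPowerSeries.C (LaurentPolynomial.C ((i : ℚ) + j)) * (z i * z j * partialDeriv (Var.z (i + j)) G) := by
  simp only [cutJoinTerm, lambdaSq, map_mul, map_add, map_natCast]
  ring

/-- All contributions carry the same power of `λ`. In a join, removing `z_{i+j}` lowers the exponent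
by `i + j - 1`, the derivatives add `i + j - 2` and `λ²` adds `2`; in a cut, removing `z_i z_j`
lowers it by `i + j - 2` and the derivative adds `i + j - 1`. -/
lemma coeff_cutJoinTerm (hG : ∀ n, MvPowerSeries.coeff n G =
      LaurentPolynomial.C (expWeight n) * LaurentPolynomial.T (expDefect n)) (n : Var →₀ ℕ) (i j : ℕ+) :
    MvPowerSeries.coeff n (cutJoinTerm G i j) =
      LaurentPolynomial.C (cutJoinWeight n i j) * LaurentPolynomial.T (expDefect n + 1) := by
  classical
  have hjoin : ∀ n : Var →₀ ℕ, MvPowerSeries.coeff n (partialDeriv (Var.z i) (partialDeriv (Var.z j) G) +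
        partialDeriv (Var.z i) G * partialDeriv (Var.z j) G) =
      LaurentPolynomial.C (expWeight (n + Finsupp.single (Var.z i) 1 + Finsupp.single (Var.z j) 1) *
        ((n + Finsupp.single (Var.z i) 1 : Var →₀ ℕ) (Var.z j) + 1) * (n (Var.z i) + 1) +
        ∑ q ∈ antidiagonal n, expWeight (q.1 + Finsupp.single (Var.z i) 1) * (q.1 (Var.z i) + 1) *
          (expWeight (q.2 + Finsupp.single (Var.z j) 1) * (q.2 (Var.z j) + 1))) *
        LaurentPolynomial.T (expDefect n + i + j - 2) := by
    intro n
    rw [map_add, map_add, add_mul]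
    congr 1
    · rw [partialDeriv, MvPowerSeries.coeff_pderiv, coeff_partialDeriv hG, expDefect_add,
        expDefect_single_z, expDefect_single_z, show expDefect n + (i - 1) + (j - 1) =
          expDefect n + i + j - 2 by ring, map_mul LaurentPolynomial.C _ ((n (Var.z i) : ℚ) + 1)]
      simp only [map_add, map_natCast, map_one]
      ring
    · rw [MvPowerSeries.coeff_mul, map_sum, Finset.sum_mul]
      refine Finset.sum_congr rfl fun q hq => ?_
      rw [coeff_partialDeriv hG, coeff_partialDeriv hG, mul_mul_mul_comm, ← map_mul,
        ← LaurentPolynomial.T_add, ← mem_antidiagonal.1 hq, expDefect_add,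
        expDefect_single_z, expDefect_single_z]
      congr 2
      ring
  have hadd : ∀ x y : ℚ, (LaurentPolynomial.C (x + y) * LaurentPolynomial.T (expDefect n + 1) : ℚ[T;T⁻¹]) =
      LaurentPolynomial.C x * LaurentPolynomial.T (expDefect n + 1) +
        LaurentPolynomial.C y * LaurentPolynomial.T (expDefect n + 1) := fun x y => by
    rw [map_add, add_mul]
  rw [cutJoinTerm_eq, map_add, MvPowerSeries.coeff_C_mul, MvPowerSeries.coeff_C_mul, coeff_z_mul,
    coeff_z_mul_z_mul, cutJoinWeight, hadd]
  congr 1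
  · split_ifs with hle
    · have h := expDefect_add (n - Finsupp.single (Var.z (i + j)) 1) (Finsupp.single (Var.z (i + j)) 1)
      rw [tsub_add_cancel_of_le hle, expDefect_single_z] at h
      rw [hjoin, map_mul LaurentPolynomial.C ((i : ℚ) * j), mul_mul_mul_comm, ← LaurentPolynomial.T_add, h]
      congr 2
      push_cast
      ring
    · simp
  · split_ifs with hle
    · have h := expDefect_add (n - (Finsupp.single (Var.z i) 1 + Finsupp.single (Var.z j) 1))
        (Finsupp.single (Var.z i) 1 + Finsupp.single (Var.z j) 1)
      rw [tsub_add_cancel_of_le hle, expDefect_add (Finsupp.single _ _), expDefect_single_z,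
        expDefect_single_z] at h
      rw [coeff_partialDeriv hG, ← mul_assoc, ← map_mul, expDefect_single_z, h]
      congr 2
      push_cast
      ring
    · simp

end coeff

lemma mem_support_of_cutJoinWeight_ne_zero {n : Var →₀ ℕ} {i j : ℕ+} (h : cutJoinWeight n i j ≠ 0) :
    n (Var.z (i + j)) ≠ 0 ∨ n (Var.z i) ≠ 0 ∧ n (Var.z j) ≠ 0 := by
  classical
  by_contra! hn
  refine h ?_
  have h1 : ¬ Finsupp.single (Var.z (i + j)) 1 ≤ n := fun hle => by
    have := hle (Var.z (i + j))
    simp [hn.1] at this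
  have h2 : ¬ Finsupp.single (Var.z i) 1 + Finsupp.single (Var.z j) 1 ≤ n := fun hle => by
    have hi := hle (Var.z i)
    have hj := hle (Var.z j)
    simp only [Finsupp.add_apply, Finsupp.single_eq_same] at hi hj
    exact (by omega : n (Var.z j) ≠ 0) (hn.2 (by omega))
  rw [cutJoinWeight, if_neg h1, if_neg h2, add_zero]

lemma hasFormalSum_cutJoinTerm {G : Series} (hG : ∀ n, MvPowerSeries.coeff n G =
      LaurentPolynomial.C (expWeight n) * LaurentPolynomial.T (expDefect n)) :
    HasFormalSum (fun ij : ℕ+ × ℕ+ => (1 / 2 : ℚ) • cutJoinTerm G ij.1 ij.2)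
      (partialDeriv Var.u G) := by
  classical
  intro n
  have hcoeff : ∀ ij : ℕ+ × ℕ+, MvPowerSeries.coeff n ((1 / 2 : ℚ) • cutJoinTerm G ij.1 ij.2) =
      LaurentPolynomial.C (1 / 2 * cutJoinWeight n ij.1 ij.2) * LaurentPolynomial.T (expDefect n + 1) := by
    intro ij
    have : MvPowerSeries.coeff n ((1 / 2 : ℚ) • cutJoinTerm G ij.1 ij.2) =
      (1 / 2 : ℚ) • MvPowerSeries.coeff n (cutJoinTerm G ij.1 ij.2) := rfl
    rw [this, coeff_cutJoinTerm hG, LaurentPolynomial.smul_eq_C_mul, map_mul, mul_assoc]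
  -- The bound `N` serves two purposes: beyond the exponents present in `n` the terms vanish, and
  -- the recursion needs all parts up to the degree.
  obtain ⟨N, hN⟩ : ∃ N : ℕ+, ∀ a : ℕ+, a ∈ (zExponents n).support ∨ (a : ℕ) ≤ n Var.t → a ≤ N := by
    obtain ⟨M, hM⟩ := (zExponents n).support.bddAbove
    refine ⟨M + Nat.succPNat (n Var.t), fun a ha => ?_⟩
    rw [← PNat.coe_le_coe, PNat.add_coe, Nat.succPNat_coe]
    rcases ha with ha | ha
    · have := PNat.coe_le_coe _ _ |>.2 (hM ha)
      omega
    · omega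
  have hmem : ∀ a : ℕ+, n (Var.z a) ≠ 0 → a ≤ N := fun a ha =>
    hN a (Or.inl (Finsupp.mem_support_iff.2 ha))
  have hsupp : ∀ ij : ℕ+ × ℕ+, MvPowerSeries.coeff n ((1 / 2 : ℚ) • cutJoinTerm G ij.1 ij.2) ≠ 0 →
      ij ∈ (Finset.Icc 1 N ×ˢ Finset.Icc 1 N : Finset (ℕ+ × ℕ+)) := by
    rintro ⟨i, j⟩ h
    rw [hcoeff] at h
    have hw : cutJoinWeight n i j ≠ 0 := fun h0 => h (by simp [h0])
    rw [Finset.mem_product, Finset.mem_Icc, Finset.mem_Icc]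
    rcases mem_support_of_cutJoinWeight_ne_zero hw with h1 | ⟨h1, h2⟩
    · have h3 := hmem _ h1
      exact ⟨⟨one_le, (PNat.lt_add_right i j).le.trans h3⟩, one_le, (PNat.lt_add_left j i).le.trans h3⟩
    · exact ⟨⟨one_le, hmem _ h1⟩, one_le, hmem _ h2⟩
  refine ⟨(Finset.finite_toSet _).subset hsupp, ?_⟩
  rw [finsum_eq_sum_of_support_subset _ hsupp, coeff_partialDeriv hG, expDefect_single_u,
    expWeight_succ n fun a ha => Finset.mem_Icc.2 ⟨one_le, hN a (Or.inr ha)⟩,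
    Finset.sum_congr rfl fun ij _ => hcoeff ij, ← Finset.sum_mul, ← map_sum, ← Finset.mul_sum,
    Finset.sum_product]

end Hurwitz

end

theorem mainTheorem9 (p : Hurwitz.Sphere) (b : (r : ℕ) → Fin r → Hurwitz.Sphere)
    (hb : ∀ r, Function.Injective (b r)) (hp : ∀ r i, b r i ≠ p) :
    (∀ (r d g : ℕ) (m : ℕ+ →₀ ℕ),
      Finite (Hurwitz.CoverClass p (b r) d g m) ∧
        ∀ X : Hurwitz.HurwitzCover p (b r) d g m, Finite (Hurwitz.HurwitzCover.Iso X X)) ∧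
    Hurwitz.HasFormalSum
      (fun ij : ℕ+ × ℕ+ =>
        (1 / 2 : ℚ) • Hurwitz.cutJoinTerm (Hurwitz.generatingFunction p b) ij.1 ij.2)
      (Hurwitz.partialDeriv Hurwitz.Var.u (Hurwitz.generatingFunction p b)) :=
  ⟨fun r d g m => Hurwitz.finite_coverClass (hb r) (hp r) d g m,
    Hurwitz.hasFormalSum_cutJoinTerm (Hurwitz.coeff_generatingFunction hb hp)⟩
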